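/- **Setting.** Let $d\ge 1$, $\mathbf B=\{x\in\mathbb R^d:|x|<1\}$, $x=(x_1,x')$, $D_j=-i\partial_j$, and let $$A=\sum_{j,k}(hD_j-V_j)g^{jk}(hD_k-V_k)+V$$ have real coefficients in $C^\infty(\mathbf B)$ with $(g^{jk})$ symmetric positive definite, $g^{1k}=\delta_{1k}$, $V_1=0$; the domain is $X=\{x_1>0\}$ in $\mathbf B$. Put $a(x,\xi)=\sum_{j,k} g^{jk}(\xi_j-V_j)(\xi_k-V_k)+V$. Let $\tau\in\mathbb R$, $\epsilon_0,\epsilon>0$, and $a(x,0)<\tau-\epsilon_0$ for $x\in\mathbf B$. *Phases.* Let $\mathcal D=\{(x,y,\theta):|x|,|y|<\tfrac34,\ |x-y|<\epsilon,\ |a(y,\theta)-\tau|<\epsilon\}$ and let $\varphi^0\in C^\infty(\mathcal D)$ be real, with $$a(x,\nabla_x\varphi^0)=a(y,\theta),\qquad \varphi^0|_{\langle x-y,\theta\rangle=0}=0,\qquad \nabla_x\varphi^0|_{x=y}=\theta .$$ Let $\mathcal O\subset\mathcal D$ be open and let $\varphi\in C^\infty(\mathcal O)$ be real, with $a(x,\nabla_x\varphi)=a(y,\theta)$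 on $\mathcal O\cap\{x_1\ge0\}$ and $\varphi=\varphi^0$, $\partial_{x_1}\varphi=-\partial_{x_1}\varphi^0$ on $\mathcal O\cap\{x_1=0\}$. *Amplitudes.* The transport equations for $(\varphi,(B_n)_{n\ge0})$ express that $e^{ih^{-1}\Phi}\sum_{n\ge 0} B_nh^n$, $\Phi=\varphi+ta(y,\theta)$, formally solves $(hD_t-A)u=0$; that is, with $p_k=\partial_{x_k}\varphi-V_k$ and $B_{-1}=0$, $$\partial_tB_n-2\sum_{j,k}g^{jk}p_k\,\partial_{x_j}B_n-\Bigl(\sum_{j,k}\partial_{x_j}(g^{jk}p_k)\Bigr)B_n=-i\sum_{j,k}\partial_{x_j}\bigl(g^{jk}\partial_{x_k}B_{n-1}\bigr),\qquad n\ge 0 .$$ Let $B^0_n(x,t,y,\theta)$ be smooth complex-valued functions on $\{(x,y,\theta)\in\mathcal D,\ |x-y|+|t|<\epsilon\}$ satisfying the transport equations for $\varphi^0$ there, with $|\partial_{x,t}^\alpha\partial_y^\beta\partial_\theta^\gamma B^0_n|\le K_{n\alpha\beta\gamma}$. Let $B_n(x,t,y,\theta)$ be smooth complex-valued functions on $\{(x,y,\theta)\in\mathcal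 O,\ |x-y|+|t|<\epsilon\}$ which satisfy the transport equations for $\varphi$ where $x_1\ge0$ and one of the following two boundary conditions (the same for all $n$) where $x_1=0$: $$B_n=-B_n^0 ,\qquad\text{or}\qquad \varphi_{x_1}B_n-i\partial_{x_1}B_{n-1}=\varphi_{x_1}B_n^0+i\partial_{x_1}B^0_{n-1}\quad(B_{-1}=B^0_{-1}=0).$$ *Reflected rays.* For $T>0$ say that $(x,t)$ is $T$-*reached* (for given $y,\theta$) if an integral curve, followed in one of its two directions, of the field $\frac{d}{dt}=\partial_t-\sum_{j,k}2g^{jk}p_k\partial_{x_j}$ (with $p=\nabla_x\varphi-(V_1,\dots,V_d)$) leads from a point $(\bar x,\bar t)$ with $\bar x_1=0$ to $(x,t)$ and up to $(x,t)$ stays in $\{x_1\ge 0,\ |x-y|+|t|\le T\}$ and over $\mathcal O$. Put $\sigma=|\partial_{x_1}\varphi(\bar x,y,\theta)|$. **Proposition.** There is a constant $C_0>0$ depending only on $A,\tau,\epsilon_0,\epsilon,\varphi^0$, and for all $n$, all multi-indices $\alpha$ (in $(x,t)$, with $\alpha_1$ the order in $x_1$), $\beta$, $\gamma$, and all families of constants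 $(K_{n\alpha\beta\gamma})$, there is a constant $C$ depending only on these and on $A,\tau,\epsilon_0,\epsilon,\varphi^0$, such that, for all $B^0_n$, $\mathcal O$, $\varphi$, $B_n$ as above, all $T>0$, all $y,\theta$ with $|y|\le\frac12$, $y_1\ge0$, $|a(y,\theta)-\tau|\le\frac\epsilon2$, and all $T$-reached $(x,t)$ with $\sigma\ge C_0T$, $$|\partial_{x,t}^\alpha\partial_y^\beta\partial_\theta^\gamma B_n(x,t,y,\theta)|\le C\begin{cases}1+T\sigma^{-1-|\alpha|-|\beta|-|\gamma|}&\text{if }\alpha_1=n=0,\\ \sigma^{-3n-\alpha_1-|\alpha|-|\beta|-|\gamma|}&\text{if }\alpha_1+n\ge1,\end{cases}$$ and, if $|\gamma'|\ge1$, where $\gamma=(\gamma_1,\gamma')$ (at least one derivative with respect to $\theta'=(\theta_2,\dots,\theta_d)$), $$|\partial_{x,t}^\alpha\partial_y^\beta\partial_\theta^\gamma B_n(x,t,y,\theta)|\le C\begin{cases}1+T\sigma^{-|\alpha|-|\beta|-|\gamma|}&\text{if }\alpha_1=n=0,\\ \sigma^{1-3n-\alpha_1-|\alpha|-|\beta|-|\gamma|}&\text{if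 }\alpha_1+n\ge1.\end{cases}$$ -/

import Mathlib

open scoped ContDiff

/-- Points of `ℝ^d`.  The coordinate called `x₁` in the text is the coordinate with index `0`, and
the domain is the half-space `x₁ > 0`. -/
abbrev Sp (d : ℕ) : Type := EuclideanSpace ℝ (Fin d)

/-- The variables `(x, y, θ)` of a phase function. -/
abbrev PhasePt (d : ℕ) : Type := Sp d × Sp d × Sp d

/-- The variables `(x, t, y, θ)` of an amplitude. -/
abbrev AmpPt (d : ℕ) : Type := Sp d × ℝ × Sp d × Sp d

/-- The partial derivative `∂u/∂x_j` of a function on `ℝ^d`. -/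
noncomputable def xpartial {d : ℕ} {F : Type} [NormedAddCommGroup F] [NormedSpace ℝ F]
    (j : Fin d) (u : Sp d → F) (x : Sp d) : F :=
  fderiv ℝ u x (EuclideanSpace.single j 1)

/-! ### Mixed partial derivatives of amplitudes -/

/-- Directional derivative, as an operator on functions of `(x, t, y, θ)`. -/
noncomputable def dirDeriv {d : ℕ} (v : AmpPt d) (F : AmpPt d → ℂ) : AmpPt d → ℂ :=
  fun z => fderiv ℝ F z v

/-- `∂_{v_0}^{α_0} ⋯ ∂_{v_{d-1}}^{α_{d-1}} F` for a family of directions `v` and a multi-index `α`. -/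
noncomputable def multiDeriv {d : ℕ} (v : Fin d → AmpPt d) (α : Fin d → ℕ)
    (F : AmpPt d → ℂ) : AmpPt d → ℂ :=
  (List.finRange d).foldr (fun i G => (dirDeriv (v i))^[α i] G) F

/-- `∂_x^α ∂_t^m ∂_y^β ∂_θ^γ F`. -/
noncomputable def ampDeriv {d : ℕ} (α : Fin d → ℕ) (m : ℕ) (β γ : Fin d → ℕ)
    (F : AmpPt d → ℂ) : AmpPt d → ℂ :=
  multiDeriv (fun i => (EuclideanSpace.single i 1, 0, 0, 0)) α
    ((dirDeriv (0, 1, 0, 0))^[m]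
      (multiDeriv (fun i => (0, 0, EuclideanSpace.single i 1, 0)) β
        (multiDeriv (fun i => (0, 0, 0, EuclideanSpace.single i 1)) γ F)))

/-- `|α| + |β| + |γ|`, where the multi-index in `(x, t)` consists of `α` (for `x`) and `m` (for `t`). -/
def totalOrder {d : ℕ} (α : Fin d → ℕ) (m : ℕ) (β γ : Fin d → ℕ) : ℕ :=
  ((∑ i, α i) + m) + (∑ i, β i) + ∑ i, γ i

/-! ### The operator -/

/-- The coefficients of the elliptic operator
`A = ∑_{j,k} (h D_j - V_j) g^{jk} (h D_k - V_k) + V`, `D_j = -i ∂_j`, smooth in the unit ball, in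
coordinates in which the boundary is `x₁ = 0`, `g^{1k} = δ_{1k}` and `V₁ = 0`. -/
structure SchrodingerOp (d : ℕ) [NeZero d] where
  /-- the metric `g^{jk}` -/
  g : Sp d → Matrix (Fin d) (Fin d) ℝ
  /-- the magnetic potential `(V_1, …, V_d)` -/
  W : Sp d → Fin d → ℝ
  /-- the scalar potential `V` -/
  V : Sp d → ℝ
  smooth_g : ∀ j k, ContDiffOn ℝ ∞ (fun x => g x j k) (Metric.ball 0 1)
  smooth_W : ∀ j, ContDiffOn ℝ ∞ (fun x => W x j) (Metric.ball 0 1)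
  smooth_V : ContDiffOn ℝ ∞ V (Metric.ball 0 1)
  elliptic : ∀ x ∈ Metric.ball (0 : Sp d) 1, (g x).PosDef
  normal_g : ∀ x ∈ Metric.ball (0 : Sp d) 1, ∀ k, g x 0 k = if k = 0 then 1 else 0
  normal_W : ∀ x ∈ Metric.ball (0 : Sp d) 1, W x 0 = 0

namespace SchrodingerOp

variable {d : ℕ} [NeZero d]

/-- The principal symbol `a(x, ξ) = ∑ g^{jk} (ξ_j - V_j) (ξ_k - V_k) + V`. -/
noncomputable def symbol (P : SchrodingerOp d) (x : Sp d) (ξ : Fin d → ℝ) : ℝ :=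
  (∑ j, ∑ k, P.g x j k * (ξ j - P.W x j) * (ξ k - P.W x k)) + P.V x

/-- `∑_k g^{jk} (∂_{x_k} φ - V_k)` at `(x, y, θ)`; this is half of the component
`a^{(j)}(x, ∇_x φ) = (∂a/∂ξ_j)(x, ∇_x φ)` of the group velocity. -/
noncomputable def halfVelocity (P : SchrodingerOp d) (φ : PhasePt d → ℝ) (y θ : Sp d)
    (j : Fin d) (x : Sp d) : ℝ :=
  ∑ k, P.g x j k * (xpartial k (fun z => φ (z, y, θ)) x - P.W x k)

end SchrodingerOp

section Optics

variable {d : ℕ} [NeZero d]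

/-- The eikonal equation `a(x, ∇_x φ) = a(y, θ)` at the point `p = (x, y, θ)`. -/
def EikonalAt (P : SchrodingerOp d) (φ : PhasePt d → ℝ) (p : PhasePt d) : Prop :=
  P.symbol p.1 (fun j => xpartial j (fun z => φ (z, p.2.1, p.2.2)) p.1)
    = P.symbol p.2.1 (fun j => p.2.2 j)

/-- `B_{n-1}`, with the convention `B_{-1} = 0`. -/
def prevAmp (B : ℕ → AmpPt d → ℂ) : ℕ → AmpPt d → ℂ
  | 0 => fun _ => 0
  | n + 1 => B n

/-- The transport equations on the set `S`.  They say that the coefficient of `h^{n+1}` in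
`e^{-iΦ/h} (h D_t - A) (e^{iΦ/h} ∑ B_n h^n)`, `Φ = φ + t a(y, θ)`, vanishes for every `n`:
`∂_t B_n - ∑_j a^{(j)} ∂_j B_n - (∑_j ∂_j ∑_k g^{jk} (∂_k φ - V_k)) B_n
  = -i ∑_j ∂_j ∑_k g^{jk} ∂_k B_{n-1}`. -/
def TransportOn (P : SchrodingerOp d) (φ : PhasePt d → ℝ) (S : Set (AmpPt d))
    (B : ℕ → AmpPt d → ℂ) : Prop :=
  ∀ (n : ℕ) (x : Sp d) (t : ℝ) (y θ : Sp d), (x, t, y, θ) ∈ S →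
    deriv (fun s => B n (x, s, y, θ)) t
      - 2 * ∑ j, (P.halfVelocity φ y θ j x : ℂ) * xpartial j (fun z => B n (z, t, y, θ)) x
      - ((∑ j, xpartial j (P.halfVelocity φ y θ j) x : ℝ) : ℂ) * B n (x, t, y, θ)
    = -Complex.I * ∑ j, xpartial j
        (fun z => ∑ k, (P.g z j k : ℂ) * xpartial k (fun w => prevAmp B n (w, t, y, θ)) z) x

/-- `(x, y, θ)` with `x`, `y` in the ball of radius `3/4`, `|x - y| < ε` and `|a(y, θ) - τ| < ε`. -/
def phaseDomain (P : SchrodingerOp d) (τ ε : ℝ) : Set (PhasePt d) :=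
  {p | ‖p.1‖ < 3 / 4 ∧ ‖p.2.1‖ < 3 / 4 ∧ ‖p.1 - p.2.1‖ < ε ∧
    |P.symbol p.2.1 (fun j => p.2.2 j) - τ| < ε}

/-- `(x, t, y, θ)` with `(x, y, θ) ∈ O` and `|x - y| + |t| < ε`. -/
def ampDomain (O : Set (PhasePt d)) (ε : ℝ) : Set (AmpPt d) :=
  {z | (z.1, z.2.2.1, z.2.2.2) ∈ O ∧ ‖z.1 - z.2.2.1‖ + |z.2.1| < ε}

/-- The phase of the incident (free space) wave. -/
structure IncidentPhase (P : SchrodingerOp d) (τ ε : ℝ) (φ₀ : PhasePt d → ℝ) : Prop where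
  smooth : ContDiffOn ℝ ∞ φ₀ (phaseDomain P τ ε)
  eikonal : ∀ p ∈ phaseDomain P τ ε, EikonalAt P φ₀ p
  vanishing : ∀ x y θ, (x, y, θ) ∈ phaseDomain P τ ε → inner ℝ (x - y) θ = 0 → φ₀ (x, y, θ) = 0
  gradient : ∀ y θ, (y, y, θ) ∈ phaseDomain P τ ε →
    ∀ j, xpartial j (fun z => φ₀ (z, y, θ)) y = θ j

/-- The amplitudes of the incident wave: solutions of the transport equations, uniformly smooth
with the constants `K`. -/
structure IncidentAmplitudes (P : SchrodingerOp d) (τ ε : ℝ) (φ₀ : PhasePt d → ℝ)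
    (K : ℕ → (Fin d → ℕ) → ℕ → (Fin d → ℕ) → (Fin d → ℕ) → ℝ) (B₀ : ℕ → AmpPt d → ℂ) : Prop where
  smooth : ∀ n, ContDiffOn ℝ ∞ (B₀ n) (ampDomain (phaseDomain P τ ε) ε)
  transport : TransportOn P φ₀ (ampDomain (phaseDomain P τ ε) ε) B₀
  bounded : ∀ n α m β γ, ∀ z ∈ ampDomain (phaseDomain P τ ε) ε,
    ‖ampDeriv α m β γ (B₀ n) z‖ ≤ K n α m β γ

/-- The reflected phase, smooth in the open set `O` (hence up to `x₁ = 0`), a solution of the eikonal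
equation where `x₁ ≥ 0`, which on the boundary agrees with the incident phase and has the opposite
normal derivative. -/
structure ReflectedPhase (P : SchrodingerOp d) (τ ε : ℝ) (φ₀ : PhasePt d → ℝ)
    (O : Set (PhasePt d)) (φ : PhasePt d → ℝ) : Prop where
  isOpen : IsOpen O
  subset : O ⊆ phaseDomain P τ ε
  smooth : ContDiffOn ℝ ∞ φ O
  eikonal : ∀ p ∈ O, 0 ≤ p.1 0 → EikonalAt P φ p
  boundary : ∀ x y θ, (x, y, θ) ∈ O → x 0 = 0 → φ (x, y, θ) = φ₀ (x, y, θ)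
  reflection : ∀ x y θ, (x, y, θ) ∈ O → x 0 = 0 →
    xpartial 0 (fun z => φ (z, y, θ)) x = -xpartial 0 (fun z => φ₀ (z, y, θ)) x

/-- Dirichlet matching: `B_n = -B⁰_n` for `x₁ = 0`. -/
def DirichletMatching (O : Set (PhasePt d)) (ε : ℝ) (B₀ B : ℕ → AmpPt d → ℂ) : Prop :=
  ∀ n, ∀ z ∈ ampDomain O ε, z.1 0 = 0 → B n z = -B₀ n z

/-- Neumann matching: `φ_{x₁} B_n - i ∂_{x₁} B_{n-1} = φ_{x₁} B⁰_n + i ∂_{x₁} B⁰_{n-1}`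
for `x₁ = 0`. -/
def NeumannMatching (O : Set (PhasePt d)) (ε : ℝ) (φ : PhasePt d → ℝ)
    (B₀ B : ℕ → AmpPt d → ℂ) : Prop :=
  ∀ (n : ℕ) (x : Sp d) (t : ℝ) (y θ : Sp d), (x, t, y, θ) ∈ ampDomain O ε → x 0 = 0 →
    (xpartial 0 (fun z => φ (z, y, θ)) x : ℂ) * B n (x, t, y, θ)
        - Complex.I * xpartial 0 (fun z => prevAmp B n (z, t, y, θ)) x
      = (xpartial 0 (fun z => φ (z, y, θ)) x : ℂ) * B₀ n (x, t, y, θ)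
        + Complex.I * xpartial 0 (fun z => prevAmp B₀ n (z, t, y, θ)) x

/-- The amplitudes of the formal reflected wave: smooth up to the boundary, solutions of the
transport equations for `x₁ ≥ 0`, with one of the two boundary conditions. -/
structure ReflectedAmplitudes (P : SchrodingerOp d) (ε : ℝ) (O : Set (PhasePt d))
    (φ : PhasePt d → ℝ) (B₀ B : ℕ → AmpPt d → ℂ) : Prop where
  smooth : ∀ n, ContDiffOn ℝ ∞ (B n) (ampDomain O ε)
  transport : TransportOn P φ (ampDomain O ε ∩ {z | 0 ≤ z.1 0}) B
  matching : DirichletMatching O ε B₀ B ∨ NeumannMatching O ε φ B₀ B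

/-- `(x, t)` lies on a reflected ray which issues from the boundary and stays, up to `(x, t)`, in the
region `x₁ ≥ 0`, `|x - y| + |t| ≤ T`.  The ray is an integral curve (followed in one of the two
directions `ς = ±1`) of the field `d/dt = ∂_t - ∑_j a^{(j)}(x, ∇_x φ) ∂_j`, and `σ` is the value of
`|∂_{x₁} φ|` at its initial point on the boundary. -/
def OnReflectedRay (P : SchrodingerOp d) (O : Set (PhasePt d)) (φ : PhasePt d → ℝ)
    (T σ : ℝ) (x : Sp d) (t : ℝ) (y θ : Sp d) : Prop :=
  ∃ (s ς : ℝ) (X : ℝ → Sp d) (u : ℝ → ℝ),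
    0 ≤ s ∧ (ς = 1 ∨ ς = -1) ∧ X s = x ∧ u s = t ∧
    X 0 0 = 0 ∧ σ = |xpartial 0 (fun z => φ (z, y, θ)) (X 0)| ∧
    ∀ r ∈ Set.Icc 0 s,
      (X r, y, θ) ∈ O ∧ 0 ≤ X r 0 ∧ ‖X r - y‖ + |u r| ≤ T ∧
      HasDerivWithinAt u ς (Set.Icc 0 s) r ∧
      ∀ j, HasDerivWithinAt (fun q => X q j) (-ς * (2 * P.halfVelocity φ y θ j (X r)))
        (Set.Icc 0 s) r

end Optics

/-! ### Weighted symbol classes for jets at a family of points -/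

open Asymptotics Filter Topology

/-! Derivatives are counted with weights: 2 for x₁; 1 for x', t, y and θ₁; 0 for θ'. Say that a
quantity has order s if every iterated derivative D_w of it is O(σ^(s - wt w)). On rays whose
diameter T is small compared to σ, φ_{x₁} has order 1, the other components of ∇φ have order 0, and
B_n has order -3n. The weight of the derivative with indices α, β, γ is α₁ + |α| + |β| + γ₁, so
these orders give the estimates with α₁ + n ≥ 1; a θ'-derivative costs nothing, which is the gain in
the second group of estimates.

The weights fit the transport field. Since g^{1k} = δ_{1k} and V₁ = 0, its coefficient at ∂_{x₁} is
-2φ_{x₁}, of order 1, and the other coefficients have order 0. Hence the field lowers orders by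
exactly one, whereas a ray has length at most 2T, a multiple of σ. Rescaled derivatives v along a
ray satisfy |v'| ≤ Cσ⁻¹(1 + |v|), and Gronwall's inequality carries order s from the boundary along
the ray at the cost of a bounded factor (`RayFrame.isSym_of_bd`). The gradient of φ solves such
equations by differentiation of the eikonal equation (`OpCoeffs.van_force`), but quasilinear ones:
its first derivatives enter quadratically. For these a barrier argument is used on rays with a large
multiple of the length below σ (`RayFrame.exists_first_order_bound`). This determines C₀ before any
amplitude enters. From second derivatives of the gradient on, the equations are linear in the
highest derivatives.

At the boundary, tangential derivatives are those of the incident data. The critical ones are the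
θ'-derivatives of φ_{x₁}, which must be O(σ): on the diagonal ∂_{x₁}φ⁰ = θ₁, so they are O(|x - y|)
= O(T) (`Background.phase_tangential`). Normal derivatives are found by solving the transport
equation for them and dividing by φ_{x₁}, which has modulus σ at the boundary points considered;
order s - 1 becomes s - 2, which explains the weight 2 (`isSym_succ_of_field`).

For amplitudes the source contains two derivatives of weight at most 2 and integration along the ray
gains one power: a loss of 3 for each n. The Neumann condition also loses 3, by one normal
derivative and one division by φ_{x₁}. If α₁ = n = 0, the derivative is bounded at the initial
point, and its derivative along the ray, O(σ^(-1 - wt)), is integrated over a length at most 2T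
(`Background.refl_zero_bound`).

Uniformity in O, φ and B is obtained by treating all admissible data as one family: `=O[⊤]` is a
bound uniform over the index type. Phases and amplitudes are cut off near each ray, and the
equations are kept in the form that all relevant derivatives of a defect vanish at the points of the
ray (`Background.exists_datum`). -/

/-- A commutative algebra with commuting derivations `D i` of weights `wt i`, evaluated at a family
of points indexed by `κ`, each of which carries a scale `σ`. -/
structure JetFrame (I κ ℛ : Type*) [CommRing ℛ] [Algebra ℂ ℛ] where
  /-- the derivations -/
  D : I → Derivation ℂ ℛ ℛ
  D_comm : ∀ i j F, D i (D j F) = D j (D i F)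
  /-- evaluation at the points -/
  ev : ℛ →ₐ[ℂ] (κ → ℂ)
  /-- the scales -/
  σ : κ → ℝ
  σ_pos : ∀ k, 0 < σ k
  σ_bdd : ∃ S, ∀ k, σ k ≤ S
  /-- the weights -/
  wt : I → ℕ

namespace JetFrame

variable {I J κ κ' ℛ : Type*} [CommRing ℛ] [Algebra ℂ ℛ] (𝔽 : JetFrame I κ ℛ)

/-- The iterated derivative along a word; the first letter acts first. -/
def word : List I → ℛ → ℛ
  | [], F => F
  | i :: w, F => word w (𝔽.D i F)

/-- The weight of a word. -/
def wordWt (w : List I) : ℕ := (w.map 𝔽.wt).sum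

/-- `D_w F = O(σ ^ (s - wt w))` for all words `w` of cost at most `M`, with an additional factor `A`
for the words of cost equal to `M`. -/
def IsSym (c : I → ℕ) (A : κ → ℝ) (M : ℕ) (s : ℤ) (F : ℛ) : Prop :=
  ∀ w : List I, (w.map c).sum ≤ M → 𝔽.ev (𝔽.word w F) =O[⊤]
    fun k => (if (w.map c).sum = M then A k else 1) * 𝔽.σ k ^ (s - (𝔽.wordWt w : ℤ))

/-- All iterated derivatives of `F` vanish at the points of the frame. -/
def Van (F : ℛ) : Prop := ∀ w : List I, 𝔽.ev (𝔽.word w F) = 0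

/-- The frame with derivations selected by `f`. -/
def comap (f : J → I) : JetFrame J κ ℛ where
  D j := 𝔽.D (f j)
  D_comm _ _ F := 𝔽.D_comm _ _ F
  ev := 𝔽.ev
  σ := 𝔽.σ
  σ_pos := 𝔽.σ_pos
  σ_bdd := 𝔽.σ_bdd
  wt j := 𝔽.wt (f j)

/-- The frame with points selected by `p`. -/
def reindex (p : κ' → κ) : JetFrame I κ' ℛ where
  D := 𝔽.D
  D_comm := 𝔽.D_comm
  ev := { toFun := fun F k => 𝔽.ev F (p k)
          map_one' := by ext; simp
          map_mul' := by intros; ext; simp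
          map_zero' := by ext; simp
          map_add' := by intros; ext; simp
          commutes' := by intros; ext; simp }
  σ k := 𝔽.σ (p k)
  σ_pos k := 𝔽.σ_pos _
  σ_bdd := let ⟨S, hS⟩ := 𝔽.σ_bdd; ⟨S, fun k => hS _⟩
  wt := 𝔽.wt

variable {𝔽}

@[simp] lemma word_nil (F : ℛ) : 𝔽.word [] F = F := rfl
@[simp] lemma word_cons (i : I) (w : List I) (F : ℛ) :
    𝔽.word (i :: w) F = 𝔽.word w (𝔽.D i F) := rfl
@[simp] lemma wordWt_nil : 𝔽.wordWt [] = 0 := rfl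
@[simp] lemma wordWt_cons (i : I) (w : List I) :
    𝔽.wordWt (i :: w) = 𝔽.wt i + 𝔽.wordWt w := rfl

lemma word_add (w : List I) (F G : ℛ) : 𝔽.word w (F + G) = 𝔽.word w F + 𝔽.word w G := by
  induction w generalizing F G with
  | nil => rfl
  | cons i w ih => simp [ih]

lemma word_zero (w : List I) : 𝔽.word w 0 = 0 := by
  induction w with
  | nil => rfl
  | cons i w ih => simp [ih]

lemma word_smul (w : List I) (a : ℂ) (F : ℛ) : 𝔽.word w (a • F) = a • 𝔽.word w F := by
  induction w generalizing F with
  | nil => rfl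
  | cons i w ih => simp [ih]

lemma word_neg (w : List I) (F : ℛ) : 𝔽.word w (-F) = -𝔽.word w F := by
  have := word_smul (𝔽 := 𝔽) w (-1) F
  simpa using this

lemma word_sub (w : List I) (F G : ℛ) : 𝔽.word w (F - G) = 𝔽.word w F - 𝔽.word w G := by
  rw [sub_eq_add_neg, word_add, word_neg, sub_eq_add_neg]

lemma word_append (v w : List I) (F : ℛ) : 𝔽.word (v ++ w) F = 𝔽.word w (𝔽.word v F) := by
  induction v generalizing F with
  | nil => rfl
  | cons j v ih => simp [ih]

/-! ### Vanishing jets -/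

namespace Van

lemma D {F : ℛ} (h : 𝔽.Van F) (i : I) : 𝔽.Van (𝔽.D i F) := fun w => h (i :: w)

lemma add {F G : ℛ} (hF : 𝔽.Van F) (hG : 𝔽.Van G) : 𝔽.Van (F + G) := fun w => by
  rw [word_add, map_add, hF, hG, add_zero]

lemma neg {F : ℛ} (hF : 𝔽.Van F) : 𝔽.Van (-F) := fun w => by
  rw [word_neg, map_neg, hF, neg_zero]

lemma sub {F G : ℛ} (hF : 𝔽.Van F) (hG : 𝔽.Van G) : 𝔽.Van (F - G) := by
  rw [sub_eq_add_neg]; exact hF.add hG.neg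

lemma mul_left {F : ℛ} (hF : 𝔽.Van F) (G : ℛ) : 𝔽.Van (G * F) := by
  intro w
  induction w generalizing F G with
  | nil => rw [word_nil, map_mul]; have := hF []; rw [word_nil] at this; rw [this, mul_zero]
  | cons i w ih =>
    rw [word_cons, Derivation.leibniz, word_add, map_add, smul_eq_mul, smul_eq_mul,
      ih (hF.D i), mul_comm F, ih hF, add_zero]

lemma eq {F G : ℛ} (h : 𝔽.Van (F - G)) : 𝔽.ev F = 𝔽.ev G := by
  have := h []
  rwa [word_nil, map_sub, sub_eq_zero] at this

lemma ev_word {F G : ℛ} (h : 𝔽.Van (F - G)) (w : List I) :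
    𝔽.ev (𝔽.word w F) = 𝔽.ev (𝔽.word w G) := by
  have := h w
  rwa [word_sub, map_sub, sub_eq_zero] at this

end Van

lemma comap_word (f : J → I) (w : List J) (F : ℛ) :
    (𝔽.comap f).word w F = 𝔽.word (w.map f) F := by
  induction w generalizing F with
  | nil => rfl
  | cons i w ih => exact ih _

lemma comap_wordWt (f : J → I) (w : List J) : (𝔽.comap f).wordWt w = 𝔽.wordWt (w.map f) := by
  induction w with
  | nil => rfl
  | cons i w ih => rw [wordWt_cons, ih]; rfl

lemma reindex_word (p : κ' → κ) (w : List I) (F : ℛ) :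
    (𝔽.reindex p).word w F = 𝔽.word w F := by
  induction w generalizing F with
  | nil => rfl
  | cons i w ih => exact ih _

lemma reindex_wordWt (p : κ' → κ) (w : List I) : (𝔽.reindex p).wordWt w = 𝔽.wordWt w := by
  induction w with
  | nil => rfl
  | cons i w ih => rw [wordWt_cons, ih]; rfl

lemma Van.reindex {F : ℛ} (h : 𝔽.Van F) (p : κ' → κ) : (𝔽.reindex p).Van F := by
  intro w
  ext k
  rw [reindex_word]
  exact congrFun (h w) (p k)

/-! ### Powers of the scale -/

/-- The scales are bounded above, so symbol classes increase as the exponent decreases. -/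
lemma zpow_isBigO {s r : ℤ} (h : r ≤ s) :
    (fun k => 𝔽.σ k ^ s) =O[⊤] fun k => 𝔽.σ k ^ r := by
  obtain ⟨S, hS⟩ := 𝔽.σ_bdd
  obtain ⟨n, hn⟩ := Int.eq_ofNat_of_zero_le (sub_nonneg.2 h)
  refine isBigO_top.2 ⟨|S| ^ n, fun k => ?_⟩
  have h0 := 𝔽.σ_pos k
  have : 𝔽.σ k ^ s = 𝔽.σ k ^ n * 𝔽.σ k ^ r := by
    rw [← zpow_natCast, ← zpow_add₀ h0.ne', ← hn]; congr 1; ring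
  rw [this, norm_mul, norm_pow, Real.norm_of_nonneg h0.le]
  gcongr
  exact (hS k).trans (le_abs_self S)

/-! ### Symbol classes -/

namespace IsSym

variable {c : I → ℕ} {A : κ → ℝ} {M : ℕ} {s r : ℤ} {F G : ℛ}

lemma mono_exp (h : 𝔽.IsSym c A M s F) (hr : r ≤ s) : 𝔽.IsSym c A M r F := fun w hw =>
  (h w hw).trans ((isBigO_refl _ _).mul (zpow_isBigO (by omega)))

/-- The weight function `A` is attached only to words of cost exactly `M`; below that cost it
disappears. All linearizations in the highest derivatives rest on this. -/
lemma lower {N : ℕ} (h : 𝔽.IsSym c A M s F) (hN : N < M) : 𝔽.IsSym c 1 N s F := by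
  intro w hw
  have := h w (by omega)
  simp only [if_neg (show (w.map c).sum ≠ M by omega)] at this
  simpa using this

lemma lower_one {N : ℕ} (h : 𝔽.IsSym c 1 M s F) (hN : N ≤ M) : 𝔽.IsSym c 1 N s F := by
  intro w hw
  have := h w (by omega)
  simpa using this

lemma of_one (h : 𝔽.IsSym c 1 M s F) (hA : ∀ k, 1 ≤ A k) : 𝔽.IsSym c A M s F := by
  intro w hw
  have := h w hw
  refine this.trans ?_
  refine IsBigO.mul ?_ (isBigO_refl _ _)
  split_ifs
  · refine isBigO_top.2 ⟨1, fun k => ?_⟩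
    have := hA k
    rw [Real.norm_of_nonneg (by linarith : (0:ℝ) ≤ A k)]
    simpa using this
  · exact isBigO_refl _ _

lemma zero : 𝔽.IsSym c A M s 0 := fun w hw => by
  rw [word_zero, map_zero]
  exact isBigO_zero _ _

lemma add (hF : 𝔽.IsSym c A M s F) (hG : 𝔽.IsSym c A M s G) : 𝔽.IsSym c A M s (F + G) :=
  fun w hw => by
    rw [word_add, map_add]
    exact (hF w hw).add (hG w hw)

lemma neg (hF : 𝔽.IsSym c A M s F) : 𝔽.IsSym c A M s (-F) :=
  fun w hw => by
    rw [word_neg, map_neg]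
    exact (hF w hw).neg_left

lemma sub (hF : 𝔽.IsSym c A M s F) (hG : 𝔽.IsSym c A M s G) : 𝔽.IsSym c A M s (F - G) := by
  rw [sub_eq_add_neg]; exact hF.add hG.neg

lemma smul (hF : 𝔽.IsSym c A M s F) (a : ℂ) : 𝔽.IsSym c A M s (a • F) :=
  fun w hw => by
    rw [word_smul, map_smul]
    exact (hF w hw).const_smul_left a

lemma sum {α : Type*} {t : Finset α} {F : α → ℛ} (h : ∀ a ∈ t, 𝔽.IsSym c A M s (F a)) :
    𝔽.IsSym c A M s (∑ a ∈ t, F a) := by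
  classical
  induction t using Finset.induction_on with
  | empty => simpa using zero
  | insert a t ha ih =>
    rw [Finset.sum_insert ha]
    exact (h a (by simp)).add (ih fun b hb => h b (by simp [hb]))

/-- The recursive description of the symbol classes. -/
lemma iff_D : 𝔽.IsSym c A M s F ↔
    ((𝔽.ev F) =O[⊤] fun k => (if 0 = M then A k else 1) * 𝔽.σ k ^ s) ∧
      ∀ i, c i ≤ M → 𝔽.IsSym c A (M - c i) (s - 𝔽.wt i) (𝔽.D i F) := by
  constructor
  · intro h
    refine ⟨by simpa using h [] (by simp), fun i hi w hw => ?_⟩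
    have := h (i :: w) (by simp; omega)
    refine this.congr_right fun k => ?_
    simp only [List.map_cons, List.sum_cons, wordWt_cons, Nat.cast_add]
    congr 2
    · simp only [eq_iff_iff]; omega
    · ring
  · rintro ⟨h0, h⟩ w hw
    cases w with
    | nil => simpa using h0
    | cons i w =>
      simp only [List.map_cons, List.sum_cons] at hw
      have := h i (by omega) w (by omega)
      refine this.congr_right fun k => ?_
      simp only [List.map_cons, List.sum_cons, wordWt_cons, Nat.cast_add]
      congr 2
      · simp only [eq_iff_iff]; omega
      · ring

lemma D (h : 𝔽.IsSym c A M s F) {i : I} (hi : c i ≤ M) :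
    𝔽.IsSym c A (M - c i) (s - 𝔽.wt i) (𝔽.D i F) := (iff_D.1 h).2 i hi

lemma ev (h : 𝔽.IsSym c A M s F) :
    (𝔽.ev F) =O[⊤] fun k => (if 0 = M then A k else 1) * 𝔽.σ k ^ s := (iff_D.1 h).1

lemma mul_fun {f g : κ → ℂ} {a b : κ → ℝ}
    (hf : f =O[⊤] fun k => a k * 𝔽.σ k ^ s) (hg : g =O[⊤] fun k => b k * 𝔽.σ k ^ r) :
    (f * g) =O[⊤] fun k => (a k * b k) * 𝔽.σ k ^ (s + r) :=
  (hf.mul hg).congr_right fun k => by rw [zpow_add₀ (𝔽.σ_pos k).ne']; ring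

/-- By Leibniz' rule a derivative that falls on `F` leaves `G` with cost below `M`, since every
letter costs at least 1. The factor `A` therefore comes from `G` alone and occurs at most linearly.
-/
lemma one_mul (hc : ∀ i, 1 ≤ c i) (hA : ∀ k, 1 ≤ A k) (hF : 𝔽.IsSym c 1 M s F)
    (hG : 𝔽.IsSym c A M r G) : 𝔽.IsSym c A M (s + r) (F * G) := by
  induction M using Nat.strong_induction_on generalizing F G s r with
  | _ M ih =>
    refine iff_D.2 ⟨?_, fun i hi => ?_⟩
    · rw [map_mul]
      refine (mul_fun hF.ev hG.ev).congr_right fun k => ?_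
      split_ifs <;> simp
    · have hci := hc i
      have hlt : M - c i < M := by omega
      rw [Derivation.leibniz, smul_eq_mul, smul_eq_mul]
      refine IsSym.add ?_ ?_
      · refine (ih _ hlt (hF.lower_one hlt.le) (hG.D hi)).mono_exp (by omega)
      · rw [mul_comm]
        exact (ih _ hlt (hF.D hi) ((hG.lower hlt).of_one hA)).mono_exp (by omega)

lemma mul (hc : ∀ i, 1 ≤ c i) (hF : 𝔽.IsSym c 1 M s F)
    (hG : 𝔽.IsSym c 1 M r G) : 𝔽.IsSym c 1 M (s + r) (F * G) :=
  one_mul hc (fun _ => le_rfl) hF hG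

/-- A derivative of positive cost `M` cannot act with full cost on both factors, so `A` still occurs
only linearly. For `M = 0` the product would be bounded by `A ^ 2`. -/
lemma mul_of_pos (hc : ∀ i, 1 ≤ c i) (hA : ∀ k, 1 ≤ A k) (hM : 1 ≤ M) (hF : 𝔽.IsSym c A M s F)
    (hG : 𝔽.IsSym c A M r G) : 𝔽.IsSym c A M (s + r) (F * G) := by
  refine iff_D.2 ⟨?_, fun i hi => ?_⟩
  · rw [map_mul]
    refine (mul_fun hF.ev hG.ev).congr_right fun k => ?_
    rw [if_neg (by omega)]; simp
  · have hci := hc i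
    have hlt : M - c i < M := by omega
    rw [Derivation.leibniz, smul_eq_mul, smul_eq_mul]
    refine IsSym.add ?_ ?_
    · exact (one_mul hc hA (hF.lower hlt) (hG.D hi)).mono_exp (by omega)
    · exact (one_mul hc hA (hG.lower hlt) (hF.D hi)).mono_exp (by omega)

lemma bound (h : 𝔽.IsSym c 1 M s F) {w : List I} (hw : (w.map c).sum ≤ M) :
    𝔽.ev (𝔽.word w F) =O[⊤] fun k => 𝔽.σ k ^ (s - (𝔽.wordWt w : ℤ)) := by
  simpa using h w hw

/-- Division by an element which is bounded from below by `σ`. -/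
lemma of_mul (hc : ∀ i, 1 ≤ c i) {u h : ℛ} (hu : 𝔽.IsSym c 1 M 1 u)
    (hu' : 𝔽.σ =O[⊤] 𝔽.ev u) (hh : 𝔽.IsSym c 1 M s h) (e : 𝔽.Van (u * G - h)) :
    𝔽.IsSym c 1 M (s - 1) G := by
  induction M using Nat.strong_induction_on generalizing G h s with
  | _ M ih =>
    refine iff_D.2 ⟨?_, fun i hi => ?_⟩
    · have h1 : 𝔽.ev u * 𝔽.ev G = 𝔽.ev h := by rw [← map_mul, e.eq]
      have h2 : (fun k => 𝔽.σ k * 𝔽.ev G k : κ → ℂ) =O[⊤] fun k => 𝔽.σ k ^ s := by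
        have h3 : (fun k => (𝔽.σ k : ℂ)) =O[⊤] 𝔽.ev u := by
          refine IsBigO.trans ?_ hu'
          exact isBigO_top.2 ⟨1, fun k => by simp⟩
        have h4 := h3.mul (isBigO_refl (𝔽.ev G) ⊤)
        have h5 : (fun k => 𝔽.ev u k * 𝔽.ev G k) =O[⊤] fun k => 𝔽.σ k ^ s := by
          have : (fun k => 𝔽.ev u k * 𝔽.ev G k) = 𝔽.ev h := h1
          rw [this]
          simpa using hh.ev
        exact h4.trans h5
      obtain ⟨C, hC⟩ := isBigO_top.1 h2
      refine isBigO_top.2 ⟨C, fun k => ?_⟩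
      have h0 := 𝔽.σ_pos k
      have := hC k
      simp only [Pi.one_apply, ite_self, _root_.one_mul]
      rw [norm_mul, Complex.norm_real, Real.norm_of_nonneg h0.le,
        Real.norm_of_nonneg (by positivity)] at this
      rw [Real.norm_of_nonneg (by positivity), zpow_sub_one₀ h0.ne', ← mul_assoc,
        ← div_eq_mul_inv, le_div_iff₀ h0]
      linarith
    · have hci := hc i
      have hlt : M - c i < M := by omega
      -- With `G` known at smaller cost, `u * D_i G = D_i h - D_i u * G` is an equation of the same
      -- type for `D_i G`.
      have hG := ih _ hlt (hu.lower_one hlt.le) (hh.lower_one hlt.le) e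
      have h1 : 𝔽.IsSym c 1 (M - c i) (s - 𝔽.wt i) (𝔽.D i h - 𝔽.D i u * G) :=
        (hh.D hi).sub ((mul hc (hu.D hi) hG).mono_exp (by omega))
      refine (ih _ hlt (hu.lower_one hlt.le) h1 ?_).mono_exp (by omega)
      have := e.D i
      rw [map_sub, Derivation.leibniz, smul_eq_mul, smul_eq_mul] at this
      convert this using 1
      ring

end IsSym

/-- Division by an element which does not vanish. -/
lemma Van.of_mul {u G : ℛ} (hu : ∀ k, 𝔽.ev u k ≠ 0) (e : 𝔽.Van (u * G)) : 𝔽.Van G := by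
  intro w
  induction w generalizing u G with
  | nil =>
    have := e []
    rw [word_nil, map_mul] at this
    ext k
    simpa [hu k] using congrFun this k
  | cons i w ih =>
    -- Multiplying `D_i (u * G)` by `u` and subtracting `D_i u * (u * G)` leaves `u * u * D_i G`:
    -- the form of the hypothesis is kept, with a new nonvanishing factor.
    refine ih (u := u * u) (G := 𝔽.D i G) (fun k => by simpa using hu k) ?_
    have h1 := ((e.D i).mul_left u).sub (e.mul_left (𝔽.D i u))
    rw [Derivation.leibniz, smul_eq_mul, smul_eq_mul] at h1
    convert h1 using 1
    ring

end JetFrame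

/-! ### Cost functions and commutation of first order operators with derivatives -/

namespace JetFrame

variable {I J κ κ' ℛ : Type*} [CommRing ℛ] [Algebra ℂ ℛ]

/-- The first order operator `∑ a_i D_i`. -/
def field [Fintype I] (𝔽 : JetFrame I κ ℛ) (a : I → ℛ) (F : ℛ) : ℛ := ∑ i, a i * 𝔽.D i F

/-- The cost function which counts the letters. -/
abbrev unitCost : I → ℕ := fun _ => 1

/-- The cost function which counts the letter `n` twice. -/
def normalCost [DecidableEq I] (n : I) : I → ℕ := fun i => if i = n then 2 else 1

variable {𝔽 : JetFrame I κ ℛ}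

lemma sum_unitCost (w : List I) : (w.map unitCost).sum = w.length := by simp

lemma one_le_normalCost [DecidableEq I] (n i : I) : 1 ≤ normalCost n i := by
  unfold normalCost; split_ifs <;> omega

lemma normalCost_sum_le [DecidableEq I] (n : I) (w : List I) :
    (w.map (normalCost n)).sum ≤ 2 * w.length := by
  induction w with
  | nil => simp
  | cons i w ih =>
    have : normalCost n i ≤ 2 := by unfold normalCost; split_ifs <;> omega
    simp only [List.map_cons, List.sum_cons, List.length_cons]; omega

lemma IsSym.unit_of_normal [DecidableEq I] {n : I} {s : ℤ} {F : ℛ}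
    (h : ∀ M, 𝔽.IsSym (normalCost n) 1 M s F) (M : ℕ) : 𝔽.IsSym unitCost 1 M s F := by
  intro w _
  simpa using (h _).bound (normalCost_sum_le n w)

lemma IsSym.word {c : I → ℕ} {A : κ → ℝ} {M : ℕ} {s : ℤ} {F : ℛ} (h : 𝔽.IsSym c A M s F)
    {w : List I} (hw : (w.map c).sum ≤ M) :
    𝔽.IsSym c A (M - (w.map c).sum) (s - 𝔽.wordWt w) (𝔽.word w F) := by
  induction w generalizing F M s with
  | nil => simpa using h
  | cons i w ih =>
    simp only [List.map_cons, List.sum_cons] at hw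
    have := ih (h.D (i := i) (by omega)) (by omega)
    simp only [List.map_cons, List.sum_cons, wordWt_cons, word_cons, Nat.cast_add]
    rwa [Nat.sub_sub, sub_sub] at this

lemma D_field [Fintype I] (a : I → ℛ) (i : I) (F : ℛ) :
    𝔽.D i (𝔽.field a F) = 𝔽.field a (𝔽.D i F) + ∑ j, 𝔽.D i (a j) * 𝔽.D j F := by
  simp only [field, map_sum, Derivation.leibniz, smul_eq_mul, ← Finset.sum_add_distrib]
  refine Finset.sum_congr rfl fun j _ => ?_
  rw [𝔽.D_comm i j, mul_comm (𝔽.D j F)]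

/-- The transport equations for the derivatives of a solution. -/
lemma transport_word [Fintype I] {A : κ → ℝ} (hA : ∀ k, 1 ≤ A k) {M : ℕ} {s : ℤ} {a : I → ℛ}
    {u f : ℛ}
    (ha : (∀ i, 𝔽.IsSym unitCost 1 M (𝔽.wt i - 1) (a i)) ∨
      (2 ≤ M ∧ ∀ i, 𝔽.IsSym unitCost A M (𝔽.wt i - 1) (a i)))
    (hu : 𝔽.IsSym unitCost A M s u) (hf : 𝔽.IsSym unitCost A M (s - 1) f)
    (e : 𝔽.Van (𝔽.field a u - f)) (w : List I) (hw : w.length ≤ M) :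
    ∃ f', 𝔽.IsSym unitCost A (M - w.length) (s - 1 - 𝔽.wordWt w) f' ∧
      𝔽.Van (𝔽.field a (𝔽.word w u) - f') := by
  induction w using List.reverseRecOn with
  | nil => exact ⟨f, by simpa using hf, by simpa using e⟩
  | append_singleton w i ih =>
    simp only [List.length_append, List.length_cons, List.length_nil, zero_add] at hw
    obtain ⟨f', hf', e'⟩ := ih (by omega)
    have hwt : 𝔽.wordWt (w ++ [i]) = 𝔽.wordWt w + 𝔽.wt i := by simp [wordWt]
    have hM : M - (w ++ [i]).length = M - w.length - 1 := by
      simp only [List.length_append, List.length_cons, List.length_nil]; omega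
    -- One more derivative adds the commutator `∑ D_i a_j D_j` applied to `D_w u`.
    refine ⟨𝔽.D i f' - ∑ j, 𝔽.D i (a j) * 𝔽.D j (𝔽.word w u), ?_, ?_⟩
    · rw [hM, hwt]
      refine IsSym.sub ((hf'.D (i := i) (by simp only [unitCost]; omega)).mono_exp ?_)
        (IsSym.sum fun j _ => ?_)
      · push_cast; omega
      have hwu := hu.word (w := w) (by rw [sum_unitCost]; omega)
      rw [sum_unitCost] at hwu
      have hju := hwu.D (i := j) (by simp only [unitCost]; omega)
      have c1 : ∀ i : I, 1 ≤ unitCost i := fun _ => le_rfl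
      rcases ha with ha | ⟨hM2, ha⟩
      · have hai := ((ha j).D (i := i) (by simp only [unitCost]; omega)).lower_one
          (show M - w.length - 1 ≤ M - unitCost i by simp only [unitCost]; omega)
        refine (IsSym.one_mul c1 hA hai hju).mono_exp ?_
        push_cast; omega
      · have hai := (ha j).D (i := i) (by simp only [unitCost]; omega)
        -- Both factors can carry `A` only for the first letter, and then the remaining order `M -
        -- 1` is positive because `2 ≤ M`. Later, `D_i a_j` is needed only below its highest order.
        rcases Nat.eq_zero_or_pos w.length with h0 | h0
        · rw [h0] at hju ⊢
          refine (IsSym.mul_of_pos c1 hA (show 1 ≤ M - 1 by omega) hai hju).mono_exp ?_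
          push_cast; omega
        · have hai' := hai.lower
            (show M - w.length - 1 < M - unitCost i by simp only [unitCost]; omega)
          refine (IsSym.one_mul c1 hA hai' hju).mono_exp ?_
          push_cast; omega
    · have := e'.D i
      rw [map_sub, D_field] at this
      rw [word_append]
      simp only [word_cons, word_nil]
      convert this using 1
      ring

/-! ### The boundary -/

/-- A word is either tangential or, by commutation, may be taken to begin with `n`; the two cases
are the two hypotheses. -/
lemma isSym_of_tangential [DecidableEq I] {n : I} {M : ℕ} {s : ℤ} {F : ℛ}
    (hT : ∀ w : List I, n ∉ w → 𝔽.ev (𝔽.word w F) =O[⊤] fun k => 𝔽.σ k ^ (s - (𝔽.wordWt w : ℤ)))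
    (hN : 2 ≤ M → 𝔽.IsSym (normalCost n) 1 (M - 2) (s - 𝔽.wt n) (𝔽.D n F)) :
    𝔽.IsSym (normalCost n) 1 M s F := by
  induction M using Nat.strong_induction_on generalizing F s with
  | _ M ih =>
    refine IsSym.iff_D.2 ⟨by simpa using hT [] (by simp), fun i hi => ?_⟩
    by_cases hin : i = n
    · subst hin
      have h2 : normalCost i i = 2 := by simp [normalCost]
      rw [h2] at hi ⊢
      exact hN hi
    · have h1 : normalCost n i = 1 := by simp [normalCost, hin]
      rw [h1] at hi ⊢
      refine ih _ (by omega) (fun w hw => ?_) fun h3 => ?_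
      · have := hT (i :: w) (by simp [hw, Ne.symm hin])
        refine this.congr_right fun k => ?_
        simp only [wordWt_cons]
        congr 1
        push_cast; ring
      · have := (hN (by omega)).D (i := i) (by rw [h1]; omega)
        rw [h1, 𝔽.D_comm] at this
        convert this using 1
        · omega
        · ring

/-- At a noncharacteristic boundary, the transport equation gives control of the normal
derivatives. -/
lemma isSym_succ_of_field [Fintype I] [DecidableEq I] {n : I} (hn : 𝔽.wt n = 2) {M : ℕ} {s : ℤ}
    {a : I → ℛ} {u f : ℛ}
    (ha : ∀ i, 𝔽.IsSym (normalCost n) 1 M (𝔽.wt i - 1) (a i))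
    (han : 𝔽.σ =O[⊤] 𝔽.ev (a n))
    (hu : 𝔽.IsSym (normalCost n) 1 M s u) (hf : 𝔽.IsSym (normalCost n) 1 M (s - 1) f)
    (e : 𝔽.Van (𝔽.field a u - f))
    (hT : ∀ w : List I, n ∉ w →
      𝔽.ev (𝔽.word w u) =O[⊤] fun k => 𝔽.σ k ^ (s - (𝔽.wordWt w : ℤ))) :
    𝔽.IsSym (normalCost n) 1 (M + 1) s u := by
  -- The letter `n` costs 2 and the others cost 1. Solving for `D_n u` replaces a normal derivative
  -- by tangential ones, which saves one unit of cost: `u` at cost `M` gives `D_n u` at cost `M -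
  -- 1`, hence `u` at cost `M + 1`. With equal costs the argument would be circular.
  refine isSym_of_tangential hT fun hM => ?_
  have c1 := one_le_normalCost n
  have hM' : M + 1 - 2 = M - 1 := by omega
  rw [hM', hn]
  have h1 : 𝔽.IsSym (normalCost n) 1 (M - 1) (s - 1)
      (f - ∑ i ∈ Finset.univ.erase n, a i * 𝔽.D i u) := by
    refine (hf.lower_one (by omega)).sub (IsSym.sum fun i hi => ?_)
    have hi1 : normalCost n i = 1 := by simp [normalCost, Finset.ne_of_mem_erase hi]
    have hD := hu.D (i := i) (by rw [hi1]; omega)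
    rw [hi1] at hD
    exact (IsSym.mul c1 ((ha i).lower_one (by omega)) hD).mono_exp (by omega)
  -- As the weight of `n` is 2, `a n` has order 1, which is what division by an element comparable
  -- to `σ` requires.
  have han' := ((ha n).lower_one (show M - 1 ≤ M by omega)).mono_exp
    (show (1 : ℤ) ≤ _ by rw [hn]; norm_num)
  have := IsSym.of_mul c1 han' han h1 (G := 𝔽.D n u) ?_
  · exact this.mono_exp (by push_cast; omega)
  · convert e using 1
    rw [field, ← Finset.add_sum_erase _ _ (Finset.mem_univ n)]
    ring

lemma exists_map_val {n : I} {w : List I} (hw : n ∉ w) :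
    ∃ v : List {i // i ≠ n}, v.map Subtype.val = w :=
  have hw' : ∀ i ∈ w, i ≠ n := fun _ hi h => hw (h ▸ hi)
  ⟨w.attachWith _ hw', by simp⟩

lemma notMem_map_val {n : I} (v : List {i // i ≠ n}) : n ∉ v.map Subtype.val := by simp

lemma ev_word_of_comap {n : I} {s : ℤ} {F : ℛ}
    (h : ∀ M, (𝔽.comap (Subtype.val : {i // i ≠ n} → I)).IsSym unitCost 1 M s F)
    (w : List I) (hw : n ∉ w) :
    𝔽.ev (𝔽.word w F) =O[⊤] fun k => 𝔽.σ k ^ (s - (𝔽.wordWt w : ℤ)) := by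
  obtain ⟨v, rfl⟩ := exists_map_val hw
  have := (h v.length).bound (w := v) (by rw [sum_unitCost])
  rw [comap_word, comap_wordWt] at this
  exact this

end JetFrame

/-! ### Differential inequalities on an interval -/

section ODE

variable {V : Type*} [NormedAddCommGroup V] [NormedSpace ℝ V] {v v' : ℝ → V} {ℓ : ℝ}

lemma hasDerivWithinAt_Ici_of_Icc
    (hd : ∀ r ∈ Set.Icc 0 ℓ, HasDerivWithinAt v (v' r) (Set.Icc 0 ℓ) r) :
    ∀ r ∈ Set.Ico 0 ℓ, HasDerivWithinAt v (v' r) (Set.Ici r) r := fun r hr =>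
  (hd r ⟨hr.1, hr.2.le⟩).mono_of_mem_nhdsWithin (Icc_mem_nhdsGE_of_mem hr)

/-- Gronwall's inequality. The bound involves only the initial value and the product `K * ℓ`. -/
lemma norm_le_of_norm_deriv_le_one_add {K : ℝ} (hK : 0 < K)
    (hd : ∀ r ∈ Set.Icc 0 ℓ, HasDerivWithinAt v (v' r) (Set.Icc 0 ℓ) r)
    (hv : ∀ r ∈ Set.Icc 0 ℓ, ‖v' r‖ ≤ K * (1 + ‖v r‖)) :
    ∀ r ∈ Set.Icc 0 ℓ, ‖v r‖ ≤ (‖v 0‖ + 1) * Real.exp (K * ℓ) := by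
  intro r hr
  have := norm_le_gronwallBound_of_norm_deriv_right_le (f := v) (f' := v') (δ := ‖v 0‖) (K := K)
    (ε := K) (a := 0) (b := ℓ) (fun r hr => (hd r hr).continuousWithinAt)
    (hasDerivWithinAt_Ici_of_Icc hd) le_rfl
    (fun r hr => (hv r ⟨hr.1, hr.2.le⟩).trans_eq (by ring)) r hr
  rw [gronwallBound_of_K_ne_0 hK.ne', div_self hK.ne', sub_zero] at this
  have h2 : Real.exp (K * r) ≤ Real.exp (K * ℓ) := Real.exp_le_exp.2 (by gcongr; exact hr.2)
  nlinarith [norm_nonneg (v 0)]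

/-- A continuity argument for nonlinear equations: the bound on `v'` is available only while `‖v‖ ≤
M + 1`, and a growth of rate `K` cannot leave this region on an interval of length at most `1 / K`.
-/
lemma norm_le_of_barrier {M K : ℝ} (hK : K * ℓ ≤ 1)
    (hd : ∀ r ∈ Set.Icc 0 ℓ, HasDerivWithinAt v (v' r) (Set.Icc 0 ℓ) r)
    (h0 : ‖v 0‖ ≤ M) (hv : ∀ r ∈ Set.Icc 0 ℓ, ‖v r‖ ≤ M + 1 → ‖v' r‖ < K) :
    ∀ r ∈ Set.Icc 0 ℓ, ‖v r‖ ≤ M + 1 := by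
  intro r hr
  have hK0 : 0 < K := by
    have : (0:ℝ) ∈ Set.Icc 0 ℓ := ⟨le_rfl, hr.1.trans hr.2⟩
    exact (norm_nonneg _).trans_lt (hv 0 this (by linarith))
  have key : ∀ r ∈ Set.Icc 0 ℓ, M + K * r ≤ M + 1 := fun r hr => by
    have : K * r ≤ K * ℓ := by gcongr; exact hr.2
    linarith
  have := image_norm_le_of_norm_deriv_right_lt_deriv_boundary (f := v) (f' := v') (a := 0) (b := ℓ)
    (fun r hr => (hd r hr).continuousWithinAt)
    (hasDerivWithinAt_Ici_of_Icc hd) (B := fun r => M + K * r) (B' := fun _ => K) (by simpa using h0)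
    (fun r => by simpa using ((hasDerivAt_id r).const_mul K).const_add M)
    (fun r hr h => hv r ⟨hr.1, hr.2.le⟩ (h.le.trans (key r ⟨hr.1, hr.2.le⟩))) hr
  exact this.trans (key r hr)

end ODE

/-! ### Propagation of symbol estimates along rays -/

/-- The points of a family of rays of lengths `ℓ`. -/
abbrev RayPt {ι : Type*} (ℓ : ι → ℝ) : Type _ := {p : ι × ℝ // p.2 ∈ Set.Icc 0 (ℓ p.1)}

/-- A frame whose points are those of a family of integral curves of the field `∑ a_i D_i`, of
lengths at most proportional to the scale. -/
structure RayFrame (I ι ℛ : Type*) [CommRing ℛ] [Algebra ℂ ℛ] [Fintype I] where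
  /-- the lengths -/
  ℓ : ι → ℝ
  ℓ_nonneg : ∀ i, 0 ≤ ℓ i
  /-- the underlying frame -/
  frame : JetFrame I (RayPt ℓ) ℛ
  /-- the scales -/
  scale : ι → ℝ
  σ_eq : ∀ k, frame.σ k = scale k.1.1
  scale_pos : ∀ i, 0 < scale i
  /-- the bound of the lengths -/
  L : ℝ
  ℓ_le : ∀ i, ℓ i ≤ L * scale i
  /-- the coefficients of the field -/
  a : I → ℛ
  /-- the orientations -/
  sgn : ι → ℝ
  abs_sgn : ∀ i, |sgn i| = 1
  /-- the values along the curves -/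
  val : ℛ → ι → ℝ → ℂ
  ev_eq : ∀ F k, frame.ev F k = val F k.1.1 k.1.2
  deriv : ∀ F i, ∀ r ∈ Set.Icc 0 (ℓ i), HasDerivWithinAt (val F i)
    (sgn i * val (frame.field a F) i r) (Set.Icc 0 (ℓ i)) r

namespace RayFrame

variable {I ι ℛ : Type*} [CommRing ℛ] [Algebra ℂ ℛ] [Fintype I] (ℜ : RayFrame I ι ℛ)

/-- The initial points. -/
def start (i : ι) : RayPt ℜ.ℓ := ⟨(i, 0), le_rfl, ℜ.ℓ_nonneg i⟩

/-- The frame of the initial points. -/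
abbrev bd : JetFrame I ι ℛ := ℜ.frame.reindex ℜ.start

section Vec

variable {Q W : Type*}

/-- Rescaled derivatives along the rays. -/
noncomputable def vec (s : Q → ℤ) (u : Q → ℛ) (wd : W → List I) (i : ι) (r : ℝ) : Q × W → ℂ :=
  fun p => (ℜ.scale i ^ ((ℜ.frame.wordWt (wd p.2) : ℤ) - s p.1) : ℝ)
    * ℜ.val (ℜ.frame.word (wd p.2) (u p.1)) i r

/-- The derivative of `vec`. -/
noncomputable def vecDeriv (s : Q → ℤ) (u : Q → ℛ) (wd : W → List I) (i : ι) (r : ℝ) :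
    Q × W → ℂ :=
  fun p => (ℜ.scale i ^ ((ℜ.frame.wordWt (wd p.2) : ℤ) - s p.1) : ℝ)
    * (ℜ.sgn i * ℜ.val (ℜ.frame.field ℜ.a (ℜ.frame.word (wd p.2) (u p.1))) i r)

variable {ℜ} {s : Q → ℤ} {u f : Q → ℛ} {wd : W → List I}

lemma hasDerivWithinAt_vec (i : ι) {r : ℝ} (hr : r ∈ Set.Icc 0 (ℜ.ℓ i)) :
    HasDerivWithinAt (ℜ.vec s u wd i) (ℜ.vecDeriv s u wd i r) (Set.Icc 0 (ℜ.ℓ i)) r :=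
  hasDerivWithinAt_pi.2 fun _ => (ℜ.deriv _ i r hr).const_mul _

lemma norm_val_eq (p : Q × W) (i : ι) (r : ℝ) :
    ‖ℜ.val (ℜ.frame.word (wd p.2) (u p.1)) i r‖
      = ‖ℜ.vec s u wd i r p‖ * ℜ.scale i ^ (s p.1 - (ℜ.frame.wordWt (wd p.2) : ℤ)) := by
  have h0 := ℜ.scale_pos i
  rw [vec, norm_mul, Complex.norm_real, Real.norm_of_nonneg (by positivity), mul_right_comm,
    ← zpow_add₀ h0.ne']
  simp

variable [Fintype Q] [Fintype W]

lemma norm_vec_le {b : ℝ} (hb : 0 ≤ b) (i : ι) (r : ℝ)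
    (h : ∀ q x, ‖ℜ.val (ℜ.frame.word (wd x) (u q)) i r‖
      ≤ b * ℜ.scale i ^ (s q - (ℜ.frame.wordWt (wd x) : ℤ))) : ‖ℜ.vec s u wd i r‖ ≤ b := by
  rw [pi_norm_le_iff_of_nonneg hb]
  intro p
  have h1 := h p.1 p.2
  rw [norm_val_eq (s := s) p] at h1
  have h0 := ℜ.scale_pos i
  exact le_of_mul_le_mul_right h1 (by positivity)

/-- The loss of one order under the transport field turns into the factor `1 / scale` after
rescaling; it is compensated by the lengths of the rays. -/
lemma norm_vecDeriv_le {b : ℝ} (hb : 0 ≤ b) (i : ι) (r : ℝ)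
    (h : ∀ q x, ‖ℜ.val (ℜ.frame.field ℜ.a (ℜ.frame.word (wd x) (u q))) i r‖
      ≤ b * ℜ.scale i ^ (s q - 1 - (ℜ.frame.wordWt (wd x) : ℤ))) :
    ‖ℜ.vecDeriv s u wd i r‖ ≤ b / ℜ.scale i := by
  have h0 := ℜ.scale_pos i
  rw [pi_norm_le_iff_of_nonneg (by positivity)]
  intro p
  have h1 := h p.1 p.2
  rw [vecDeriv, norm_mul, norm_mul, Complex.norm_real, Complex.norm_real,
    Real.norm_of_nonneg (by positivity), Real.norm_eq_abs, ℜ.abs_sgn, one_mul]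
  calc _ ≤ ℜ.scale i ^ ((ℜ.frame.wordWt (wd p.2) : ℤ) - s p.1)
        * (b * ℜ.scale i ^ (s p.1 - 1 - (ℜ.frame.wordWt (wd p.2) : ℤ))) := by gcongr
    _ = b * ℜ.scale i ^ (-1 : ℤ) := by
      rw [mul_left_comm, ← zpow_add₀ h0.ne']; congr 2; ring
    _ = b / ℜ.scale i := by rw [zpow_neg_one, div_eq_mul_inv]

end Vec

variable {Q : Type*} [Fintype Q] {ℜ} {s : Q → ℤ} {u f : Q → ℛ}

/-- A common constant for finitely many estimates. -/
lemma exists_common_bound {α κ : Type*} [Fintype α] {F : α → κ → ℂ} {G : α → κ → ℝ}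
    (h : ∀ a, F a =O[⊤] G a) : ∃ C, 0 < C ∧ ∀ a k, ‖F a k‖ ≤ C * ‖G a k‖ := by
  choose C hC using fun a => isBigO_top.1 (h a)
  refine ⟨1 + ∑ a, |C a|, by positivity, fun a k => (hC a k).trans ?_⟩
  gcongr
  calc C a ≤ |C a| := le_abs_self _
    _ ≤ ∑ a, |C a| := Finset.single_le_sum (f := fun a => |C a|) (fun _ _ => abs_nonneg _)
        (Finset.mem_univ a)
    _ ≤ _ := by linarith

/-- Solutions of transport equations: the derivatives of order `M`, given those of lower order. -/
theorem isSym_of_bd {M : ℕ} (e : ∀ q, ℜ.frame.Van (ℜ.frame.field ℜ.a (u q) - f q))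
    (h : ∀ A : RayPt ℜ.ℓ → ℝ, (∀ k, 1 ≤ A k) →
      (∀ q, ℜ.frame.IsSym JetFrame.unitCost A M (s q) (u q)) →
      ((∀ i, ℜ.frame.IsSym JetFrame.unitCost 1 M (ℜ.frame.wt i - 1) (ℜ.a i)) ∨
        (2 ≤ M ∧ ∀ i, ℜ.frame.IsSym JetFrame.unitCost A M (ℜ.frame.wt i - 1) (ℜ.a i))) ∧
      ∀ q, ℜ.frame.IsSym JetFrame.unitCost A M (s q - 1) (f q))
    (hlow : ∀ N < M, ∀ q, ℜ.frame.IsSym JetFrame.unitCost 1 N (s q) (u q))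
    (h0 : ∀ q, ℜ.bd.IsSym JetFrame.unitCost 1 M (s q) (u q)) (q : Q) :
    ℜ.frame.IsSym JetFrame.unitCost 1 M (s q) (u q) := by
  classical
  let wd : (Fin M → I) → List I := List.ofFn
  have hwd : ∀ x, (wd x).length = M := fun x => by simp [wd]
  -- The unknown size of the highest derivatives is itself taken as the weight function. Then `u`
  -- lies in the class with `A` for trivial reasons, and the hypothesis `h` bounds the right hand
  -- sides linearly in `A`.
  let A : RayPt ℜ.ℓ → ℝ := fun k => 1 + ‖ℜ.vec s u wd k.1.1 k.1.2‖
  have hA : ∀ k, 1 ≤ A k := fun k => by simp [A]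
  have hwd' : ∀ w : List I, w.length = M → ∃ x, wd x = w := by
    rintro w rfl
    exact ⟨fun j => w.get j, by simp [wd]⟩
  have huA : ∀ q, ℜ.frame.IsSym JetFrame.unitCost A M (s q) (u q) := by
    intro q w hw
    rw [JetFrame.sum_unitCost] at hw ⊢
    rcases hw.lt_or_eq with hw | hw
    · have := (hlow _ hw q).bound (w := w) (by rw [JetFrame.sum_unitCost])
      simpa [hw.ne] using this
    · obtain ⟨x, rfl⟩ := hwd' w hw
      simp only [hw, if_true]
      refine isBigO_top.2 ⟨1, fun k => ?_⟩
      rw [ℜ.ev_eq, norm_val_eq (s := s) (wd := wd) (q, x), ℜ.σ_eq, one_mul, norm_mul,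
        Real.norm_of_nonneg (zero_le_one.trans (hA k))]
      have hs := ℜ.scale_pos k.1.1
      rw [Real.norm_of_nonneg (by positivity)]
      gcongr
      have := norm_le_pi_norm (ℜ.vec s u wd k.1.1 k.1.2) (q, x)
      simp only [A]; linarith
  obtain ⟨ha, hf⟩ := h A hA huA
  have hO : ∀ p : Q × (Fin M → I),
      ℜ.frame.ev (ℜ.frame.field ℜ.a (ℜ.frame.word (wd p.2) (u p.1))) =O[⊤]
        fun k => A k * ℜ.frame.σ k ^ (s p.1 - 1 - (ℜ.frame.wordWt (wd p.2) : ℤ)) := by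
    intro p
    obtain ⟨f', hf', e'⟩ := JetFrame.transport_word hA ha (huA p.1) (hf p.1) (e p.1) (wd p.2)
      (hwd _).le
    rw [e'.eq]
    rw [hwd, Nat.sub_self] at hf'
    simpa using hf'.ev
  obtain ⟨C, hC0, hC⟩ := exists_common_bound hO
  have hI : ∀ p : Q × (Fin M → I), ℜ.bd.ev (ℜ.bd.word (wd p.2) (u p.1)) =O[⊤]
        fun i => ℜ.bd.σ i ^ (s p.1 - (ℜ.bd.wordWt (wd p.2) : ℤ)) := fun p =>
    (h0 p.1).bound (by rw [JetFrame.sum_unitCost, hwd])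
  obtain ⟨C', hC'0, hC'⟩ := exists_common_bound hI
  have hv0 : ∀ i, ‖ℜ.vec s u wd i 0‖ ≤ C' := fun i => norm_vec_le hC'0.le i 0 fun q x => by
    have h1 := hC' (q, x) i
    have hs := ℜ.scale_pos i
    have h2 : ℜ.bd.σ i = ℜ.scale i := ℜ.σ_eq _
    rw [h2, Real.norm_of_nonneg (by positivity), JetFrame.reindex_word,
      JetFrame.reindex_wordWt] at h1
    have h3 : ℜ.bd.ev (ℜ.frame.word (wd x) (u q)) i = ℜ.val (ℜ.frame.word (wd x) (u q)) i 0 :=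
      ℜ.ev_eq _ _
    rwa [h3] at h1
  have hv : ∀ i, ∀ r ∈ Set.Icc 0 (ℜ.ℓ i), ‖ℜ.vec s u wd i r‖ ≤ (C' + 1) * Real.exp (C * ℜ.L) := by
    intro i r hr
    have hs := ℜ.scale_pos i
    -- The rate is `C / scale` and the length at most `L * scale`, so the exponent is at most `C *
    -- L` for all rays.
    refine (norm_le_of_norm_deriv_le_one_add (K := C / ℜ.scale i) (by positivity)
      (fun r hr => hasDerivWithinAt_vec i hr) (fun r hr => ?_) r hr).trans ?_
    · refine (norm_vecDeriv_le (b := C * (1 + ‖ℜ.vec s u wd i r‖)) (by positivity) i r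
        fun q x => ?_).trans_eq (by ring)
      have h1 := hC (q, x) ⟨(i, r), hr⟩
      rw [ℜ.ev_eq, ℜ.σ_eq, norm_mul, Real.norm_of_nonneg (zero_le_one.trans (hA _)),
        Real.norm_of_nonneg (by positivity), ← mul_assoc] at h1
      exact h1
    · have := hv0 i
      have h2 : C / ℜ.scale i * ℜ.ℓ i ≤ C * ℜ.L := by
        rw [div_mul_eq_mul_div, div_le_iff₀ hs, mul_assoc]
        exact mul_le_mul_of_nonneg_left (ℜ.ℓ_le i) hC0.le
      gcongr
  intro w hw
  rw [JetFrame.sum_unitCost] at hw ⊢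
  simp only [Pi.one_apply, ite_self, one_mul]
  rcases hw.lt_or_eq with hw | hw
  · exact (hlow _ hw q).bound (w := w) (by rw [JetFrame.sum_unitCost])
  · obtain ⟨x, rfl⟩ := hwd' w hw
    refine isBigO_top.2 ⟨(C' + 1) * Real.exp (C * ℜ.L), fun k => ?_⟩
    rw [ℜ.ev_eq, norm_val_eq (s := s) (wd := wd) (q, x), ℜ.σ_eq]
    have hs := ℜ.scale_pos k.1.1
    rw [Real.norm_of_nonneg (zpow_nonneg hs.le _)]
    gcongr
    exact (norm_le_pi_norm (ℜ.vec s u wd k.1.1 k.1.2) (q, x)).trans (hv _ _ k.2)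

/-- Solutions of quasilinear transport equations: the derivatives of order at most one are controlled
on rays which are short compared to the scale. -/
theorem exists_first_order_bound (e : ∀ q, ℜ.frame.Van (ℜ.frame.field ℜ.a (u q) - f q))
    (h : ∀ S : Set (RayPt ℜ.ℓ),
      (∀ q, (ℜ.frame.reindex (Subtype.val : S → _)).IsSym JetFrame.unitCost 1 1 (s q) (u q)) →
      (∀ i, (ℜ.frame.reindex (Subtype.val : S → _)).IsSym JetFrame.unitCost 1 1
        (ℜ.frame.wt i - 1) (ℜ.a i)) ∧
      ∀ q, (ℜ.frame.reindex (Subtype.val : S → _)).IsSym JetFrame.unitCost 1 1 (s q - 1) (f q))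
    (h0 : ∀ q, ℜ.bd.IsSym JetFrame.unitCost 1 1 (s q) (u q)) :
    ∃ C₀, 0 < C₀ ∧ ∃ C, ∀ q, ∀ w : List I, w.length ≤ 1 → ∀ k : RayPt ℜ.ℓ,
      C₀ * ℜ.ℓ k.1.1 ≤ ℜ.scale k.1.1 →
      ‖ℜ.frame.ev (ℜ.frame.word w (u q)) k‖
        ≤ C * ℜ.frame.σ k ^ (s q - (ℜ.frame.wordWt w : ℤ)) := by
  classical
  let wd : Option I → List I := Option.toList
  have hwd : ∀ x, (wd x).length ≤ 1 := fun x => by cases x <;> simp [wd]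
  have hwd' : ∀ w : List I, w.length ≤ 1 → ∃ x, wd x = w := by
    intro w hw
    match w, hw with
    | [], _ => exact ⟨none, rfl⟩
    | [i], _ => exact ⟨some i, rfl⟩
  have hI : ∀ p : Q × Option I, ℜ.bd.ev (ℜ.bd.word (wd p.2) (u p.1)) =O[⊤]
        fun i => ℜ.bd.σ i ^ (s p.1 - (ℜ.bd.wordWt (wd p.2) : ℤ)) := fun p =>
    (h0 p.1).bound (by rw [JetFrame.sum_unitCost]; exact hwd _)
  obtain ⟨M, hM0, hM⟩ := exists_common_bound hI
  have hv0 : ∀ i, ‖ℜ.vec s u wd i 0‖ ≤ M := fun i => norm_vec_le hM0.le i 0 fun q x => by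
    have h1 := hM (q, x) i
    have hs := ℜ.scale_pos i
    have h2 : ℜ.bd.σ i = ℜ.scale i := ℜ.σ_eq _
    rw [h2, Real.norm_of_nonneg (by positivity), JetFrame.reindex_word,
      JetFrame.reindex_wordWt] at h1
    have h3 : ℜ.bd.ev (ℜ.frame.word (wd x) (u q)) i = ℜ.val (ℜ.frame.word (wd x) (u q)) i 0 :=
      ℜ.ev_eq _ _
    rwa [h3] at h1
  -- The region of the barrier argument. It is fixed by the bound `M` at the initial points, so the
  -- constant `C` obtained on it can be used to decide how short the rays must be.
  let S : Set (RayPt ℜ.ℓ) := {k | ‖ℜ.vec s u wd k.1.1 k.1.2‖ ≤ M + 1}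
  have huS : ∀ q, (ℜ.frame.reindex (Subtype.val : S → _)).IsSym JetFrame.unitCost 1 1 (s q)
      (u q) := by
    intro q w hw
    rw [JetFrame.sum_unitCost] at hw ⊢
    simp only [Pi.one_apply, ite_self, one_mul]
    obtain ⟨x, rfl⟩ := hwd' w hw
    refine isBigO_top.2 ⟨M + 1, fun k => ?_⟩
    rw [JetFrame.reindex_word, JetFrame.reindex_wordWt]
    have h3 : (ℜ.frame.reindex (Subtype.val : S → _)).ev (ℜ.frame.word (wd x) (u q)) k
      = ℜ.val (ℜ.frame.word (wd x) (u q)) k.1.1.1 k.1.1.2 := ℜ.ev_eq _ _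
    have h2 : (ℜ.frame.reindex (Subtype.val : S → _)).σ k = ℜ.scale k.1.1.1 := ℜ.σ_eq _
    rw [h3, h2, norm_val_eq (s := s) (wd := wd) (q, x)]
    have hs := ℜ.scale_pos k.1.1.1
    rw [Real.norm_of_nonneg (zpow_nonneg hs.le _)]
    gcongr
    exact (norm_le_pi_norm (ℜ.vec s u wd k.1.1.1 k.1.1.2) (q, x)).trans k.2
  obtain ⟨ha, hf⟩ := h S huS
  have hO : ∀ p : Q × Option I,
      (ℜ.frame.reindex (Subtype.val : S → _)).ev
        (ℜ.frame.field ℜ.a (ℜ.frame.word (wd p.2) (u p.1))) =O[⊤]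
        fun k => (ℜ.frame.reindex (Subtype.val : S → _)).σ k
          ^ (s p.1 - 1 - (ℜ.frame.wordWt (wd p.2) : ℤ)) := by
    intro p
    obtain ⟨f', hf', e'⟩ := JetFrame.transport_word (A := 1) (fun _ => le_rfl) (Or.inl ha)
      (huS p.1) (hf p.1) ((e p.1).reindex _) (wd p.2) (hwd _)
    have h1 := hf'.ev
    rw [← e'.eq, JetFrame.reindex_word, JetFrame.reindex_wordWt] at h1
    simp only [Pi.one_apply, ite_self, one_mul] at h1
    exact h1
  obtain ⟨C, hC0, hC⟩ := exists_common_bound hO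
  -- The factor 2 makes the inequality between `C / scale` and the rate of the barrier strict.
  refine ⟨2 * C, by positivity, M + 1, fun q w hw k hk => ?_⟩
  have hs := ℜ.scale_pos k.1.1
  obtain ⟨x, rfl⟩ := hwd' w hw
  have key := norm_le_of_barrier (K := 2 * C / ℜ.scale k.1.1) (M := M)
    (by rw [div_mul_eq_mul_div, div_le_one hs]; exact hk)
    (fun r hr => hasDerivWithinAt_vec (s := s) (u := u) (wd := wd) k.1.1 hr) (hv0 k.1.1)
    (fun r hr hle => ?_) _ k.2
  · rw [ℜ.ev_eq, norm_val_eq (s := s) (wd := wd) (q, x), ℜ.σ_eq]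
    gcongr
    exact (norm_le_pi_norm (ℜ.vec s u wd k.1.1 k.1.2) (q, x)).trans key
  · refine (norm_vecDeriv_le (b := C) hC0.le k.1.1 r fun q x => ?_).trans_lt ?_
    · have h1 := hC (q, x) ⟨⟨(k.1.1, r), hr⟩, hle⟩
      have h3 : ∀ F, (ℜ.frame.reindex (Subtype.val : S → _)).ev F ⟨⟨(k.1.1, r), hr⟩, hle⟩
        = ℜ.val F k.1.1 r := fun F => ℜ.ev_eq _ _
      have h2 : (ℜ.frame.reindex (Subtype.val : S → _)).σ ⟨⟨(k.1.1, r), hr⟩, hle⟩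
        = ℜ.scale k.1.1 := ℜ.σ_eq _
      rw [h3, h2, Real.norm_of_nonneg (by positivity)] at h1
      exact h1
    · gcongr; linarith

end RayFrame

/-! ### Symbols with estimates for all derivatives -/

namespace JetFrame

variable {I κ κ' ℛ : Type*} [CommRing ℛ] [Algebra ℂ ℛ]

/-- `D_w F = O(σ ^ (s - wt w))` for all words `w`. -/
def AllSym (𝔽 : JetFrame I κ ℛ) (s : ℤ) (F : ℛ) : Prop :=
  ∀ w : List I, 𝔽.ev (𝔽.word w F) =O[⊤] fun k => 𝔽.σ k ^ (s - (𝔽.wordWt w : ℤ))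

/-- All derivatives are bounded. -/
def Flat (𝔽 : JetFrame I κ ℛ) (F : ℛ) : Prop :=
  ∀ w : List I, 𝔽.ev (𝔽.word w F) =O[⊤] fun _ => (1 : ℝ)

variable {𝔽 : JetFrame I κ ℛ} {s r : ℤ} {F G : ℛ}

lemma AllSym.isSym (h : 𝔽.AllSym s F) (c : I → ℕ) (M : ℕ) : 𝔽.IsSym c 1 M s F := fun w _ => by
  simpa using h w

lemma allSym_iff_unit : 𝔽.AllSym s F ↔ ∀ M, 𝔽.IsSym unitCost 1 M s F :=
  ⟨fun h => h.isSym _, fun h w => by simpa using (h w.length).bound (by rw [sum_unitCost])⟩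

lemma allSym_of_normal [DecidableEq I] {n : I} (h : ∀ M, 𝔽.IsSym (normalCost n) 1 M s F) :
    𝔽.AllSym s F := allSym_iff_unit.2 (IsSym.unit_of_normal h)

lemma Flat.D (h : 𝔽.Flat F) (i : I) : 𝔽.Flat (𝔽.D i F) := fun w => h (i :: w)

/-- Weights are nonnegative and scales bounded above, so negative powers of the scale only weaken a
bound. -/
lemma Flat.allSym (h : 𝔽.Flat F) : 𝔽.AllSym 0 F := fun w => (h w).trans <| by
  simpa using zpow_isBigO (𝔽 := 𝔽) (s := 0) (r := 0 - (𝔽.wordWt w : ℤ)) (by omega)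

lemma Flat.one : 𝔽.Flat 1 := fun w => isBigO_top.2 ⟨1, fun k => by
  cases w with
  | nil => simp
  | cons i w => simp [word_zero]⟩

lemma Flat.reindex (h : 𝔽.Flat F) (p : κ' → κ) : (𝔽.reindex p).Flat F := fun w => by
  rw [reindex_word]
  exact (h w).comp_tendsto (tendsto_top (l := ⊤) (f := p))

namespace AllSym

lemma mono_exp (h : 𝔽.AllSym s F) (hr : r ≤ s) : 𝔽.AllSym r F := fun w =>
  (h w).trans (zpow_isBigO (by omega))

lemma add (hF : 𝔽.AllSym s F) (hG : 𝔽.AllSym s G) : 𝔽.AllSym s (F + G) :=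
  allSym_iff_unit.2 fun _ => (hF.isSym _ _).add (hG.isSym _ _)

lemma smul (hF : 𝔽.AllSym s F) (a : ℂ) : 𝔽.AllSym s (a • F) :=
  allSym_iff_unit.2 fun _ => (hF.isSym _ _).smul a

lemma mul (hF : 𝔽.AllSym s F) (hG : 𝔽.AllSym r G) : 𝔽.AllSym (s + r) (F * G) :=
  allSym_iff_unit.2 fun _ => (hF.isSym _ _).mul (fun _ => le_rfl) (hG.isSym _ _)

lemma sum {α : Type*} {t : Finset α} {F : α → ℛ} (h : ∀ a ∈ t, 𝔽.AllSym s (F a)) :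
    𝔽.AllSym s (∑ a ∈ t, F a) :=
  allSym_iff_unit.2 fun _ => IsSym.sum fun a ha => (h a ha).isSym _ _

lemma D (h : 𝔽.AllSym s F) (i : I) : 𝔽.AllSym (s - 𝔽.wt i) (𝔽.D i F) := fun w =>
  (h (i :: w)).congr_right fun k => by
    rw [wordWt_cons]; congr 1; push_cast; ring

lemma reindex (h : 𝔽.AllSym s F) (p : κ' → κ) : (𝔽.reindex p).AllSym s F := fun w => by
  rw [reindex_word, reindex_wordWt]
  exact (h w).comp_tendsto (tendsto_top (l := ⊤) (f := p))

end AllSym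

/-- Solutions of a linear transport equation at a noncharacteristic boundary. -/
lemma allSym_of_field [Fintype I] [DecidableEq I] {n : I} (hn : 𝔽.wt n = 2) {a : I → ℛ}
    {u δ f : ℛ} (ha : ∀ i, 𝔽.AllSym (𝔽.wt i - 1) (a i)) (han : 𝔽.σ =O[⊤] 𝔽.ev (a n))
    (hδ : 𝔽.AllSym (-1) δ) (hf : 𝔽.AllSym (s - 1) f)
    (e : 𝔽.Van (𝔽.field a u - (δ * u + f)))
    (hT : ∀ w : List I, n ∉ w →
      𝔽.ev (𝔽.word w u) =O[⊤] fun k => 𝔽.σ k ^ (s - (𝔽.wordWt w : ℤ))) :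
    𝔽.AllSym s u := by
  refine allSym_of_normal (n := n) fun M => ?_
  induction M with
  | zero => exact isSym_of_tangential hT (by omega)
  | succ M ih =>
    refine isSym_succ_of_field hn (fun i => (ha i).isSym _ _) han ih (f := δ * u + f) ?_ e hT
    exact (((hδ.isSym _ _).mul (one_le_normalCost n) ih).mono_exp (by omega)).add (hf.isSym _ _)

end JetFrame

open JetFrame

/-- Solutions of a linear transport equation along rays. -/
lemma RayFrame.allSym_of_bd {I ι ℛ : Type*} [CommRing ℛ] [Algebra ℂ ℛ] [Fintype I]
    {ℜ : RayFrame I ι ℛ} {s : ℤ} {u δ f : ℛ}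
    (ha : ∀ i, ℜ.frame.AllSym (ℜ.frame.wt i - 1) (ℜ.a i))
    (hδ : ℜ.frame.AllSym (-1) δ) (hf : ℜ.frame.AllSym (s - 1) f)
    (e : ℜ.frame.Van (ℜ.frame.field ℜ.a u - (δ * u + f))) (h0 : ℜ.bd.AllSym s u) :
    ℜ.frame.AllSym s u := by
  refine allSym_iff_unit.2 fun M => ?_
  induction M using Nat.strong_induction_on with
  | _ M ih =>
    -- The coefficients are already under control to all orders, so the equation is linear and no
    -- restriction on `M` is needed.
    refine RayFrame.isSym_of_bd (ℜ := ℜ) (Q := Unit) (M := M) (s := fun _ => s) (u := fun _ => u)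
      (f := fun _ => δ * u + f) (fun _ => e) (fun A hA hu => ⟨Or.inl fun i => (ha i).isSym _ _,
        fun q => ?_⟩) (fun N hN _ => ih N hN) (fun _ => h0.isSym _ _) ()
    exact ((IsSym.one_mul (fun _ => le_rfl) hA (hδ.isSym _ _) (hu q)).mono_exp (by omega)).add
      ((hf.isSym _ _).of_one hA)

/-! ### Phase functions -/

/-- The directions of the variables `x_j`, `t`, `y_j`, `θ_j`. -/
abbrev Dir (d : ℕ) : Type := Fin d ⊕ Unit ⊕ Fin d ⊕ Fin d

namespace Dir

variable {d : ℕ}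

/-- The direction of `x_j`. -/
abbrev x (j : Fin d) : Dir d := Sum.inl j
/-- The direction of `t`. -/
abbrev t : Dir d := Sum.inr (Sum.inl ())
/-- The direction of `y_j`. -/
abbrev y (j : Fin d) : Dir d := Sum.inr (Sum.inr (Sum.inl j))
/-- The direction of `θ_j`. -/
abbrev θ (j : Fin d) : Dir d := Sum.inr (Sum.inr (Sum.inr j))

variable [NeZero d]

/-- The weights: `2` for the normal derivative, `0` for the derivatives with respect to the
tangential covariables, and `1` for all others. -/
def wt : Dir d → ℕ :=
  Sum.elim (fun j => if j = 0 then 2 else 1) (Sum.elim (fun _ => 1) (Sum.elim (fun _ => 1)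
    fun j => if j = 0 then 1 else 0))

end Dir

/-! ### The eikonal equation, differentiated, and the orders of its coefficients -/

/-- The coefficients of the operator, as elements of the algebra. -/
structure OpCoeffs (d : ℕ) [NeZero d] (ℛ : Type*) [CommRing ℛ] where
  /-- the metric -/
  g : Fin d → Fin d → ℛ
  /-- the magnetic potential -/
  W : Fin d → ℛ
  /-- the scalar potential -/
  V : ℛ
  symm : ∀ j k, g j k = g k j
  normal_g : ∀ k, g 0 k = if k = 0 then 1 else 0
  normal_W : W 0 = 0

namespace OpCoeffs

variable {d : ℕ} [NeZero d] {ℛ κ : Type*} [CommRing ℛ] [Algebra ℂ ℛ] (a : OpCoeffs d ℛ)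
  (D : Dir d → Derivation ℂ ℛ ℛ) (φ : ℛ)

/-- `∂_{x_k} φ - V_k`. -/
def p (k : Fin d) : ℛ := D (Dir.x k) φ - a.W k

/-- The group velocity. -/
def vel (j : Fin d) : ℛ := (2 : ℂ) • ∑ k, a.g j k * a.p D φ k

/-- The symbol at the differential of `φ`. -/
def sym : ℛ := (∑ j, ∑ k, a.g j k * a.p D φ j * a.p D φ k) + a.V

/-- The right hand sides of the transport equations for the derivatives of the phase. -/
def force (m : Fin d) : ℛ :=
  (∑ j, a.vel D φ j * D (Dir.x m) (a.W j))
    - (∑ j, ∑ k, D (Dir.x m) (a.g j k) * (a.p D φ j * a.p D φ k)) - D (Dir.x m) a.V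

/-- The coefficients of the transport operator `∂_t - ∑ a^{(j)} ∂_j`. -/
def transport : Dir d → ℛ :=
  Sum.elim (fun j => -a.vel D φ j) (Sum.elim (fun _ => 1) fun _ => 0)

/-- The zero order term of the transport equations for amplitudes. -/
def divg : ℛ := ∑ j, D (Dir.x j) (∑ k, a.g j k * a.p D φ k)

/-- The source of the transport equation for an amplitude which follows `B`. -/
def source (B : ℛ) : ℛ := (-Complex.I) • ∑ j, D (Dir.x j) (∑ k, a.g j k * D (Dir.x k) B)

/-- The exponents of the symbol classes of the first derivatives of the phase. -/
def phaseExp (m : Fin d) : ℤ := if m = 0 then 1 else 0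

variable {a D φ}

/-- The normal form of the metric and of the magnetic potential enters here: the normal velocity is
of size `σ` at the boundary, and no tangential component contributes to it. -/
lemma vel_zero : a.vel D φ 0 = (2 : ℂ) • D (Dir.x 0) φ := by
  simp [vel, p, a.normal_g, a.normal_W]

lemma field_transport (𝔽 : JetFrame (Dir d) κ ℛ) (G : ℛ) :
    𝔽.field (a.transport D φ) G
      = 𝔽.D Dir.t G - ∑ j, a.vel D φ j * 𝔽.D (Dir.x j) G := by
  simp [JetFrame.field, transport, Fintype.sum_sum_type]
  ring

/-- The differentiated eikonal equation. -/
lemma van_force (𝔽 : JetFrame (Dir d) κ ℛ) {Q : ℛ} (hQ : ∀ m, 𝔽.D (Dir.x m) Q = 0)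
    (he : 𝔽.Van (a.sym 𝔽.D φ - Q)) (ht : 𝔽.Van (𝔽.D Dir.t φ)) (m : Fin d) :
    𝔽.Van (𝔽.field (a.transport 𝔽.D φ) (𝔽.D (Dir.x m) φ) - -a.force 𝔽.D φ m) := by
  -- The phase does not depend on `t`, so `∂_t φ` may be added to the eikonal equation for free; its
  -- derivative in `x_m` then contains the full transport operator applied to `∂_m φ`.
  have h := (ht.D (Dir.x m)).sub (he.D (Dir.x m))
  convert h using 1
  rw [field_transport, map_sub, hQ, 𝔽.D_comm Dir.t]
  have hp : ∀ j, 𝔽.D (Dir.x m) (a.p 𝔽.D φ j)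
      = 𝔽.D (Dir.x j) (𝔽.D (Dir.x m) φ) - 𝔽.D (Dir.x m) (a.W j) := fun j => by
    rw [p, map_sub, 𝔽.D_comm]
  have h1 : 𝔽.D (Dir.x m) (a.sym 𝔽.D φ)
      = (∑ j, ∑ k, 𝔽.D (Dir.x m) (a.g j k) * (a.p 𝔽.D φ j * a.p 𝔽.D φ k))
        + (∑ j, ∑ k, a.g j k * a.p 𝔽.D φ k * 𝔽.D (Dir.x m) (a.p 𝔽.D φ j))
        + (∑ j, ∑ k, a.g j k * a.p 𝔽.D φ j * 𝔽.D (Dir.x m) (a.p 𝔽.D φ k))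
        + 𝔽.D (Dir.x m) a.V := by
    simp only [sym, map_add, map_sum, Derivation.leibniz, smul_eq_mul, ← Finset.sum_add_distrib]
    congr 1
    refine Finset.sum_congr rfl fun j _ => Finset.sum_congr rfl fun k _ => ?_
    ring
  have h2 : (∑ j, ∑ k, a.g j k * a.p 𝔽.D φ j * 𝔽.D (Dir.x m) (a.p 𝔽.D φ k))
      = ∑ j, ∑ k, a.g j k * a.p 𝔽.D φ k * 𝔽.D (Dir.x m) (a.p 𝔽.D φ j) := by
    rw [Finset.sum_comm]
    refine Finset.sum_congr rfl fun j _ => Finset.sum_congr rfl fun k _ => ?_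
    rw [a.symm]
  have h3 : ∑ j, a.vel 𝔽.D φ j * 𝔽.D (Dir.x m) (a.p 𝔽.D φ j)
      = (∑ j, ∑ k, a.g j k * a.p 𝔽.D φ k * 𝔽.D (Dir.x m) (a.p 𝔽.D φ j))
        + ∑ j, ∑ k, a.g j k * a.p 𝔽.D φ k * 𝔽.D (Dir.x m) (a.p 𝔽.D φ j) := by
    rw [← Finset.sum_add_distrib]
    refine Finset.sum_congr rfl fun j _ => ?_
    rw [vel, two_smul, add_mul, Finset.sum_mul]
  rw [h1, h2, force]
  simp only [hp, mul_sub, Finset.sum_sub_distrib] at h3 ⊢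
  linear_combination -h3

section Classes

variable {𝔽 : JetFrame (Dir d) κ ℛ} (hwt : 𝔽.wt = Dir.wt) {c : Dir d → ℕ} (hc : ∀ i, 1 ≤ c i)
  {A : κ → ℝ} (hA : ∀ k, 1 ≤ A k) {M : ℕ} (hg : ∀ j k, 𝔽.Flat (a.g j k)) (hW : ∀ j, 𝔽.Flat (a.W j))
  (hV : 𝔽.Flat a.V)

include hA hW in
lemma isSym_p (hu : ∀ m, 𝔽.IsSym c A M (phaseExp m) (𝔽.D (Dir.x m) φ)) (m : Fin d) :
    𝔽.IsSym c A M (phaseExp m) (a.p 𝔽.D φ m) := by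
  refine (hu m).sub ?_
  by_cases hm : m = 0
  · rw [hm, a.normal_W]; exact IsSym.zero
  · rw [phaseExp, if_neg hm]; exact ((hW m).allSym.isSym _ _).of_one hA

lemma phaseExp_nonneg (m : Fin d) : 0 ≤ phaseExp m := by unfold phaseExp; split_ifs <;> norm_num
lemma phaseExp_le (m : Fin d) : phaseExp m ≤ 1 := by unfold phaseExp; split_ifs <;> norm_num

include hc hA hg hW in
lemma isSym_vel (hu : ∀ m, 𝔽.IsSym c A M (phaseExp m) (𝔽.D (Dir.x m) φ)) (j : Fin d) :
    𝔽.IsSym c A M (phaseExp j) (a.vel 𝔽.D φ j) := by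
  by_cases hj : j = 0
  · rw [hj, vel_zero]; exact (hu 0).smul _
  · rw [phaseExp, if_neg hj]
    refine IsSym.smul (IsSym.sum fun k _ => ?_) _
    exact (IsSym.one_mul hc hA ((hg j k).allSym.isSym _ _) (isSym_p hA hW hu k)).mono_exp
      (by have := phaseExp_nonneg k; omega)

include hwt hc hA hg hW in
-- The exponents `wt i - 1` say that each term `a_i D_i` of the transport field lowers the order by
-- one.
lemma isSym_transport (hu : ∀ m, 𝔽.IsSym c A M (phaseExp m) (𝔽.D (Dir.x m) φ)) (i : Dir d) :
    𝔽.IsSym c A M (𝔽.wt i - 1) (a.transport 𝔽.D φ i) := by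
  rw [hwt]
  rcases i with j | _ | j | j
  · have : ((Dir.wt (Sum.inl j) : ℕ) : ℤ) - 1 = phaseExp j := by
      simp only [Dir.wt, phaseExp, Sum.elim_inl]; split_ifs <;> norm_num
    rw [this]
    exact (isSym_vel hc hA hg hW hu j).neg
  · simpa [Dir.wt, transport] using (Flat.one.allSym.isSym c M).of_one hA
  · exact IsSym.zero
  · exact IsSym.zero

include hc hA hg hW hV in
-- The force is a polynomial of degree at most two in the gradient, hence of order 0. The quadratic
-- terms are linear in the highest derivatives only if `1 ≤ M`; otherwise `A = 1` is needed.
lemma isSym_force (hAM : A = 1 ∨ 1 ≤ M)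
    (hu : ∀ m, 𝔽.IsSym c A M (phaseExp m) (𝔽.D (Dir.x m) φ)) (m : Fin d) :
    𝔽.IsSym c A M (phaseExp m - 1) (-a.force 𝔽.D φ m) := by
  have hf : 𝔽.IsSym c A M 0 (a.force 𝔽.D φ m) := by
    refine ((IsSym.sum fun j _ => ?_).sub (IsSym.sum fun j _ => IsSym.sum fun k _ => ?_)).sub
      (((hV.D _).allSym.isSym _ _).of_one hA)
    · rw [mul_comm]
      exact (IsSym.one_mul hc hA (((hW j).D _).allSym.isSym _ _)
        (isSym_vel hc hA hg hW hu j)).mono_exp (by have := phaseExp_nonneg j; omega)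
    · have hj := isSym_p hA hW hu j
      have hk := isSym_p hA hW hu k
      have hjk : 𝔽.IsSym c A M (phaseExp j + phaseExp k) (a.p 𝔽.D φ j * a.p 𝔽.D φ k) := by
        rcases hAM with rfl | hM
        · exact IsSym.mul hc hj hk
        · exact IsSym.mul_of_pos hc hA hM hj hk
      exact (IsSym.one_mul hc hA (((hg j k).D _).allSym.isSym _ _) hjk).mono_exp (by
        have := phaseExp_nonneg j; have := phaseExp_nonneg k; omega)
  exact hf.neg.mono_exp (by have := phaseExp_le m; omega)

end Classes

/-- The reflected phase at the boundary. -/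
theorem allSym_phase_boundary {𝔽 : JetFrame (Dir d) κ ℛ} (hwt : 𝔽.wt = Dir.wt)
    (hg : ∀ j k, 𝔽.Flat (a.g j k)) (hW : ∀ j, 𝔽.Flat (a.W j)) (hV : 𝔽.Flat a.V)
    {Q : ℛ} (hQ : ∀ m, 𝔽.D (Dir.x m) Q = 0)
    (he : 𝔽.Van (a.sym 𝔽.D φ - Q)) (ht : 𝔽.Van (𝔽.D Dir.t φ))
    (hσ : 𝔽.σ =O[⊤] 𝔽.ev (a.transport 𝔽.D φ (Dir.x 0)))
    (hT : ∀ m, ∀ w : List (Dir d), Dir.x 0 ∉ w → 𝔽.ev (𝔽.word w (𝔽.D (Dir.x m) φ)) =O[⊤]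
      fun k => 𝔽.σ k ^ (phaseExp m - (𝔽.wordWt w : ℤ))) (m : Fin d) :
    𝔽.AllSym (phaseExp m) (𝔽.D (Dir.x m) φ) := by
  suffices h : ∀ M m, 𝔽.IsSym (normalCost (Dir.x 0)) 1 M (phaseExp m) (𝔽.D (Dir.x m) φ) from
    allSym_of_normal fun M => h M m
  intro M
  have hn : 𝔽.wt (Dir.x 0) = 2 := by simp [hwt, Dir.wt]
  induction M with
  | zero => exact fun m => isSym_of_tangential (hT m) (by omega)
  | succ M ih =>
    intro m
    exact isSym_succ_of_field hn
      (isSym_transport hwt (one_le_normalCost _) (fun _ => le_rfl) hg hW ih) hσ (ih m)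
      (isSym_force (one_le_normalCost _) (fun _ => le_rfl) hg hW hV (Or.inl rfl) ih m)
      (van_force 𝔽 hQ he ht m) (hT m)

variable {ι : Type*} {ℜ : RayFrame (Dir d) ι ℛ}

/-- Short rays, on which the derivatives of the reflected phase of order at most two are under
control. -/
theorem exists_phase_bound (hwt : ℜ.frame.wt = Dir.wt)
    (ha : ℜ.a = a.transport ℜ.frame.D φ)
    (hg : ∀ j k, ℜ.frame.Flat (a.g j k)) (hW : ∀ j, ℜ.frame.Flat (a.W j)) (hV : ℜ.frame.Flat a.V)
    {Q : ℛ} (hQ : ∀ m, ℜ.frame.D (Dir.x m) Q = 0)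
    (he : ℜ.frame.Van (a.sym ℜ.frame.D φ - Q)) (ht : ℜ.frame.Van (ℜ.frame.D Dir.t φ))
    (h0 : ∀ m, ℜ.bd.AllSym (phaseExp m) (ℜ.frame.D (Dir.x m) φ)) :
    ∃ C₀, 0 < C₀ ∧ ∃ C, ∀ m, ∀ w : List (Dir d), w.length ≤ 1 → ∀ k : RayPt ℜ.ℓ,
      C₀ * ℜ.ℓ k.1.1 ≤ ℜ.scale k.1.1 →
      ‖ℜ.frame.ev (ℜ.frame.word w (ℜ.frame.D (Dir.x m) φ)) k‖
        ≤ C * ℜ.frame.σ k ^ (phaseExp m - (ℜ.frame.wordWt w : ℤ)) := by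
  refine RayFrame.exists_first_order_bound (ℜ := ℜ) (Q := Fin d) (s := phaseExp)
    (u := fun m => ℜ.frame.D (Dir.x m) φ) (f := fun m => -a.force ℜ.frame.D φ m)
    (fun m => ?_) (fun S hS => ?_) fun m => (h0 m).isSym _ _
  · rw [ha]; exact van_force ℜ.frame hQ he ht m
  · have c1 : ∀ i : Dir d, 1 ≤ unitCost i := fun _ => le_rfl
    have hg' := fun j k => (hg j k).reindex (Subtype.val : S → _)
    have hW' := fun j => (hW j).reindex (Subtype.val : S → _)
    have hV' := hV.reindex (Subtype.val : S → _)
    refine ⟨fun i => ?_, fun m => ?_⟩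
    · rw [ha]
      exact isSym_transport (𝔽 := ℜ.frame.reindex (Subtype.val : S → _)) hwt c1 (fun _ => le_rfl)
        hg' hW' hS i
    · exact isSym_force (𝔽 := ℜ.frame.reindex (Subtype.val : S → _)) c1 (fun _ => le_rfl)
        hg' hW' hV' (Or.inl rfl) hS m

/-- The reflected phase along the rays. -/
theorem allSym_phase (hwt : ℜ.frame.wt = Dir.wt)
    (ha : ℜ.a = a.transport ℜ.frame.D φ)
    (hg : ∀ j k, ℜ.frame.Flat (a.g j k)) (hW : ∀ j, ℜ.frame.Flat (a.W j)) (hV : ℜ.frame.Flat a.V)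
    {Q : ℛ} (hQ : ∀ m, ℜ.frame.D (Dir.x m) Q = 0)
    (he : ℜ.frame.Van (a.sym ℜ.frame.D φ - Q)) (ht : ℜ.frame.Van (ℜ.frame.D Dir.t φ))
    (h0 : ∀ m, ℜ.bd.AllSym (phaseExp m) (ℜ.frame.D (Dir.x m) φ))
    (h1 : ∀ m, ℜ.frame.IsSym unitCost 1 1 (phaseExp m) (ℜ.frame.D (Dir.x m) φ)) (m : Fin d) :
    ℜ.frame.AllSym (phaseExp m) (ℜ.frame.D (Dir.x m) φ) := by
  suffices h : ∀ M m, ℜ.frame.IsSym unitCost 1 M (phaseExp m) (ℜ.frame.D (Dir.x m) φ) from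
    allSym_iff_unit.2 fun M => h M m
  intro M
  induction M using Nat.strong_induction_on with
  | _ M ih =>
    -- Orders below 2 are the nonlinear ones, supplied by `h1`; from order 2 on, products of two
    -- derivatives of the gradient are linear in the highest ones.
    rcases Nat.lt_or_ge M 2 with hM | hM
    · exact fun m => (h1 m).lower_one (by omega)
    · have c1 : ∀ i : Dir d, 1 ≤ unitCost i := fun _ => le_rfl
      refine RayFrame.isSym_of_bd (ℜ := ℜ) (Q := Fin d) (s := phaseExp)
        (u := fun m => ℜ.frame.D (Dir.x m) φ) (f := fun m => -a.force ℜ.frame.D φ m)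
        (fun m => ?_) (fun A hA hu => ⟨Or.inr ⟨hM, fun i => ?_⟩, fun m => ?_⟩) ih
        fun m => (h0 m).isSym _ _
      · rw [ha]; exact van_force ℜ.frame hQ he ht m
      · rw [ha]; exact isSym_transport hwt c1 hA hg hW hu i
      · exact isSym_force c1 hA hg hW hV (Or.inr (by omega)) hu m

/-! ### Orders of the terms in the amplitude equations -/

section Amplitude

variable {𝔽 : JetFrame (Dir d) κ ℛ} (hwt : 𝔽.wt = Dir.wt) (hg : ∀ j k, 𝔽.Flat (a.g j k))
  (hW : ∀ j, 𝔽.Flat (a.W j))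

include hwt hg hW in
lemma allSym_transport (hu : ∀ m, 𝔽.AllSym (phaseExp m) (𝔽.D (Dir.x m) φ)) (i : Dir d) :
    𝔽.AllSym (𝔽.wt i - 1) (a.transport 𝔽.D φ i) :=
  allSym_iff_unit.2 fun _ => isSym_transport hwt (fun _ => le_rfl) (fun _ => le_rfl) hg hW
    (fun m => (hu m).isSym _ _) i

include hwt hg hW in
-- The summand of index `j` is half of `∂_j` of the velocity, and `∂_j` lowers the order of that
-- component to -1 in all cases: from 1 by 2, or from 0 by 1.
lemma allSym_divg (hu : ∀ m, 𝔽.AllSym (phaseExp m) (𝔽.D (Dir.x m) φ)) :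
    𝔽.AllSym (-1) (a.divg 𝔽.D φ) := by
  refine AllSym.sum fun j _ => ?_
  have h1 : 𝔽.AllSym (phaseExp j) (a.vel 𝔽.D φ j) :=
    allSym_iff_unit.2 fun _ => isSym_vel (fun _ => le_rfl) (fun _ => le_rfl) hg hW
      (fun m => (hu m).isSym _ _) j
  have h2 := ((h1.smul (1 / 2)).D (Dir.x j)).mono_exp (r := -1) (by
    simp only [hwt, Dir.wt, phaseExp, Sum.elim_inl]; split_ifs <;> norm_num)
  rwa [vel, smul_smul, one_div_mul_cancel two_ne_zero, one_smul] at h2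

include hwt hg in
-- Two derivatives in `x`, each of weight at most 2.
lemma allSym_source {s : ℤ} {B : ℛ} (hB : 𝔽.AllSym s B) :
    𝔽.AllSym (s - 4) (a.source 𝔽.D B) := by
  have w2 : ∀ j : Fin d, (𝔽.wt (Dir.x j) : ℤ) ≤ 2 := fun j => by
    simp only [hwt, Dir.wt, Sum.elim_inl]; split_ifs <;> norm_num
  refine AllSym.smul (AllSym.sum fun j _ => ?_) _
  have h1 : 𝔽.AllSym (s - 2) (∑ k, a.g j k * 𝔽.D (Dir.x k) B) := by
    refine AllSym.sum fun k _ => ?_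
    exact ((hg j k).allSym.mul (hB.D _)).mono_exp (by have := w2 k; omega)
  exact (h1.D _).mono_exp (by have := w2 j; omega)

end Amplitude

end OpCoeffs

/-! ### Cutoff functions -/

section Cutoff

variable {E : Type*} [NormedAddCommGroup E] [NormedSpace ℝ E]

lemma exists_cutoff [FiniteDimensional ℝ E] {K U : Set E} (hK : IsClosed K) (hU : IsOpen U)
    (hKU : K ⊆ U) : ∃ χ : E → ℝ, ContDiff ℝ ∞ χ ∧ (∀ z ∉ U, χ =ᶠ[𝓝 z] 0) ∧
      ∃ V, IsOpen V ∧ K ⊆ V ∧ V ⊆ U ∧ ∀ z ∈ V, χ z = 1 := by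
  obtain ⟨f, h0, h1, -⟩ := exists_contMDiffMap_zero_one_nhds_of_isClosed (n := (⊤ : ℕ∞))
    (modelWithCornersSelf ℝ E) hU.isClosed_compl hK
    (Set.disjoint_left.2 fun z hz hz' => hz (hKU hz'))
  refine ⟨f, f.contMDiff.contDiff, fun z hz => ?_, ?_⟩
  · exact eventually_nhdsSet_iff_forall.1 h0 z hz
  · obtain ⟨V, hV, hKV, hV1⟩ := eventually_nhdsSet_iff_exists.1 h1
    exact ⟨V ∩ U, hV.inter hU, fun z hz => ⟨hKV hz, hKU hz⟩, Set.inter_subset_right,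
      fun z hz => hV1 z hz.1⟩

lemma contDiff_cutoff_smul {G : Type*} [NormedAddCommGroup G] [NormedSpace ℝ G] {U : Set E}
    (hU : IsOpen U) {χ : E → ℝ} (hχ : ContDiff ℝ ∞ χ) (h0 : ∀ z ∉ U, χ =ᶠ[𝓝 z] 0) {F : E → G}
    (hF : ContDiffOn ℝ ∞ F U) : ContDiff ℝ ∞ fun z => χ z • F z := by
  rw [contDiff_iff_contDiffAt]
  intro z
  by_cases hz : z ∈ U
  · exact hχ.contDiffAt.smul (hF.contDiffAt (hU.mem_nhds hz))
  · refine (contDiffAt_const (c := (0 : G))).congr_of_eventuallyEq ?_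
    filter_upwards [h0 z hz] with y hy
    simp [hy]

end Cutoff

/-! ### Iterated derivatives of functions of `(x, t, y, θ)` -/

section Deriv

variable {d : ℕ}

/-- The unit vectors. -/
noncomputable def Dir.vec : Dir d → AmpPt d :=
  Sum.elim (fun j => (EuclideanSpace.single j 1, 0, 0, 0)) (Sum.elim (fun _ => (0, 1, 0, 0))
    (Sum.elim (fun j => (0, 0, EuclideanSpace.single j 1, 0))
      fun j => (0, 0, 0, EuclideanSpace.single j 1)))

/-- Iterated derivatives; the first letter acts first. -/
noncomputable def wordDeriv : List (Dir d) → (AmpPt d → ℂ) → AmpPt d → ℂ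
  | [], F => F
  | i :: w, F => wordDeriv w (dirDeriv i.vec F)

variable {F G : AmpPt d → ℂ} {v : AmpPt d}

lemma ContDiff.dirDeriv (h : ContDiff ℝ ∞ F) (v : AmpPt d) : ContDiff ℝ ∞ (dirDeriv v F) :=
  (h.fderiv_right (m := ∞) le_rfl).clm_apply contDiff_const

lemma ContDiff.wordDeriv (h : ContDiff ℝ ∞ F) (w : List (Dir d)) :
    ContDiff ℝ ∞ (wordDeriv w F) := by
  induction w generalizing F with
  | nil => exact h
  | cons i w ih => exact ih (h.dirDeriv _)

lemma dirDeriv_comm (h : ContDiff ℝ ∞ F) (u v : AmpPt d) :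
    dirDeriv u (dirDeriv v F) = dirDeriv v (dirDeriv u F) := by
  funext z
  have h1 : DifferentiableAt ℝ (fderiv ℝ F) z :=
    ((h.fderiv_right (m := 1) (by norm_cast)).differentiable (by norm_num)) z
  have h2 : ∀ a b : AmpPt d, dirDeriv a (dirDeriv b F) z = fderiv ℝ (fderiv ℝ F) z a b := by
    intro a b
    unfold dirDeriv
    rw [fderiv_clm_apply h1 (differentiableAt_const _)]
    simp
  rw [h2, h2]
  exact (h.contDiffAt.isSymmSndFDerivAt (by simp; norm_cast)) u v

lemma Filter.EventuallyEq.dirDeriv {z : AmpPt d} (h : F =ᶠ[𝓝 z] G) (v : AmpPt d) :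
    dirDeriv v F =ᶠ[𝓝 z] dirDeriv v G := by
  filter_upwards [h.fderiv (𝕜 := ℝ)] with y hy
  simp only [_root_.dirDeriv, hy]

lemma Filter.EventuallyEq.wordDeriv {z : AmpPt d} (h : F =ᶠ[𝓝 z] G) (w : List (Dir d)) :
    wordDeriv w F =ᶠ[𝓝 z] wordDeriv w G := by
  induction w generalizing F G with
  | nil => exact h
  | cons i w ih => exact ih (h.dirDeriv _)

lemma wordDeriv_append (v w : List (Dir d)) (F : AmpPt d → ℂ) :
    wordDeriv (v ++ w) F = wordDeriv w (wordDeriv v F) := by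
  induction v generalizing F with
  | nil => rfl
  | cons i v ih => exact ih _

/-- Mixed derivatives of smooth functions commute. Thus bounds indexed by multi-indices can be used
for words, whose letters come in any order. -/
lemma wordDeriv_perm {v w : List (Dir d)} (h : v.Perm w) (hF : ContDiff ℝ ∞ F) :
    wordDeriv v F = wordDeriv w F := by
  induction h generalizing F with
  | nil => rfl
  | cons i _ ih => exact ih (hF.dirDeriv _)
  | swap i j l => simp only [wordDeriv, dirDeriv_comm hF]
  | trans _ _ ih1 ih2 => rw [ih1 hF, ih2 hF]

instance {α β : Type*} [BEq α] [BEq β] [LawfulBEq α] [LawfulBEq β] : LawfulBEq (α ⊕ β) where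
  rfl := by
    rintro (a | b)
    · exact beq_self_eq_true a
    · exact beq_self_eq_true b
  eq_of_beq := by
    rintro (a | a) (b | b) h
    · exact congrArg Sum.inl (eq_of_beq (α := α) h)
    · exact absurd h Bool.false_ne_true
    · exact absurd h Bool.false_ne_true
    · exact congrArg Sum.inr (eq_of_beq (α := β) h)

/-- A word with prescribed multiplicities. -/
def multiWord (c : Fin d → Dir d) (α : Fin d → ℕ) : List (Dir d) :=
  (List.finRange d).reverse.flatMap fun i => List.replicate (α i) (c i)

/-- The word of a mixed partial derivative. -/
def ampWord (α : Fin d → ℕ) (m : ℕ) (β γ : Fin d → ℕ) : List (Dir d) :=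
  multiWord Dir.θ γ ++ multiWord Dir.y β ++ List.replicate m Dir.t ++ multiWord Dir.x α

lemma wordDeriv_replicate (i : Dir d) (n : ℕ) (F : AmpPt d → ℂ) :
    wordDeriv (List.replicate n i) F = (dirDeriv i.vec)^[n] F := by
  induction n generalizing F with
  | zero => rfl
  | succ n ih => rw [List.replicate_succ, wordDeriv, ih, Function.iterate_succ_apply]

lemma multiDeriv_eq (c : Fin d → Dir d) (α : Fin d → ℕ) (F : AmpPt d → ℂ) :
    multiDeriv (fun i => (c i).vec) α F = wordDeriv (multiWord c α) F := by
  unfold multiDeriv multiWord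
  induction List.finRange d with
  | nil => rfl
  | cons i l ih =>
    rw [List.foldr_cons, ih, List.reverse_cons, List.flatMap_append, wordDeriv_append]
    simp [wordDeriv_replicate]

lemma ampDeriv_eq (α : Fin d → ℕ) (m : ℕ) (β γ : Fin d → ℕ) (F : AmpPt d → ℂ) :
    ampDeriv α m β γ F = wordDeriv (ampWord α m β γ) F := by
  unfold ampDeriv ampWord
  rw [wordDeriv_append, wordDeriv_append, wordDeriv_append, ← multiDeriv_eq, ← multiDeriv_eq,
    ← multiDeriv_eq, wordDeriv_replicate]
  rfl

lemma count_multiWord (c : Fin d → Dir d) (α : Fin d → ℕ) (a : Dir d) :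
    (multiWord c α).count a = ∑ i, if c i = a then α i else 0 := by
  rw [multiWord, List.count_flatMap, ← List.sum_reverse, ← List.map_reverse, List.reverse_reverse,
    ← List.ofFn_eq_map, List.sum_ofFn]
  refine Finset.sum_congr rfl fun i _ => ?_
  simp [List.count_replicate]

lemma perm_ampWord (w : List (Dir d)) :
    w.Perm (ampWord (fun j => w.count (Dir.x j)) (w.count Dir.t) (fun j => w.count (Dir.y j))
      fun j => w.count (Dir.θ j)) := by
  rw [List.perm_iff_count]
  intro a
  simp only [ampWord, List.count_append, count_multiWord, List.count_replicate]
  rcases a with j | ⟨⟩ | j | j <;> simp [Dir.x, Dir.t, Dir.y, Dir.θ]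

/-- The sum of a function over the letters of a word. -/
lemma sum_map_multiWord (c : Fin d → Dir d) (α : Fin d → ℕ) (f : Dir d → ℕ) :
    ((multiWord c α).map f).sum = ∑ i, α i * f (c i) := by
  rw [multiWord, List.map_flatMap]
  have : ∀ l : List (Fin d), ((l.reverse.flatMap fun i => (List.replicate (α i) (c i)).map f)).sum
      = (l.map fun i => α i * f (c i)).sum := by
    intro l
    induction l with
    | nil => rfl
    | cons i l ih =>
      rw [List.reverse_cons, List.flatMap_append, List.sum_append, ih]
      simp [add_comm]
  rw [this, ← List.ofFn_eq_map, List.sum_ofFn]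

/-! ### Vanishing on sets -/

/-- Functions which vanish on a set, in an open set, have vanishing tangential derivatives. -/
lemma dirDeriv_eq_zero_of_line (hF : ContDiff ℝ ∞ F) {U S : Set (AmpPt d)} (hU : IsOpen U)
    (hS : ∀ z ∈ S, ∀ r : ℝ, z + r • v ∈ S) (h : ∀ z ∈ U ∩ S, F z = 0) :
    ∀ z ∈ U ∩ S, dirDeriv v F z = 0 := by
  rintro z ⟨hzU, hzS⟩
  have h1 : HasDerivAt (fun r : ℝ => F (z + r • v)) (fderiv ℝ F z v) 0 := by
    have h2 : HasDerivAt (fun r : ℝ => z + r • v) v 0 := by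
      simpa using ((hasDerivAt_id (0 : ℝ)).smul_const v).const_add z
    have h3 : HasFDerivAt F (fderiv ℝ F z) (z + (0 : ℝ) • v) := by
      simpa using (hF.differentiable (by simp) z).hasFDerivAt
    exact h3.comp_hasDerivAt 0 h2
  have h2 : (fun r : ℝ => F (z + r • v)) =ᶠ[𝓝 0] fun _ => 0 := by
    have : Tendsto (fun r : ℝ => z + r • v) (𝓝 0) (𝓝 z) := by
      have : Continuous fun r : ℝ => z + r • v := by fun_prop
      simpa using this.tendsto 0
    filter_upwards [this (hU.mem_nhds hzU)] with r hr
    exact h _ ⟨hr, hS z hzS r⟩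
  exact h1.unique ((hasDerivAt_const (0 : ℝ) (0 : ℂ)).congr_of_eventuallyEq h2)

lemma wordDeriv_eq_zero_of_line (hF : ContDiff ℝ ∞ F) {U S : Set (AmpPt d)} (hU : IsOpen U)
    (h : ∀ z ∈ U ∩ S, F z = 0) {w : List (Dir d)}
    (hS : ∀ i ∈ w, ∀ z ∈ S, ∀ r : ℝ, z + r • i.vec ∈ S) :
    ∀ z ∈ U ∩ S, wordDeriv w F z = 0 := by
  induction w generalizing F with
  | nil => exact h
  | cons i w ih =>
    exact ih (hF.dirDeriv _) (dirDeriv_eq_zero_of_line hF hU (hS i (by simp)) h)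
      fun j hj => hS j (by simp [hj])

/-- A convex set with interior points determines derivatives uniquely up to its boundary. So an
equation valid only for `x₁ ≥ 0` yields all derivatives at boundary points too, the normal ones
included. -/
lemma dirDeriv_eq_zero_of_convex (hF : ContDiff ℝ ∞ F) {U S : Set (AmpPt d)} (hU : IsOpen U)
    (hS : Convex ℝ S) (hS' : (interior S).Nonempty) (h : ∀ z ∈ U ∩ S, F z = 0) :
    ∀ z ∈ U ∩ S, dirDeriv v F z = 0 := by
  rintro z ⟨hzU, hzS⟩
  have hu : UniqueDiffWithinAt ℝ (S ∩ U) z :=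
    (uniqueDiffWithinAt_convex hS hS' (subset_closure hzS)).inter (hU.mem_nhds hzU)
  have h1 : HasFDerivWithinAt F (fderiv ℝ F z) (S ∩ U) z :=
    (hF.differentiable (by simp) z).hasFDerivAt.hasFDerivWithinAt
  have h2 : HasFDerivWithinAt F (0 : AmpPt d →L[ℝ] ℂ) (S ∩ U) z :=
    (hasFDerivWithinAt_const (0 : ℂ) z _).congr (fun y hy => h y ⟨hy.2, hy.1⟩) (h z ⟨hzU, hzS⟩)
  rw [dirDeriv, hu.eq h1 h2]
  rfl

lemma wordDeriv_eq_zero_of_convex (hF : ContDiff ℝ ∞ F) {U S : Set (AmpPt d)} (hU : IsOpen U)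
    (hS : Convex ℝ S) (hS' : (interior S).Nonempty) (h : ∀ z ∈ U ∩ S, F z = 0)
    (w : List (Dir d)) : ∀ z ∈ U ∩ S, wordDeriv w F z = 0 := by
  induction w generalizing F with
  | nil => exact h
  | cons i w ih => exact ih (hF.dirDeriv _) (dirDeriv_eq_zero_of_convex hF hU hS hS' h)

end Deriv

/-! ### Families of smooth functions -/

section Family

variable {d : ℕ} {ι : Type*}

/-- The algebra of families of smooth functions. -/
def smoothFam (d : ℕ) (ι : Type*) : Subalgebra ℂ (ι → AmpPt d → ℂ) where
  carrier := {F | ∀ k, ContDiff ℝ ∞ (F k)}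
  mul_mem' hF hG k := (hF k).mul (hG k)
  add_mem' hF hG k := (hF k).add (hG k)
  algebraMap_mem' _ _ := contDiff_const

/-- The derivations of the algebra of families of smooth functions. -/
noncomputable def famD (i : Dir d) : Derivation ℂ (smoothFam d ι) (smoothFam d ι) :=
  Derivation.mk'
    { toFun := fun F => ⟨fun k => dirDeriv i.vec (F.1 k), fun k => (F.2 k).dirDeriv _⟩
      map_add' := fun F G => by
        ext k z
        have hF := (F.2 k).differentiable (by simp) z
        have hG := (G.2 k).differentiable (by simp) z
        exact congrArg (fun L : AmpPt d →L[ℝ] ℂ => L i.vec) (fderiv_add hF hG)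
      map_smul' := fun a F => by
        ext k z
        have hF := (F.2 k).differentiable (by simp) z
        exact congrArg (fun L : AmpPt d →L[ℝ] ℂ => L i.vec) (fderiv_const_smul hF a) }
    fun F G => by
      ext k z
      have hF := (F.2 k).differentiable (by simp) z
      have hG := (G.2 k).differentiable (by simp) z
      exact congrArg (fun L : AmpPt d →L[ℝ] ℂ => L i.vec) (fderiv_mul hF hG)

lemma famD_apply (i : Dir d) (F : smoothFam d ι) (k : ι) :
    (famD i F).1 k = dirDeriv i.vec (F.1 k) := rfl

variable {κ : Type*} [NeZero d]

/-- The frame of families of smooth functions at a family of points. -/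
noncomputable def famFrame (q : κ → ι) (z : κ → AmpPt d) (σ : κ → ℝ) (hσ : ∀ k, 0 < σ k)
    (hσ' : ∃ S, ∀ k, σ k ≤ S) : JetFrame (Dir d) κ (smoothFam d ι) where
  D := famD
  D_comm i j F := by
    ext k : 2
    exact dirDeriv_comm (F.2 k) _ _
  ev :=
    { toFun := fun F k => F.1 (q k) (z k)
      map_one' := rfl
      map_mul' := fun _ _ => rfl
      map_zero' := rfl
      map_add' := fun _ _ => rfl
      commutes' := fun _ => rfl }
  σ := σ
  σ_pos := hσ
  σ_bdd := hσ'
  wt := Dir.wt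

variable {q : κ → ι} {z : κ → AmpPt d} {σ : κ → ℝ} {hσ : ∀ k, 0 < σ k}
  {hσ' : ∃ S, ∀ k, σ k ≤ S}

lemma famFrame_ev (F : smoothFam d ι) (k : κ) :
    (famFrame q z σ hσ hσ').ev F k = F.1 (q k) (z k) := rfl

lemma famFrame_word (w : List (Dir d)) (F : smoothFam d ι) (k : ι) :
    ((famFrame q z σ hσ hσ').word w F).1 k = wordDeriv w (F.1 k) := by
  induction w generalizing F with
  | nil => rfl
  | cons i w ih => exact ih _

lemma famFrame_ev_word (w : List (Dir d)) (F : smoothFam d ι) (k : κ) :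
    (famFrame q z σ hσ hσ').ev ((famFrame q z σ hσ hσ').word w F) k
      = wordDeriv w (F.1 (q k)) (z k) := by
  rw [famFrame_ev, famFrame_word]

/-- A fixed smooth function, as a constant family. -/
def constFam (ι : Type*) (F : AmpPt d → ℂ) (hF : ContDiff ℝ ∞ F) : smoothFam d ι :=
  ⟨fun _ => F, fun _ => hF⟩

lemma flat_constFam {F : AmpPt d → ℂ} (hF : ContDiff ℝ ∞ F) {K : Set (AmpPt d)} (hK : IsCompact K)
    (hz : ∀ k, z k ∈ K) : (famFrame q z σ hσ hσ').Flat (constFam ι F hF) := fun w => by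
  obtain ⟨C, hC⟩ := hK.exists_bound_of_continuousOn (hF.wordDeriv w).continuous.continuousOn
  refine isBigO_top.2 ⟨C, fun k => ?_⟩
  rw [famFrame_ev_word, norm_one, mul_one]
  exact hC _ (hz k)

end Family

/-! ### Families of phases with their rays, and the order of the reflected phase -/

/-- Globally smooth coefficients and a globally smooth incident phase, with a compact set of points
to be considered. -/
structure Background (d : ℕ) [NeZero d] where
  /-- the metric -/
  g : Fin d → Fin d → Sp d → ℝ
  /-- the magnetic potential -/
  W : Fin d → Sp d → ℝ
  /-- the scalar potential -/
  V : Sp d → ℝ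
  smooth_g : ∀ j k, ContDiff ℝ ∞ (g j k)
  smooth_W : ∀ j, ContDiff ℝ ∞ (W j)
  smooth_V : ContDiff ℝ ∞ V
  symm : ∀ j k, g j k = g k j
  normal_g : ∀ k x, g 0 k x = if k = 0 then 1 else 0
  normal_W : ∀ x, W 0 x = 0
  /-- the incident phase -/
  φ₀ : AmpPt d → ℂ
  smooth_φ₀ : ContDiff ℝ ∞ φ₀
  /-- the set of points -/
  K : Set (AmpPt d)
  compact_K : IsCompact K
  /-- a bound of the scales -/
  S : ℝ
  diagonal : ∀ w : List (Dir d), w ≠ [] → (∀ i ∈ w, i.wt = 0) → ∃ C, ∀ z ∈ K,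
    ‖wordDeriv w (dirDeriv (Dir.x 0).vec φ₀) z‖ ≤ C * ‖z.1 - z.2.2.1‖

lemma smooth_coeff {d : ℕ} {f : Sp d → ℝ} (hf : ContDiff ℝ ∞ f) :
    ContDiff ℝ ∞ fun z : AmpPt d => (f z.1 : ℂ) :=
  Complex.ofRealCLM.contDiff.comp (hf.comp contDiff_fst)

lemma smoothFam_coe_sum {d : ℕ} {ι α : Type*} (i : ι) (t : Finset α) (F : α → smoothFam d ι)
    (z : AmpPt d) : (∑ a ∈ t, F a).1 i z = ∑ a ∈ t, (F a).1 i z := by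
  induction t using Finset.cons_induction with
  | empty => rfl
  | cons a t ha ih => rw [Finset.sum_cons, Finset.sum_cons, ← ih]; rfl

lemma dirDeriv_eq_zero_of_const {d : ℕ} {F : AmpPt d → ℂ} (hF : ContDiff ℝ ∞ F) {v : AmpPt d}
    (h : ∀ z (r : ℝ), F (z + r • v) = F z) : dirDeriv v F = 0 := by
  funext z
  have h1 : HasDerivAt (fun r : ℝ => F (z + r • v)) (fderiv ℝ F z v) 0 := by
    have h2 : HasDerivAt (fun r : ℝ => z + r • v) v 0 := by
      simpa using ((hasDerivAt_id (0 : ℝ)).smul_const v).const_add z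
    have h3 : HasFDerivAt F (fderiv ℝ F z) (z + (0 : ℝ) • v) := by
      simpa using (hF.differentiable (by simp) z).hasFDerivAt
    exact h3.comp_hasDerivAt 0 h2
  simp only [h] at h1
  exact h1.unique (hasDerivAt_const _ _)

namespace Background

variable {d : ℕ} [NeZero d] (𝔹 : Background d) (φ B : AmpPt d → ℂ)

/-- `∂_{x_k} φ - V_k`. -/
noncomputable def pFn (k : Fin d) (z : AmpPt d) : ℂ := dirDeriv (Dir.x k).vec φ z - 𝔹.W k z.1

/-- Half of the group velocity. -/
noncomputable def velFn (j : Fin d) (z : AmpPt d) : ℂ := ∑ k, (𝔹.g j k z.1 : ℂ) * 𝔹.pFn φ k z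

/-- The symbol at the differential of `φ`. -/
noncomputable def symFn (z : AmpPt d) : ℂ :=
  (∑ j, ∑ k, (𝔹.g j k z.1 : ℂ) * 𝔹.pFn φ j z * 𝔹.pFn φ k z) + 𝔹.V z.1

/-- The symbol at `(y, θ)`. -/
noncomputable def energy (z : AmpPt d) : ℝ :=
  (∑ j, ∑ k, 𝔹.g j k z.2.2.1 * (z.2.2.2 j - 𝔹.W j z.2.2.1) * (z.2.2.2 k - 𝔹.W k z.2.2.1))
    + 𝔹.V z.2.2.1

/-- The divergence of half of the group velocity. -/
noncomputable def divFn (z : AmpPt d) : ℂ := ∑ j, dirDeriv (Dir.x j).vec (𝔹.velFn φ j) z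

/-- The source of the transport equation for an amplitude which follows `B`. -/
noncomputable def sourceFn (z : AmpPt d) : ℂ :=
  -Complex.I * ∑ j, dirDeriv (Dir.x j).vec
    (fun z' => ∑ k, (𝔹.g j k z'.1 : ℂ) * dirDeriv (Dir.x k).vec B z') z

/-- The transport operator. -/
noncomputable def transportFn (z : AmpPt d) : ℂ :=
  dirDeriv Dir.t.vec B z - ∑ j, 2 * 𝔹.velFn φ j z * dirDeriv (Dir.x j).vec B z

lemma smooth_energy : ContDiff ℝ ∞ fun z : AmpPt d => (𝔹.energy z : ℂ) := by
  have hy : ∀ {f : Sp d → ℝ}, ContDiff ℝ ∞ f → ContDiff ℝ ∞ fun z : AmpPt d => f z.2.2.1 :=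
    fun hf => hf.comp (by fun_prop)
  have hθ : ∀ j, ContDiff ℝ ∞ fun z : AmpPt d => z.2.2.2 j := fun j =>
    (contDiff_euclidean.1 (contDiff_snd.comp (contDiff_snd.comp contDiff_snd)) j)
  refine Complex.ofRealCLM.contDiff.comp (ContDiff.add (ContDiff.sum fun j _ =>
    ContDiff.sum fun k _ => ?_) (hy 𝔹.smooth_V))
  exact ((hy (𝔹.smooth_g j k)).mul ((hθ j).sub (hy (𝔹.smooth_W j)))).mul
    ((hθ k).sub (hy (𝔹.smooth_W k)))

/-- The coefficients as constant families. -/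
noncomputable def coeffs (ι : Type*) : OpCoeffs d (smoothFam d ι) where
  g j k := constFam ι _ (smooth_coeff (𝔹.smooth_g j k))
  W j := constFam ι _ (smooth_coeff (𝔹.smooth_W j))
  V := constFam ι _ (smooth_coeff 𝔹.smooth_V)
  symm j k := by rw [Subtype.ext_iff]; simp only [𝔹.symm j k]
  normal_g k := by
    rw [Subtype.ext_iff]; ext i z
    by_cases hk : k = 0 <;> simp [constFam, 𝔹.normal_g, hk]
  normal_W := by
    rw [Subtype.ext_iff]; ext i z
    simp [constFam, 𝔹.normal_W]

section Coe

variable {𝔹} {ι : Type*} (Φ b : smoothFam d ι) (i : ι)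

lemma coe_vel (j : Fin d) : (∑ k, (𝔹.coeffs ι).g j k * (𝔹.coeffs ι).p famD Φ k).1 i
    = 𝔹.velFn (Φ.1 i) j := by
  funext z; exact smoothFam_coe_sum i _ _ z

lemma coe_sym : ((𝔹.coeffs ι).sym famD Φ).1 i = 𝔹.symFn (Φ.1 i) := by
  funext z
  refine congrArg (· + _) ((smoothFam_coe_sum i _ _ z).trans ?_)
  exact Finset.sum_congr rfl fun j _ => smoothFam_coe_sum i _ _ z

lemma coe_divg : ((𝔹.coeffs ι).divg famD Φ).1 i = 𝔹.divFn (Φ.1 i) := by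
  funext z
  refine (smoothFam_coe_sum i _ _ z).trans (Finset.sum_congr rfl fun j _ => ?_)
  rw [famD_apply, coe_vel]

lemma coe_source : ((𝔹.coeffs ι).source famD b).1 i = 𝔹.sourceFn (b.1 i) := by
  funext z
  refine congrArg (-Complex.I * ·) ((smoothFam_coe_sum i _ _ z).trans (Finset.sum_congr rfl fun j _ => ?_))
  rw [famD_apply]
  congr 1
  funext z'
  exact smoothFam_coe_sum i _ _ z'

lemma coe_field {κ : Type*} {q : κ → ι} {z : κ → AmpPt d} {σ : κ → ℝ} {hσ : ∀ k, 0 < σ k}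
    {hσ' : ∃ S, ∀ k, σ k ≤ S} :
    ((famFrame q z σ hσ hσ').field ((𝔹.coeffs ι).transport famD Φ) b).1 i
      = 𝔹.transportFn (Φ.1 i) (b.1 i) := by
  have := (𝔹.coeffs ι).field_transport (D := famD) (φ := Φ) (famFrame q z σ hσ hσ') b
  funext z'
  refine (congrArg (fun F : smoothFam d ι => F.1 i z') this).trans ?_
  refine congrArg (_ - ·) ((smoothFam_coe_sum i _ _ z').trans (Finset.sum_congr rfl fun j _ => ?_))
  have h2 := congrFun (coe_vel (𝔹 := 𝔹) Φ i j) z'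
  exact congrArg (fun c => 2 * c * _) h2

end Coe

/-- A reflected phase, smoothly extended, with a ray of length at most `2 * T`, on which the eikonal
equation holds to infinite order. -/
structure PhaseDatum (C : ℝ) where
  /-- the phase -/
  φ : AmpPt d → ℂ
  smooth_φ : ContDiff ℝ ∞ φ
  /-- the length -/
  ℓ : ℝ
  /-- the ray -/
  z : ℝ → AmpPt d
  /-- the normal derivative of the phase at the initial point -/
  σ : ℝ
  /-- the orientation -/
  sgn : ℝ
  /-- the diameter -/
  T : ℝ
  ℓ_nonneg : 0 ≤ ℓ
  ℓ_le : ℓ ≤ 2 * T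
  σ_pos : 0 < σ
  σ_le : σ ≤ 𝔹.S
  T_le : C * T ≤ σ
  abs_sgn : |sgn| = 1
  mem_K : ∀ r ∈ Set.Icc 0 ℓ, z r ∈ 𝔹.K
  deriv : ∀ F : AmpPt d → ℂ, ContDiff ℝ ∞ F → ∀ r ∈ Set.Icc 0 ℓ,
    HasDerivWithinAt (fun r => F (z r)) (sgn * 𝔹.transportFn φ F (z r)) (Set.Icc 0 ℓ) r
  eikonal : ∀ r ∈ Set.Icc 0 ℓ, ∀ w, wordDeriv w (fun z => 𝔹.symFn φ z - 𝔹.energy z) (z r) = 0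
  stationary : ∀ r ∈ Set.Icc 0 ℓ, ∀ w, wordDeriv w (dirDeriv Dir.t.vec φ) (z r) = 0
  boundary : ∀ w, Dir.x 0 ∉ w → wordDeriv w (fun z => φ z - 𝔹.φ₀ z) (z 0) = 0
  reflection : ∀ w, Dir.x 0 ∉ w → wordDeriv w
    (fun z => dirDeriv (Dir.x 0).vec φ z + dirDeriv (Dir.x 0).vec 𝔹.φ₀ z) (z 0) = 0
  σ_eq : σ = ‖dirDeriv (Dir.x 0).vec φ (z 0)‖
  dist_le : ‖(z 0).1 - (z 0).2.2.1‖ ≤ T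

/-- Reflected amplitudes, smoothly extended, for which the transport equations on the ray and the
boundary conditions hold to infinite order. -/
structure AmpDatum (C : ℝ) (K : ℕ → List (Dir d) → ℝ) extends 𝔹.PhaseDatum C where
  /-- the reflected amplitudes -/
  B : ℕ → AmpPt d → ℂ
  /-- the incident amplitudes -/
  B₀ : ℕ → AmpPt d → ℂ
  smooth_B : ∀ n, ContDiff ℝ ∞ (B n)
  smooth_B₀ : ∀ n, ContDiff ℝ ∞ (B₀ n)
  bound : ∀ n w, ‖wordDeriv w (B₀ n) (z 0)‖ ≤ K n w
  transport : ∀ n, ∀ r ∈ Set.Icc 0 ℓ, ∀ w, wordDeriv w (fun z => 𝔹.transportFn φ (B n) z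
    - (𝔹.divFn φ z * B n z + 𝔹.sourceFn (prevAmp B n) z)) (z r) = 0
  matching : (∀ n w, Dir.x 0 ∉ w → wordDeriv w (fun z => B n z + B₀ n z) (z 0) = 0) ∨
    ∀ n w, Dir.x 0 ∉ w → wordDeriv w (fun z =>
      (dirDeriv (Dir.x 0).vec φ z * B n z
        - Complex.I * dirDeriv (Dir.x 0).vec (prevAmp B n) z)
      - (dirDeriv (Dir.x 0).vec φ z * B₀ n z
        + Complex.I * dirDeriv (Dir.x 0).vec (prevAmp B₀ n) z)) (z 0) = 0

variable {𝔹} {C : ℝ} (hC : 0 < C) {ι : Type*} (π : ι → 𝔹.PhaseDatum C)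

/-- The phases of a family of data. -/
def phases : smoothFam d ι := ⟨fun i => (π i).φ, fun i => (π i).smooth_φ⟩

/-- The rays of a family of data. -/
noncomputable def rays : RayFrame (Dir d) ι (smoothFam d ι) where
  ℓ i := (π i).ℓ
  ℓ_nonneg i := (π i).ℓ_nonneg
  frame := famFrame (fun k => k.1.1) (fun k => (π k.1.1).z k.1.2) (fun k => (π k.1.1).σ)
    (fun k => (π k.1.1).σ_pos) ⟨𝔹.S, fun k => (π k.1.1).σ_le⟩
  scale i := (π i).σ
  σ_eq _ := rfl
  scale_pos i := (π i).σ_pos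
  L := 2 / C
  ℓ_le i := by
    have h1 := (π i).ℓ_le
    have h2 := (π i).T_le
    rw [div_mul_eq_mul_div, le_div_iff₀ hC]
    nlinarith
  a := (𝔹.coeffs ι).transport famD (phases π)
  sgn i := (π i).sgn
  abs_sgn i := (π i).abs_sgn
  val F i r := F.1 i ((π i).z r)
  ev_eq _ _ := rfl
  deriv F i r hr := by
    rw [coe_field]
    exact (π i).deriv _ (F.2 i) r hr

/-- The tangential directions. -/
abbrev tang (d : ℕ) [NeZero d] : {i : Dir d // i ≠ Dir.x 0} → Dir d := Subtype.val

variable {hC π}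

lemma van_rays {F : smoothFam d ι}
    (h : ∀ i, ∀ r ∈ Set.Icc 0 (π i).ℓ, ∀ w, wordDeriv w (F.1 i) ((π i).z r) = 0) :
    (rays hC π).frame.Van F := fun w => by
  ext k
  exact (famFrame_ev_word w F k).trans (h _ _ k.2 w)

lemma bd_ev_word (F : smoothFam d ι) (w : List (Dir d)) (i : ι) :
    (rays hC π).bd.ev ((rays hC π).bd.word w F) i = wordDeriv w (F.1 i) ((π i).z 0) := by
  rw [reindex_word]
  exact famFrame_ev_word w F ((rays hC π).start i)

lemma van_tang {F : smoothFam d ι}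
    (h : ∀ i, ∀ w, Dir.x 0 ∉ w → wordDeriv w (F.1 i) ((π i).z 0) = 0) :
    ((rays hC π).bd.comap (tang d)).Van F := fun w => by
  ext i
  rw [comap_word]
  exact (bd_ev_word F _ i).trans (h i _ (notMem_map_val w))

lemma flat_const {F : AmpPt d → ℂ} (hF : ContDiff ℝ ∞ F) :
    (rays hC π).frame.Flat (constFam ι F hF) :=
  flat_constFam hF 𝔹.compact_K fun k => (π k.1.1).mem_K _ k.2

lemma rays_wt : (rays hC π).frame.wt = Dir.wt := rfl

lemma flat_g (j k : Fin d) : (rays hC π).frame.Flat ((𝔹.coeffs ι).g j k) := flat_const _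
lemma flat_W (j : Fin d) : (rays hC π).frame.Flat ((𝔹.coeffs ι).W j) := flat_const _
lemma flat_V : (rays hC π).frame.Flat (𝔹.coeffs ι).V := flat_const _

lemma van_eikonal : (rays hC π).frame.Van ((𝔹.coeffs ι).sym famD (phases π)
    - constFam ι _ 𝔹.smooth_energy) := van_rays fun i r hr w => by
  have : ((𝔹.coeffs ι).sym famD (phases π) - constFam ι _ 𝔹.smooth_energy).1 i
      = fun z => 𝔹.symFn (π i).φ z - 𝔹.energy z :=
    funext fun z => congrArg (· - _) (congrFun (coe_sym (𝔹 := 𝔹) (phases π) i) z)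
  rw [this]
  exact (π i).eikonal r hr w

lemma van_stationary : (rays hC π).frame.Van (famD Dir.t (phases π)) :=
  van_rays fun i r hr w => (π i).stationary r hr w

lemma D_energy (m : Fin d) :
    famD (Dir.x m) (constFam ι _ 𝔹.smooth_energy) = 0 := by
  rw [Subtype.ext_iff]
  funext i
  exact dirDeriv_eq_zero_of_const 𝔹.smooth_energy fun z r => by
    simp [energy, Dir.vec, Dir.x]

lemma normal_isBigO : (rays hC π).bd.σ =O[⊤] (rays hC π).bd.ev (famD (Dir.x 0) (phases π)) :=
  isBigO_top.2 ⟨1, fun i => by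
    rw [one_mul, Real.norm_of_nonneg ((rays hC π).bd.σ_pos i).le]
    exact (π i).σ_eq.le⟩

lemma transport_normal_isBigO : (rays hC π).bd.σ =O[⊤]
    (rays hC π).bd.ev ((𝔹.coeffs ι).transport famD (phases π) (Dir.x 0)) := by
  have : (𝔹.coeffs ι).transport famD (phases π) (Dir.x 0)
      = (-2 : ℂ) • famD (Dir.x 0) (phases π) := by
    rw [neg_smul, ← OpCoeffs.vel_zero (a := 𝔹.coeffs ι)]; rfl
  rw [this, map_smul]
  exact (isBigO_const_smul_right (c := (-2 : ℂ)) (by norm_num)).2 normal_isBigO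

/-- Tangential derivatives of the gradient of the reflected phase at the boundary. -/
lemma phase_tangential (m : Fin d) (w : List (Dir d)) (hw : Dir.x 0 ∉ w) :
    (rays hC π).bd.ev ((rays hC π).bd.word w (famD (Dir.x m) (phases π))) =O[⊤]
      fun k => (rays hC π).bd.σ k
        ^ (OpCoeffs.phaseExp m - ((rays hC π).bd.wordWt w : ℤ)) := by
  have hz : ∀ i, (π i).z 0 ∈ 𝔹.K := fun i => (π i).mem_K 0 ⟨le_rfl, (π i).ℓ_nonneg⟩
  have hflat := ((flat_const (hC := hC) (π := π) 𝔹.smooth_φ₀).reindex (rays hC π).start).D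
  by_cases hm : m = 0
  · subst hm
    have hv : ((rays hC π).bd.comap (tang d)).Van (famD (Dir.x 0) (phases π)
        - -famD (Dir.x 0) (constFam ι _ 𝔹.smooth_φ₀)) := by
      rw [sub_neg_eq_add]
      exact van_tang fun i w hw => (π i).reflection w hw
    have hev : (rays hC π).bd.ev ((rays hC π).bd.word w (famD (Dir.x 0) (phases π)))
        = -(rays hC π).bd.ev ((rays hC π).bd.word w
          (famD (Dir.x 0) (constFam ι _ 𝔹.smooth_φ₀))) := by
      obtain ⟨v, rfl⟩ := exists_map_val hw
      have := hv.ev_word v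
      rw [word_neg, map_neg, comap_word, comap_word] at this
      exact this
    rw [OpCoeffs.phaseExp, if_pos rfl]
    -- If the weight is at least 1, the required exponent is at most 0 and boundedness suffices.
    -- Words of weight 0 consist of θ'-derivatives and must be O(σ).
    rcases Nat.eq_zero_or_pos ((rays hC π).bd.wordWt w) with h0 | h0
    · rw [h0]
      simp only [Nat.cast_zero, sub_zero, zpow_one]
      by_cases hnil : w = []
      · subst hnil
        refine isBigO_top.2 ⟨1, fun i => ?_⟩
        rw [one_mul, Real.norm_of_nonneg ((rays hC π).bd.σ_pos i).le]
        exact (π i).σ_eq.ge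
      · have hw0 : ∀ i ∈ w, i.wt = 0 := fun i hi => by
          have := List.sum_eq_zero_iff.1 h0 (Dir.wt i) (List.mem_map_of_mem hi)
          exact this
        obtain ⟨c, hc⟩ := 𝔹.diagonal w hnil hw0
        rw [hev]
        refine isBigO_top.2 ⟨|c| / C, fun i => ?_⟩
        rw [Pi.neg_apply, norm_neg, bd_ev_word, Real.norm_of_nonneg ((rays hC π).bd.σ_pos i).le]
        -- The distance to the diagonal is at most `T`, which is at most `σ / C`.
        have h1 : C * (π i).T ≤ (rays hC π).bd.σ i := (π i).T_le
        calc _ ≤ c * ‖((π i).z 0).1 - ((π i).z 0).2.2.1‖ := hc _ (hz i)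
          _ ≤ |c| * (π i).T := by
            gcongr
            · exact le_abs_self c
            · exact (π i).dist_le
          _ ≤ |c| / C * (rays hC π).bd.σ i := by
            rw [div_mul_eq_mul_div, le_div_iff₀ hC, mul_assoc]
            gcongr
            linarith
    · rw [hev]
      refine ((hflat (Dir.x 0) w).neg_left).trans ?_
      have := zpow_isBigO (𝔽 := (rays hC π).bd) (s := 0)
        (r := 1 - ((rays hC π).bd.wordWt w : ℤ)) (by omega)
      simpa using this
  · have hv : ((rays hC π).bd.comap (tang d)).Van (phases π - constFam ι _ 𝔹.smooth_φ₀) :=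
      van_tang fun i w hw => (π i).boundary w hw
    have hev : (rays hC π).bd.ev ((rays hC π).bd.word w (famD (Dir.x m) (phases π)))
        = (rays hC π).bd.ev ((rays hC π).bd.word w
          (famD (Dir.x m) (constFam ι _ 𝔹.smooth_φ₀))) := by
      -- For `m ≠ 0` the direction `x_m` is tangential as well, so the equality of phases on the
      -- boundary may be differentiated in it.
      have hw' : Dir.x 0 ∉ Dir.x m :: w := by
        rw [List.mem_cons, not_or]
        exact ⟨fun h => hm (Sum.inl_injective h).symm, hw⟩
      obtain ⟨v, hv'⟩ := exists_map_val hw'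
      have := hv.ev_word v
      rw [comap_word, comap_word, hv'] at this
      exact this
    rw [hev, OpCoeffs.phaseExp, if_neg hm]
    refine (hflat (Dir.x m) w).trans ?_
    have := zpow_isBigO (𝔽 := (rays hC π).bd) (s := 0)
      (r := 0 - ((rays hC π).bd.wordWt w : ℤ)) (by omega)
    simpa using this

lemma allSym_bd (m : Fin d) :
    (rays hC π).bd.AllSym (OpCoeffs.phaseExp m) (famD (Dir.x m) (phases π)) := by
  have hg : ∀ j k, (rays hC π).bd.Flat ((𝔹.coeffs ι).g j k) := fun j k => (flat_g j k).reindex _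
  have hW : ∀ j, (rays hC π).bd.Flat ((𝔹.coeffs ι).W j) := fun j => (flat_W j).reindex _
  have hV : (rays hC π).bd.Flat (𝔹.coeffs ι).V := flat_V.reindex _
  have hE := (van_eikonal (hC := hC) (π := π)).reindex (rays hC π).start
  have hS := (van_stationary (hC := hC) (π := π)).reindex (rays hC π).start
  have hn := transport_normal_isBigO (hC := hC) (π := π)
  have hT := phase_tangential (hC := hC) (π := π)
  have hwt : (rays hC π).bd.wt = Dir.wt := rfl
  have hD : (rays hC π).bd.D = famD := rfl
  have hQ := D_energy (𝔹 := 𝔹) (ι := ι)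
  change (rays hC π).bd.Van _ at hE hS
  generalize (rays hC π).bd = 𝔽 at *
  rw [← hD] at hE hS hn hT hQ ⊢
  exact OpCoeffs.allSym_phase_boundary hwt hg hW hV hQ hE hS hn hT m

variable (𝔹) in
/-- The constant `C₀`. -/
theorem exists_constant (hC : 0 < C) : ∃ C₀, C ≤ C₀ ∧ ∃ A, ∀ D : 𝔹.PhaseDatum C,
    C₀ * D.T ≤ D.σ → ∀ m, ∀ w : List (Dir d), w.length ≤ 1 → ∀ r ∈ Set.Icc 0 D.ℓ,
      ‖wordDeriv w (dirDeriv (Dir.x m).vec D.φ) (D.z r)‖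
        ≤ A * D.σ ^ (OpCoeffs.phaseExp m - ((w.map Dir.wt).sum : ℤ)) := by
  -- The family of all data, indexed by itself: the resulting constants depend on the background and
  -- `C` only.
  obtain ⟨c, hc, A, hA⟩ := OpCoeffs.exists_phase_bound (ℜ := rays hC (id : 𝔹.PhaseDatum C → _))
    (a := 𝔹.coeffs _) (φ := phases _) rays_wt rfl flat_g flat_W flat_V
    (Q := constFam _ _ 𝔹.smooth_energy) D_energy van_eikonal van_stationary allSym_bd
  -- The rays have length at most `2 * T`, hence the factor 2.
  refine ⟨max C (2 * c), le_max_left _ _, A, fun D hD m w hw r hr => ?_⟩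
  have hT : 0 ≤ D.T := by linarith [D.ℓ_nonneg, D.ℓ_le]
  have h1 : c * D.ℓ ≤ D.σ := by
    calc c * D.ℓ ≤ c * (2 * D.T) := by gcongr; exact D.ℓ_le
      _ = 2 * c * D.T := by ring
      _ ≤ max C (2 * c) * D.T := by gcongr; exact le_max_right _ _
      _ ≤ D.σ := hD
  have := hA m w hw ⟨(D, r), hr⟩ h1
  exact (congrArg norm (famFrame_ev_word w _ _)).symm.le.trans this

/-- The phase along short rays. -/
lemma allSym_rays {A : ℝ} (hA : ∀ i, ∀ m, ∀ w : List (Dir d), w.length ≤ 1 →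
      ∀ r ∈ Set.Icc 0 (π i).ℓ, ‖wordDeriv w (dirDeriv (Dir.x m).vec (π i).φ) ((π i).z r)‖
        ≤ A * (π i).σ ^ (OpCoeffs.phaseExp m - ((w.map Dir.wt).sum : ℤ))) (m : Fin d) :
    (rays hC π).frame.AllSym (OpCoeffs.phaseExp m) (famD (Dir.x m) (phases π)) := by
  refine OpCoeffs.allSym_phase (ℜ := rays hC π) (a := 𝔹.coeffs ι) (φ := phases π) rays_wt rfl flat_g flat_W flat_V
    (Q := constFam ι _ 𝔹.smooth_energy) D_energy van_eikonal van_stationary allSym_bd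
    (fun m w hw => ?_) m
  rw [sum_unitCost] at hw
  simp only [Pi.one_apply, ite_self, one_mul]
  refine isBigO_top.2 ⟨A, fun k => ?_⟩
  rw [Real.norm_of_nonneg (zpow_nonneg ((rays hC π).frame.σ_pos k).le _)]
  exact ((congrArg norm (famFrame_ev_word w _ k)).le).trans (hA k.1.1 m w hw k.1.2 k.2)

end Background

/-! ### The order of the reflected amplitudes -/

namespace JetFrame

variable {I J κ ℛ : Type*} [CommRing ℛ] [Algebra ℂ ℛ] {𝔽 : JetFrame I κ ℛ}

lemma AllSym.comap {s : ℤ} {F : ℛ} (h : 𝔽.AllSym s F) (f : J → I) : (𝔽.comap f).AllSym s F :=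
  fun w => by
    rw [comap_word, comap_wordWt]
    exact h _

lemma AllSym.field [Fintype I] {a : I → ℛ} (ha : ∀ i, 𝔽.AllSym (𝔽.wt i - 1) (a i)) {s : ℤ} {F : ℛ}
    (h : 𝔽.AllSym s F) : 𝔽.AllSym (s - 1) (𝔽.field a F) :=
  AllSym.sum fun i _ => ((ha i).mul (h.D i)).mono_exp (by omega)

lemma AllSym.word {s : ℤ} {F : ℛ} (h : 𝔽.AllSym s F) (w : List I) :
    𝔽.AllSym (s - 𝔽.wordWt w) (𝔽.word w F) := fun v => by
  rw [← word_append]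
  refine (h (w ++ v)).congr_right fun k => ?_
  congr 1
  simp [wordWt]
  ring

end JetFrame

namespace Background

variable {d : ℕ} [NeZero d] {𝔹 : Background d} {C : ℝ} (hC : 0 < C) {K : ℕ → List (Dir d) → ℝ}
  {ι : Type*} (π : ι → 𝔹.AmpDatum C K)

/-- The rays of a family of data with amplitudes. -/
noncomputable abbrev ampRays : RayFrame (Dir d) ι (smoothFam d ι) :=
  rays hC fun i => (π i).toPhaseDatum

/-- The phases of a family of data with amplitudes. -/
abbrev ampPhases : smoothFam d ι := phases fun i => (π i).toPhaseDatum

/-- The reflected amplitudes of a family of data. -/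
def refl (n : ℕ) : smoothFam d ι := ⟨fun i => (π i).B n, fun i => (π i).smooth_B n⟩

/-- The incident amplitudes of a family of data. -/
def inc (n : ℕ) : smoothFam d ι := ⟨fun i => (π i).B₀ n, fun i => (π i).smooth_B₀ n⟩

/-- The amplitude which precedes the given one. -/
def prev (b : ℕ → smoothFam d ι) : ℕ → smoothFam d ι
  | 0 => 0
  | n + 1 => b n

variable {hC π}

lemma flat_inc (n : ℕ) : (ampRays hC π).bd.Flat (inc π n) := fun w =>
  isBigO_top.2 ⟨K n w, fun i => by
    rw [bd_ev_word, norm_one, mul_one]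
    exact (π i).bound n w⟩

lemma prev_refl_coe (n : ℕ) (i : ι) : (prev (refl π) n).1 i = prevAmp (π i).B n := by
  cases n <;> rfl

lemma prev_inc_coe (n : ℕ) (i : ι) : (prev (inc π) n).1 i = prevAmp (π i).B₀ n := by
  cases n <;> rfl

lemma van_transport (n : ℕ) : (ampRays hC π).frame.Van
    ((ampRays hC π).frame.field (ampRays hC π).a (refl π n)
      - ((𝔹.coeffs ι).divg famD (ampPhases π) * refl π n
        + (𝔹.coeffs ι).source famD (prev (refl π) n))) := van_rays fun i r hr w => by
  refine Eq.trans ?_ ((π i).transport n r hr w)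
  refine congrArg (fun F => wordDeriv w F _) ?_
  rw [← prev_refl_coe]
  have h1 : ((ampRays hC π).frame.field (ampRays hC π).a (refl π n)).1 i
    = 𝔹.transportFn (π i).φ ((π i).B n) := coe_field _ _ i
  have h2 := coe_divg (𝔹 := 𝔹) (ampPhases π) i
  have h3 := coe_source (𝔹 := 𝔹) (prev (refl π) n) i
  funext z
  have h1 := congrFun h1 z
  have h2 := congrFun h2 z
  have h3 := congrFun h3 z
  exact congrArg₂ (· - ·) h1 (congrArg₂ (· + ·) (congrArg (· * _) h2) h3)

lemma van_dirichlet (h : ∀ i, ∀ n w, Dir.x 0 ∉ w →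
      wordDeriv w (fun z => (π i).B n z + (π i).B₀ n z) ((π i).z 0) = 0) (n : ℕ) :
    ((ampRays hC π).bd.comap (tang d)).Van (refl π n - -inc π n) := by
  rw [sub_neg_eq_add]
  exact van_tang fun i => h i n

lemma van_neumann (h : ∀ i, ∀ n w, Dir.x 0 ∉ w → wordDeriv w (fun z =>
      (dirDeriv (Dir.x 0).vec (π i).φ z * (π i).B n z
        - Complex.I * dirDeriv (Dir.x 0).vec (prevAmp (π i).B n) z)
      - (dirDeriv (Dir.x 0).vec (π i).φ z * (π i).B₀ n z
        + Complex.I * dirDeriv (Dir.x 0).vec (prevAmp (π i).B₀ n) z)) ((π i).z 0) = 0) (n : ℕ) :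
    ((ampRays hC π).bd.comap (tang d)).Van (famD (Dir.x 0) (ampPhases π) * refl π n
        - Complex.I • famD (Dir.x 0) (prev (refl π) n)
      - (famD (Dir.x 0) (ampPhases π) * inc π n
        + Complex.I • famD (Dir.x 0) (prev (inc π) n))) := van_tang fun i w hw => by
  refine Eq.trans ?_ (h i n w hw)
  rw [← prev_refl_coe, ← prev_inc_coe]
  rfl

/-- All data satisfy the same boundary condition. -/
def SameCondition (π : ι → 𝔹.AmpDatum C K) : Prop :=
  (∀ i, ∀ n w, Dir.x 0 ∉ w →
      wordDeriv w (fun z => (π i).B n z + (π i).B₀ n z) ((π i).z 0) = 0) ∨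
  ∀ i, ∀ n w, Dir.x 0 ∉ w → wordDeriv w (fun z =>
      (dirDeriv (Dir.x 0).vec (π i).φ z * (π i).B n z
        - Complex.I * dirDeriv (Dir.x 0).vec (prevAmp (π i).B n) z)
      - (dirDeriv (Dir.x 0).vec (π i).φ z * (π i).B₀ n z
        + Complex.I * dirDeriv (Dir.x 0).vec (prevAmp (π i).B₀ n) z)) ((π i).z 0) = 0

lemma ev_word_eq_of_tang {F G : smoothFam d ι}
    (h : ((ampRays hC π).bd.comap (tang d)).Van (F - G)) {w : List (Dir d)} (hw : Dir.x 0 ∉ w) :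
    (ampRays hC π).bd.ev ((ampRays hC π).bd.word w F)
      = (ampRays hC π).bd.ev ((ampRays hC π).bd.word w G) := by
  obtain ⟨v, rfl⟩ := exists_map_val hw
  have := h.ev_word v
  rw [comap_word, comap_word] at this
  exact this

/-- The first amplitude at the boundary. -/
lemma refl_zero_tangential (hm : SameCondition π) {w : List (Dir d)} (hw : Dir.x 0 ∉ w) :
    (ampRays hC π).bd.ev ((ampRays hC π).bd.word w (refl π 0)) =O[⊤] fun _ => (1 : ℝ) := by
  rcases hm with hm | hm
  · rw [ev_word_eq_of_tang (van_dirichlet hm 0) hw, word_neg, map_neg]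
    exact (flat_inc 0 w).neg_left
  · have h1 := van_neumann (hC := hC) hm 0
    simp only [prev, map_zero, smul_zero, sub_zero, add_zero, ← mul_sub] at h1
    -- For `n = 0` the Neumann condition reads `φ_{x₁} (B_0 - B⁰_0) = 0`, and `φ_{x₁}` does not
    -- vanish at the initial points, where its modulus is `σ`.
    have h2 := h1.of_mul fun i => by
      have h3 : (π i).σ = ‖(ampRays hC π).bd.ev (famD (Dir.x 0) (ampPhases π)) i‖ := (π i).σ_eq
      exact norm_pos_iff.1 (h3 ▸ (π i).σ_pos)
    rw [ev_word_eq_of_tang h2 hw]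
    exact flat_inc 0 w

/-- The later amplitudes at the boundary. -/
lemma refl_succ_tangential (hm : SameCondition π)
    (hu : ∀ m, (ampRays hC π).frame.AllSym (OpCoeffs.phaseExp m) (famD (Dir.x m) (ampPhases π)))
    {n : ℕ} (ih : (ampRays hC π).frame.AllSym (-3 * n) (refl π n)) {w : List (Dir d)}
    (hw : Dir.x 0 ∉ w) :
    (ampRays hC π).bd.ev ((ampRays hC π).bd.word w (refl π (n + 1))) =O[⊤]
      fun k => (ampRays hC π).bd.σ k
        ^ (-3 * ((n + 1 : ℕ) : ℤ) - ((ampRays hC π).bd.wordWt w : ℤ)) := by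
  have hinc := fun m => (flat_inc (hC := hC) (π := π) m).allSym
  rcases hm with hm | hm
  · rw [ev_word_eq_of_tang (van_dirichlet hm (n + 1)) hw, word_neg, map_neg]
    exact ((hinc (n + 1)).mono_exp (by push_cast; omega) w).neg_left
  · have h1 := van_neumann (hC := hC) hm (n + 1)
    -- The boundary condition may be differentiated only tangentially, so the division takes place
    -- in the frame of tangential directions.
    refine ev_word_of_comap (𝔽 := (ampRays hC π).bd) (fun M => ?_) w hw
    have hu0 : (ampRays hC π).bd.AllSym 1 (famD (Dir.x 0) (ampPhases π)) := (hu 0).reindex _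
    have hB : (ampRays hC π).bd.AllSym (-3 * n) (refl π n) := ih.reindex _
    have hwt : ((ampRays hC π).bd.wt (Dir.x 0) : ℤ) = 2 := by
      change ((Dir.wt (Dir.x 0 : Dir d) : ℕ) : ℤ) = 2
      simp [Dir.wt]
    have hB' : (ampRays hC π).bd.AllSym (-3 * n - 2) (famD (Dir.x 0) (refl π n)) :=
      (hB.D (Dir.x 0)).mono_exp (by rw [hwt])
    have hI' : (ampRays hC π).bd.AllSym 0 (famD (Dir.x 0) (inc π n)) :=
      ((flat_inc n).D (Dir.x 0)).allSym
    have hrhs : (ampRays hC π).bd.AllSym (-3 * n - 2)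
        ((famD (Dir.x 0) (ampPhases π) * inc π (n + 1) + Complex.I • famD (Dir.x 0) (inc π n))
          + Complex.I • famD (Dir.x 0) (refl π n)) :=
      (((hu0.mul (hinc (n + 1))).mono_exp (by omega)).add
        ((hI'.smul _).mono_exp (by omega))).add (hB'.smul _)
    -- The normal derivative of `B_n` has order `-3n - 2`; division by `φ_{x₁}` gives `-3(n + 1)`.
    have := IsSym.of_mul (𝔽 := (ampRays hC π).bd.comap (tang d)) (c := unitCost) (M := M)
      (fun _ => le_rfl) ((hu0.comap _).isSym _ _)
      (normal_isBigO (hC := hC) (π := fun i => (π i).toPhaseDatum)) ((hrhs.comap _).isSym _ _)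
      (G := refl π (n + 1)) (by
        convert h1 using 1
        simp only [prev]
        ring)
    exact this.mono_exp (by push_cast; omega)

/-- The two mechanisms combined: tangential derivatives at the initial points give all derivatives
there through the equation, and these propagate along the rays. -/
lemma allSym_refl_of_tangential
    (hu : ∀ m, (ampRays hC π).frame.AllSym (OpCoeffs.phaseExp m) (famD (Dir.x m) (ampPhases π)))
    {n : ℕ} {s : ℤ} (hs : (ampRays hC π).frame.AllSym (s - 1)
      ((𝔹.coeffs ι).source famD (prev (refl π) n)))
    (hT : ∀ w : List (Dir d), Dir.x 0 ∉ w →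
      (ampRays hC π).bd.ev ((ampRays hC π).bd.word w (refl π n)) =O[⊤]
        fun k => (ampRays hC π).bd.σ k ^ (s - ((ampRays hC π).bd.wordWt w : ℤ))) :
    (ampRays hC π).frame.AllSym s (refl π n) := by
  have ha : ∀ i, (ampRays hC π).frame.AllSym ((ampRays hC π).frame.wt i - 1)
      ((ampRays hC π).a i) :=
    OpCoeffs.allSym_transport (𝔽 := (ampRays hC π).frame) rays_wt flat_g flat_W hu
  have hδ : (ampRays hC π).frame.AllSym (-1) ((𝔹.coeffs ι).divg famD (ampPhases π)) :=
    OpCoeffs.allSym_divg (𝔽 := (ampRays hC π).frame) rays_wt flat_g flat_W hu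
  refine RayFrame.allSym_of_bd ha hδ hs (van_transport n) ?_
  have hn : (ampRays hC π).bd.wt (Dir.x 0) = 2 := by
    change Dir.wt (Dir.x 0 : Dir d) = 2
    simp [Dir.wt]
  exact allSym_of_field (𝔽 := (ampRays hC π).bd) hn (fun i => (ha i).reindex _)
    transport_normal_isBigO (hδ.reindex _) (hs.reindex _) ((van_transport n).reindex _) hT

/-- The reflected amplitudes along short rays. -/
theorem allSym_refl (hm : SameCondition π)
    (hu : ∀ m, (ampRays hC π).frame.AllSym (OpCoeffs.phaseExp m) (famD (Dir.x m) (ampPhases π)))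
    (n : ℕ) : (ampRays hC π).frame.AllSym (-3 * n) (refl π n) := by
  induction n with
  | zero =>
    have h0 : (𝔹.coeffs ι).source famD (prev (refl π) 0) = 0 := by simp [OpCoeffs.source, prev]
    refine allSym_refl_of_tangential hu ?_ fun w hw => (refl_zero_tangential hm hw).trans ?_
    · rw [h0]; exact allSym_iff_unit.2 fun _ => IsSym.zero
    · have := zpow_isBigO (𝔽 := (ampRays hC π).bd) (s := 0)
        (r := -3 * ((0 : ℕ) : ℤ) - ((ampRays hC π).bd.wordWt w : ℤ)) (by push_cast; omega)
      simpa using this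
  | succ n ih =>
    refine allSym_refl_of_tangential hu ?_ fun w hw => refl_succ_tangential hm hu ih hw
    exact (OpCoeffs.allSym_source (𝔽 := (ampRays hC π).frame) rays_wt flat_g ih).mono_exp
      (by push_cast; omega)

/-- The derivatives of the first amplitude which do not involve the normal variable. -/
theorem refl_zero_bound (hm : SameCondition π)
    (hu : ∀ m, (ampRays hC π).frame.AllSym (OpCoeffs.phaseExp m) (famD (Dir.x m) (ampPhases π)))
    {w : List (Dir d)} (hw : Dir.x 0 ∉ w) :
    ∃ A, 0 ≤ A ∧ ∀ i, ∀ r ∈ Set.Icc 0 (π i).ℓ, ‖wordDeriv w ((π i).B 0) ((π i).z r)‖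
      ≤ A * (1 + (π i).T * (π i).σ ^ (-1 - ((w.map Dir.wt).sum : ℤ))) := by
  obtain ⟨A, hA⟩ := isBigO_top.1 (refl_zero_tangential (hC := hC) hm hw)
  have ha : ∀ i, (ampRays hC π).frame.AllSym ((ampRays hC π).frame.wt i - 1)
      ((ampRays hC π).a i) :=
    OpCoeffs.allSym_transport (𝔽 := (ampRays hC π).frame) rays_wt flat_g flat_W hu
  -- The derivative of `D_w B_0` along the ray, of order `-1 - wt w`. It is integrated directly:
  -- Gronwall's inequality would lose the bounded initial value when `wt w` is positive.
  have h1 := (AllSym.field ha ((allSym_refl hm hu 0).word w)) []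
  obtain ⟨A', hA'⟩ := isBigO_top.1 h1
  refine ⟨|A| + 2 * |A'|, by positivity, fun i r hr => ?_⟩
  have hσ := (π i).σ_pos
  set P : ℝ := (π i).σ ^ (-1 - ((w.map Dir.wt).sum : ℤ)) with hP
  have hP0 : 0 ≤ P := by positivity
  have hT : 0 ≤ (π i).T := by linarith [(π i).ℓ_nonneg, (π i).ℓ_le]
  have h0 : ‖wordDeriv w ((π i).B 0) ((π i).z 0)‖ ≤ |A| := by
    have := hA i
    rw [bd_ev_word, norm_one, mul_one] at this
    exact this.trans (le_abs_self A)
  have hd : ∀ q ∈ Set.Icc 0 (π i).ℓ, HasDerivWithinAt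
      (fun q => wordDeriv w ((π i).B 0) ((π i).z q))
      ((π i).sgn * 𝔹.transportFn (π i).φ (wordDeriv w ((π i).B 0)) ((π i).z q))
      (Set.Icc 0 (π i).ℓ) q := fun q hq => (π i).deriv _ (((π i).smooth_B 0).wordDeriv w) q hq
  have hb : ∀ q ∈ Set.Icc 0 (π i).ℓ,
      ‖((π i).sgn : ℂ) * 𝔹.transportFn (π i).φ (wordDeriv w ((π i).B 0)) ((π i).z q)‖
        ≤ |A'| * P := fun q hq => by
    rw [norm_mul, Complex.norm_real, Real.norm_eq_abs, (π i).abs_sgn, one_mul]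
    have h2 := hA' ⟨(i, q), hq⟩
    have h3 : (ampRays hC π).frame.ev ((ampRays hC π).frame.field (ampRays hC π).a
        ((ampRays hC π).frame.word w (refl π 0))) ⟨(i, q), hq⟩
        = 𝔹.transportFn (π i).φ (wordDeriv w ((π i).B 0)) ((π i).z q) := by
      rw [show wordDeriv w ((π i).B 0) = ((ampRays hC π).frame.word w (refl π 0)).1 i from
        (famFrame_word (q := fun k : RayPt (ampRays hC π).ℓ => k.1.1)
          (z := fun k => (π k.1.1).z k.1.2) (hσ := (ampRays hC π).frame.σ_pos)
          (hσ' := (ampRays hC π).frame.σ_bdd) w (refl π 0) i).symm]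
      exact congrFun (coe_field _ _ i) _
    rw [word_nil, h3, Real.norm_of_nonneg (zpow_nonneg
      ((ampRays hC π).frame.σ_pos _).le _)] at h2
    refine h2.trans ?_
    have h4 : (ampRays hC π).frame.σ ⟨(i, q), hq⟩ ^ (-3 * ((0 : ℕ) : ℤ)
        - ((ampRays hC π).frame.wordWt w : ℤ) - 1 - ((ampRays hC π).frame.wordWt [] : ℤ)) = P := by
      rw [hP]
      refine congrArg (fun e : ℤ => (π i).σ ^ e) ?_
      rw [wordWt_nil, show (ampRays hC π).frame.wordWt w = (w.map Dir.wt).sum from rfl]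
      push_cast; ring
    rw [h4]
    exact mul_le_mul_of_nonneg_right (le_abs_self _) hP0
  have h5 := Convex.norm_image_sub_le_of_norm_hasDerivWithin_le hd hb (convex_Icc _ _)
    (show (0:ℝ) ∈ Set.Icc 0 (π i).ℓ from ⟨le_rfl, (π i).ℓ_nonneg⟩) hr
  have h6 : ‖r - 0‖ ≤ 2 * (π i).T := by
    rw [sub_zero, Real.norm_of_nonneg hr.1]
    exact hr.2.trans (π i).ℓ_le
  have h7 : |A'| * P * ‖r - 0‖ ≤ |A'| * P * (2 * (π i).T) := by gcongr
  have h8 := norm_le_norm_add_norm_sub' (wordDeriv w ((π i).B 0) ((π i).z r))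
    (wordDeriv w ((π i).B 0) ((π i).z 0))
  have h9 : 0 ≤ |A| * ((π i).T * P) := by positivity
  nlinarith [abs_nonneg A']

/-- The derivatives of all amplitudes. -/
theorem refl_bound (hm : SameCondition π)
    (hu : ∀ m, (ampRays hC π).frame.AllSym (OpCoeffs.phaseExp m) (famD (Dir.x m) (ampPhases π)))
    (n : ℕ) (w : List (Dir d)) :
    ∃ A, 0 ≤ A ∧ ∀ i, ∀ r ∈ Set.Icc 0 (π i).ℓ, ‖wordDeriv w ((π i).B n) ((π i).z r)‖
      ≤ A * (π i).σ ^ (-3 * (n : ℤ) - ((w.map Dir.wt).sum : ℤ)) := by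
  obtain ⟨A, hA⟩ := isBigO_top.1 (allSym_refl (hC := hC) hm hu n w)
  refine ⟨|A|, abs_nonneg A, fun i r hr => ?_⟩
  have hσ := (π i).σ_pos
  have h2 := hA ⟨(i, r), hr⟩
  rw [Real.norm_of_nonneg (zpow_nonneg ((ampRays hC π).frame.σ_pos _).le _)] at h2
  have h3 := (congrArg norm (famFrame_ev_word (hσ := (ampRays hC π).frame.σ_pos)
    (hσ' := (ampRays hC π).frame.σ_bdd) w (refl π n) (⟨(i, r), hr⟩ :
      RayPt (ampRays hC π).ℓ))).symm.le.trans h2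
  refine h3.trans ?_
  exact mul_le_mul_of_nonneg_right (le_abs_self _) (zpow_nonneg hσ.le _)

/-- Uniform estimates for all data on short rays. -/
theorem amplitude_bounds {C₀ A : ℝ} (hA : ∀ D : 𝔹.PhaseDatum C,
      C₀ * D.T ≤ D.σ → ∀ m, ∀ w : List (Dir d), w.length ≤ 1 → ∀ r ∈ Set.Icc 0 D.ℓ,
      ‖wordDeriv w (dirDeriv (Dir.x m).vec D.φ) (D.z r)‖
        ≤ A * D.σ ^ (OpCoeffs.phaseExp m - ((w.map Dir.wt).sum : ℤ)))
    (hC : 0 < C) (K : ℕ → List (Dir d) → ℝ) (n : ℕ) (w : List (Dir d)) :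
    ∃ A', 0 ≤ A' ∧ ∀ D : 𝔹.AmpDatum C K, C₀ * D.T ≤ D.σ → ∀ r ∈ Set.Icc 0 D.ℓ,
      ‖wordDeriv w (D.B n) (D.z r)‖
          ≤ A' * D.σ ^ (-3 * (n : ℤ) - ((w.map Dir.wt).sum : ℤ)) ∧
      (n = 0 → Dir.x 0 ∉ w → ‖wordDeriv w (D.B n) (D.z r)‖
          ≤ A' * (1 + D.T * D.σ ^ (-1 - ((w.map Dir.wt).sum : ℤ)))) := by
  -- Families are restricted to rays short enough for the phase bounds and to one boundary
  -- condition, given by `p`. The sum of the two constants then serves for all data.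
  have key : ∀ (p : 𝔹.AmpDatum C K → Prop), (SameCondition
        (fun D : {D : 𝔹.AmpDatum C K // C₀ * D.T ≤ D.σ ∧ p D} => D.1)) →
      ∃ A', 0 ≤ A' ∧ ∀ D : 𝔹.AmpDatum C K, C₀ * D.T ≤ D.σ → p D → ∀ r ∈ Set.Icc 0 D.ℓ,
      ‖wordDeriv w (D.B n) (D.z r)‖
          ≤ A' * D.σ ^ (-3 * (n : ℤ) - ((w.map Dir.wt).sum : ℤ)) ∧
      (n = 0 → Dir.x 0 ∉ w → ‖wordDeriv w (D.B n) (D.z r)‖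
          ≤ A' * (1 + D.T * D.σ ^ (-1 - ((w.map Dir.wt).sum : ℤ)))) := by
    intro p hm
    have hu := allSym_rays (hC := hC)
      (π := fun D : {D : 𝔹.AmpDatum C K // C₀ * D.T ≤ D.σ ∧ p D} => D.1.toPhaseDatum) (A := A)
      fun i => hA _ i.2.1
    obtain ⟨A1, hA10, hA1⟩ := refl_bound (hC := hC) hm hu n w
    by_cases hw : n = 0 ∧ Dir.x 0 ∉ w
    · obtain ⟨A2, hA20, hA2⟩ := refl_zero_bound (hC := hC) hm hu hw.2
      refine ⟨A1 + A2, by positivity, fun D hD hp r hr => ⟨?_, fun h0 _ => ?_⟩⟩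
      · have hσ := D.σ_pos
        refine (hA1 ⟨D, hD, hp⟩ r hr).trans ?_
        gcongr
        linarith
      · have hσ := D.σ_pos
        have hT : 0 ≤ D.T := by linarith [D.ℓ_nonneg, D.ℓ_le]
        subst h0
        refine (hA2 ⟨D, hD, hp⟩ r hr).trans ?_
        gcongr
        linarith
    · exact ⟨A1, hA10, fun D hD hp r hr => ⟨hA1 ⟨D, hD, hp⟩ r hr, fun h0 h1 =>
        absurd ⟨h0, h1⟩ hw⟩⟩
  obtain ⟨A1, hA10, hA1⟩ := key (fun D => ∀ n w, Dir.x 0 ∉ w →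
      wordDeriv w (fun z => D.B n z + D.B₀ n z) (D.z 0) = 0) (Or.inl fun i => i.2.2)
  obtain ⟨A2, hA20, hA2⟩ := key (fun D => ∀ n w, Dir.x 0 ∉ w → wordDeriv w (fun z =>
      (dirDeriv (Dir.x 0).vec D.φ z * D.B n z
        - Complex.I * dirDeriv (Dir.x 0).vec (prevAmp D.B n) z)
      - (dirDeriv (Dir.x 0).vec D.φ z * D.B₀ n z
        + Complex.I * dirDeriv (Dir.x 0).vec (prevAmp D.B₀ n) z)) (D.z 0) = 0)
    (Or.inr fun i => i.2.2)
  refine ⟨A1 + A2, by positivity, fun D hD r hr => ?_⟩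
  have hσ := D.σ_pos
  have hT : 0 ≤ D.T := by linarith [D.ℓ_nonneg, D.ℓ_le]
  rcases D.matching with hm | hm
  · obtain ⟨h1, h2⟩ := hA1 D hD hm r hr
    refine ⟨h1.trans ?_, fun h0 hw => (h2 h0 hw).trans ?_⟩ <;> gcongr <;> linarith
  · obtain ⟨h1, h2⟩ := hA2 D hD hm r hr
    refine ⟨h1.trans ?_, fun h0 hw => (h2 h0 hw).trans ?_⟩ <;> gcongr <;> linarith

end Background

/-! ### Bounds for covariables and smooth extension of the coefficients -/

namespace SchrodingerOp

variable {d : ℕ} [NeZero d] (P : SchrodingerOp d)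

lemma continuousOn_g (j k : Fin d) :
    ContinuousOn (fun x => P.g x j k) (Metric.closedBall 0 (3 / 4)) :=
  (P.smooth_g j k).continuousOn.mono (Metric.closedBall_subset_ball (by norm_num))

/-- Uniform ellipticity. -/
lemma exists_elliptic_bound : ∃ c, 0 < c ∧ ∀ x : Sp d, ‖x‖ ≤ 3 / 4 → ∀ η : Sp d,
    c * ‖η‖ ^ 2 ≤ ∑ j, ∑ k, P.g x j k * η j * η k := by
  have hK : IsCompact (Metric.closedBall (0 : Sp d) (3 / 4) ×ˢ Metric.sphere (0 : Sp d) 1) :=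
    (isCompact_closedBall _ _).prod (isCompact_sphere _ _)
  have hη : ∀ j, Continuous fun q : Sp d × Sp d => q.2 j := fun j => by fun_prop
  have hcont : ContinuousOn (fun q : Sp d × Sp d => ∑ j, ∑ k, P.g q.1 j k * q.2 j * q.2 k)
      (Metric.closedBall (0 : Sp d) (3 / 4) ×ˢ Metric.sphere (0 : Sp d) 1) := by
    refine continuousOn_finsetSum _ fun j _ => continuousOn_finsetSum _ fun k _ => ?_
    refine ((ContinuousOn.comp (P.continuousOn_g j k) continuousOn_fst fun q hq => hq.1).mul
      (hη j).continuousOn).mul (hη k).continuousOn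
  obtain ⟨c, hc, h⟩ := hK.exists_forall_le' hcont (a := 0) fun q hq => by
    have hx : q.1 ∈ Metric.ball (0 : Sp d) 1 :=
      Metric.closedBall_subset_ball (by norm_num) hq.1
    have hne : (fun j => q.2 j) ≠ 0 := fun h0 => by
      have h1 : q.2 = 0 := by ext j; exact congrFun h0 j
      have h2 : ‖q.2‖ = 1 := by simpa using hq.2
      rw [h1, norm_zero] at h2
      norm_num at h2
    have := (P.elliptic q.1 hx).dotProduct_mulVec_pos hne
    simp only [dotProduct, Matrix.mulVec, Pi.star_apply, star_trivial, Finset.mul_sum] at this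
    refine this.trans_eq (Finset.sum_congr rfl fun j _ => Finset.sum_congr rfl fun k _ => ?_)
    ring
  refine ⟨c, hc, fun x hx η => ?_⟩
  by_cases h0 : η = 0
  · simp [h0]
  have hn : 0 < ‖η‖ := norm_pos_iff.2 h0
  have h1 := h (x, ‖η‖⁻¹ • η) ⟨by simpa using hx, by simp [norm_smul, hn.ne']⟩
  have h2 : (∑ j, ∑ k, P.g x j k * (‖η‖⁻¹ • η) j * (‖η‖⁻¹ • η) k)
      = ‖η‖⁻¹ ^ 2 * ∑ j, ∑ k, P.g x j k * η j * η k := by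
    simp only [Finset.mul_sum, PiLp.smul_apply, smul_eq_mul]
    exact Finset.sum_congr rfl fun j _ => Finset.sum_congr rfl fun k _ => by ring
  simp only at h1
  rw [h2, inv_pow, inv_mul_eq_div, le_div_iff₀ (by positivity)] at h1
  exact h1

/-- The energy controls the covariables. -/
lemma exists_covector_bound (E : ℝ) : ∃ R, 0 ≤ R ∧ ∀ x : Sp d, ‖x‖ ≤ 3 / 4 → ∀ ξ : Fin d → ℝ,
    P.symbol x ξ ≤ E → ∀ j, |ξ j| ≤ R := by
  obtain ⟨c, hc, h⟩ := P.exists_elliptic_bound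
  have hK : IsCompact (Metric.closedBall (0 : Sp d) (3 / 4)) := isCompact_closedBall _ _
  have hsub : Metric.closedBall (0 : Sp d) (3 / 4) ⊆ Metric.ball 0 1 :=
    Metric.closedBall_subset_ball (by norm_num)
  obtain ⟨v, hv⟩ := hK.exists_bound_of_continuousOn (P.smooth_V.continuousOn.mono hsub)
  choose w hw using fun j =>
    hK.exists_bound_of_continuousOn ((P.smooth_W j).continuousOn.mono hsub)
  refine ⟨√((|E| + |v|) / c) + ∑ j, |w j|, by positivity, fun x hx ξ hξ j => ?_⟩
  have hx' : x ∈ Metric.closedBall (0 : Sp d) (3 / 4) := by simpa using hx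
  set η : Sp d := WithLp.toLp 2 fun j => ξ j - P.W x j with hη
  have h1 := h x hx η
  have h2 : c * ‖η‖ ^ 2 ≤ |E| + |v| := by
    have h3 : P.symbol x ξ = (∑ j, ∑ k, P.g x j k * η j * η k) + P.V x := rfl
    have h4 := hv x hx'
    rw [Real.norm_eq_abs] at h4
    have h5 := neg_abs_le (P.V x)
    have h6 := le_abs_self E
    have h7 := le_abs_self v
    linarith
  have h3 : |ξ j - P.W x j| ≤ √((|E| + |v|) / c) := by
    refine le_trans ?_ (Real.le_sqrt_of_sq_le ((le_div_iff₀' hc).2 h2))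
    exact PiLp.norm_apply_le η j
  have h4 : |P.W x j| ≤ ∑ j, |w j| := by
    refine ((hw j x hx').trans (le_abs_self _)).trans ?_
    exact Finset.single_le_sum (f := fun j => |w j|) (fun _ _ => abs_nonneg _) (Finset.mem_univ j)
  calc |ξ j| = |(ξ j - P.W x j) + P.W x j| := by ring_nf
    _ ≤ |ξ j - P.W x j| + |P.W x j| := abs_add_le _ _
    _ ≤ _ := add_le_add h3 h4

/-- Smooth extension of the coefficients. -/
lemma exists_global_coeffs : ∃ (g : Fin d → Fin d → Sp d → ℝ) (W : Fin d → Sp d → ℝ) (V : Sp d → ℝ),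
    (∀ j k, ContDiff ℝ ∞ (g j k)) ∧ (∀ j, ContDiff ℝ ∞ (W j)) ∧ ContDiff ℝ ∞ V ∧
    (∀ j k, g j k = g k j) ∧ (∀ k x, g 0 k x = if k = 0 then 1 else 0) ∧ (∀ x, W 0 x = 0) ∧
    ∀ x : Sp d, ‖x‖ < 3 / 4 → (∀ j k, g j k x = P.g x j k) ∧ (∀ j, W j x = P.W x j) ∧
      V x = P.V x := by
  have hsub : Metric.closedBall (0 : Sp d) (3 / 4) ⊆ Metric.ball 0 1 :=
    Metric.closedBall_subset_ball (by norm_num)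
  obtain ⟨χ, hχ, h0, Y, -, hKY, hY, h1⟩ :=
    exists_cutoff Metric.isClosed_closedBall Metric.isOpen_ball hsub
  have hsm : ∀ {f : Sp d → ℝ}, ContDiffOn ℝ ∞ f (Metric.ball 0 1) →
      ContDiff ℝ ∞ fun x => χ x • f x := fun hf =>
    contDiff_cutoff_smul Metric.isOpen_ball hχ h0 hf
  have hz : ∀ x, x ∉ Metric.ball (0 : Sp d) 1 → χ x = 0 := fun x hx => (h0 x hx).self_of_nhds
  have hsymm : ∀ x ∈ Metric.ball (0 : Sp d) 1, ∀ j k, P.g x j k = P.g x k j := fun x hx j k => by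
    have := (P.elliptic x hx).1.apply k j
    simpa using this
  -- First row and column are prescribed as constants, not cut off, so that the normal form holds in
  -- all of space. Positivity of the extended metric is not required.
  refine ⟨fun j k => if j = 0 then fun _ => if k = 0 then 1 else 0 else
      if k = 0 then fun _ => 0 else fun x => χ x • P.g x j k,
    fun j => if j = 0 then fun _ => 0 else fun x => χ x • P.W x j, fun x => χ x • P.V x,
    fun j k => ?_, fun j => ?_, hsm P.smooth_V, fun j k => ?_, fun k x => ?_, fun x => ?_,
    fun x hx => ?_⟩
  · by_cases hj : j = 0 <;> by_cases hk : k = 0 <;> simp only [hj, hk, if_true, if_false]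
    · exact contDiff_const
    · exact contDiff_const
    · exact contDiff_const
    · exact hsm (P.smooth_g j k)
  · by_cases hj : j = 0 <;> simp only [hj, if_true, if_false]
    · exact contDiff_const
    · exact hsm (P.smooth_W j)
  · by_cases hj : j = 0 <;> by_cases hk : k = 0 <;> simp only [hj, hk, if_true, if_false]
    funext x
    by_cases hx : x ∈ Metric.ball (0 : Sp d) 1
    · rw [hsymm x hx]
    · simp [hz x hx]
  · simp
  · simp
  · have hxK : x ∈ Metric.closedBall (0 : Sp d) (3 / 4) := by simpa using hx.le
    have hxb := hsub hxK
    have hx1 := h1 x (hKY hxK)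
    refine ⟨fun j k => ?_, fun j => ?_, by simp [hx1]⟩
    · by_cases hj : j = 0
      · subst hj; simp [P.normal_g x hxb]
      · by_cases hk : k = 0
        · subst hk; simp [hj, hsymm x hxb j 0, P.normal_g x hxb]
        · simp [hj, hk, hx1]
    · by_cases hj : j = 0
      · subst hj; simp [P.normal_W x hxb]
      · simp [hj, hx1]

end SchrodingerOp

/-! ### Partial derivatives as directional derivatives -/

section Lift

variable {d : ℕ}

/-- The projection which forgets the variable `t`. -/
def phasePt (z : AmpPt d) : PhasePt d := (z.1, z.2.2.1, z.2.2.2)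

lemma contDiff_phasePt : ContDiff ℝ ∞ (phasePt (d := d)) := by
  unfold phasePt; fun_prop

lemma hasFDerivAt_slice (x : Sp d) (t : ℝ) (y θ : Sp d) :
    HasFDerivAt (fun x' => ((x', t, y, θ) : AmpPt d))
      (ContinuousLinearMap.inl ℝ (Sp d) (ℝ × Sp d × Sp d)) x := by
  have := (hasFDerivAt_id (𝕜 := ℝ) x).prodMk (hasFDerivAt_const (𝕜 := ℝ) (t, y, θ) x)
  exact this

/-- Partial derivatives are directional derivatives. -/
lemma xpartial_slice {F : AmpPt d → ℂ} {x : Sp d} {t : ℝ} {y θ : Sp d}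
    (hF : DifferentiableAt ℝ F (x, t, y, θ)) (j : Fin d) :
    xpartial j (fun x' => F (x', t, y, θ)) x = dirDeriv (Dir.x j).vec F (x, t, y, θ) := by
  have := HasFDerivAt.comp x hF.hasFDerivAt (hasFDerivAt_slice x t y θ)
  rw [xpartial, show (fun x' => F (x', t, y, θ)) = F ∘ fun x' => ((x', t, y, θ) : AmpPt d) from rfl,
    this.fderiv]
  rfl

lemma fderiv_ofReal {E : Type*} [NormedAddCommGroup E] [NormedSpace ℝ E] {h : E → ℝ} {x : E}
    (hh : DifferentiableAt ℝ (fun x => (h x : ℂ)) x) (v : E) :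
    fderiv ℝ (fun x => (h x : ℂ)) x v = (fderiv ℝ h x v : ℂ) := by
  have h1 : DifferentiableAt ℝ h x := by
    have := Complex.reCLM.differentiableAt.comp x hh
    exact this
  have := (Complex.ofRealCLM.hasFDerivAt (x := h x)).comp x h1.hasFDerivAt
  rw [show (fun x => (h x : ℂ)) = Complex.ofRealCLM ∘ h from rfl, this.fderiv]
  rfl

/-- Partial derivatives of real functions are directional derivatives. -/
lemma xpartial_ofReal_slice {F : AmpPt d → ℂ} {h : Sp d → ℝ} {x : Sp d} {t : ℝ} {y θ : Sp d}
    (hF : DifferentiableAt ℝ F (x, t, y, θ))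
    (hh : ∀ᶠ x' in 𝓝 x, F (x', t, y, θ) = h x') (j : Fin d) :
    dirDeriv (Dir.x j).vec F (x, t, y, θ) = ((xpartial j h x : ℝ) : ℂ) := by
  rw [← xpartial_slice hF, xpartial, xpartial]
  have hh' : (fun x' => F (x', t, y, θ)) =ᶠ[𝓝 x] fun x' => (h x' : ℂ) := hh
  have hd : DifferentiableAt ℝ (fun x' => F (x', t, y, θ)) x :=
    DifferentiableAt.comp x hF (hasFDerivAt_slice x t y θ).differentiableAt
  rw [hh'.fderiv_eq]
  exact fderiv_ofReal (hh'.differentiableAt_iff.1 hd) _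

end Lift

/-! ### The incident phase near the diagonal -/

/-- Near the diagonal, derivatives of `∂_{x₁} φ - θ₁` in the directions of weight zero are small. -/
lemma exists_diagonal_bound {d : ℕ} [NeZero d] {ψ : AmpPt d → ℂ} (hψs : ContDiff ℝ ∞ ψ)
    {Y K : Set (AmpPt d)} (hY : IsOpen Y) (hKc : IsCompact K) (hKY : K ⊆ Y)
    (hgrad : ∀ z ∈ Y ∩ {z : AmpPt d | z.1 = z.2.2.1},
      (dirDeriv (Dir.x 0).vec ψ - fun z : AmpPt d => (z.2.2.2 0 : ℂ)) z = 0)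
    (hstar : ∀ z ∈ K, ((z.2.2.1, z.2.1, z.2.2.1, z.2.2.2) : AmpPt d) ∈ K ∧
      segment ℝ ((z.2.2.1, z.2.1, z.2.2.1, z.2.2.2) : AmpPt d) z ⊆ K)
    {w : List (Dir d)} (hw : w ≠ []) (hwt : ∀ i ∈ w, i.wt = 0) : ∃ C, ∀ z ∈ K,
      ‖wordDeriv w (dirDeriv (Dir.x 0).vec ψ) z‖ ≤ C * ‖z.1 - z.2.2.1‖ := by
  have hθs : ContDiff ℝ ∞ fun z : AmpPt d => (z.2.2.2 0 : ℂ) :=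
    Complex.ofRealCLM.contDiff.comp
      (contDiff_euclidean.1 (contDiff_snd.comp (contDiff_snd.comp contDiff_snd)) 0)
  have hθ : ∀ i ∈ w, ∃ j : Fin d, j ≠ 0 ∧ i = Dir.θ j := by
    intro i hi
    have := hwt i hi
    rcases i with j | _ | j | j
    · simp only [Dir.wt, Sum.elim_inl] at this; split_ifs at this
    · simp [Dir.wt] at this
    · simp [Dir.wt] at this
    · refine ⟨j, fun hj => ?_, rfl⟩
      simp [Dir.wt, hj] at this
  have hGs := (hψs.dirDeriv (Dir.x 0).vec).wordDeriv w
  have hzero : ∀ z ∈ Y ∩ {z | z.1 = z.2.2.1}, wordDeriv w (dirDeriv (Dir.x 0).vec ψ) z = 0 := by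
    -- Directions in `θ` preserve the diagonal, so the vanishing of `∂_{x₁} φ⁰ - θ₁` there can be
    -- differentiated. The term `θ₁` drops out at the first letter, which is some `θ_j` with `j ≠
    -- 0`.
    have h1 := wordDeriv_eq_zero_of_line ((hψs.dirDeriv (Dir.x 0).vec).sub hθs) hY
      hgrad (w := w) fun i hi z hz r => by
        obtain ⟨j, -, rfl⟩ := hθ i hi
        simpa [Dir.vec, Dir.θ] using hz
    cases w with
    | nil => exact absurd rfl hw
    | cons i w =>
      obtain ⟨j, hj, rfl⟩ := hθ i (by simp)
      have h2 : dirDeriv (Dir.θ j).vec (fun z : AmpPt d => (z.2.2.2 0 : ℂ)) = 0 :=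
        dirDeriv_eq_zero_of_const hθs fun z r => by
          simp [Dir.vec, Dir.θ, hj.symm]
      have h3 : dirDeriv (Dir.θ j).vec (dirDeriv (Dir.x 0).vec ψ
          - fun z : AmpPt d => (z.2.2.2 0 : ℂ))
          = dirDeriv (Dir.θ j).vec (dirDeriv (Dir.x 0).vec ψ) := by
        funext z
        have h4 : fderiv ℝ (dirDeriv (Dir.x 0).vec ψ - fun z : AmpPt d => (z.2.2.2 0 : ℂ)) z
            = fderiv ℝ (dirDeriv (Dir.x 0).vec ψ) z
              - fderiv ℝ (fun z : AmpPt d => (z.2.2.2 0 : ℂ)) z :=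
          fderiv_sub ((hψs.dirDeriv _).differentiable (by simp) z)
            (hθs.differentiable (by simp) z)
        have h5 := congrFun h2 z
        simp only [dirDeriv, Pi.zero_apply] at h5
        rw [dirDeriv, h4, sub_apply, h5, sub_zero]
        rfl
      have h6 := h1
      simp only [wordDeriv] at h6 ⊢
      intro z hz
      have h7 := h6 z hz
      change wordDeriv w (dirDeriv (Dir.θ j).vec (dirDeriv (Dir.x 0).vec ψ
          - fun z : AmpPt d => (z.2.2.2 0 : ℂ))) z = 0 at h7
      rwa [h3] at h7
  obtain ⟨C, hC⟩ := hKc.exists_bound_of_continuousOn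
    (hGs.continuous_fderiv (by simp)).continuousOn
  refine ⟨C, fun z hz => ?_⟩
  obtain ⟨ha, hseg⟩ := hstar z hz
  -- The mean value inequality on the segment from the diagonal point with the same `t, y, θ`; the
  -- segment stays in the compact set `K`.
  have := (convex_segment ((z.2.2.1, z.2.1, z.2.2.1, z.2.2.2) : AmpPt d) z
    ).norm_image_sub_le_of_norm_fderiv_le (𝕜 := ℝ)
    (f := wordDeriv w (dirDeriv (Dir.x 0).vec ψ)) (C := C)
    (fun q _ => hGs.differentiable (by simp) q) (fun q hq => hC q (hseg hq))
    (left_mem_segment ℝ _ z) (right_mem_segment ℝ _ z)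
  rw [hzero _ ⟨hKY ha, rfl⟩, sub_zero] at this
  refine this.trans_eq ?_
  congr 1
  have e3 : z - ((z.2.2.1, z.2.1, z.2.2.1, z.2.2.2) : AmpPt d) = (z.1 - z.2.2.1, 0) :=
    Prod.ext rfl (sub_self z.2)
  rw [e3, Prod.norm_def]
  simp

/-- At `x = y` the normalization of the incident phase gives gradient `θ`; it passes to any
extension agreeing with the phase near the point. -/
lemma gradient_diagonal {d : ℕ} [NeZero d] {P : SchrodingerOp d} {τ ε : ℝ}
    {φ₀ : PhasePt d → ℝ} (hφ₀ : IncidentPhase P τ ε φ₀) {ψ : AmpPt d → ℂ} (hψs : ContDiff ℝ ∞ ψ)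
    {Y : Set (AmpPt d)} (hY : IsOpen Y) (hψY : ∀ z ∈ Y, ψ z = φ₀ (phasePt z)) (x : Sp d) (t : ℝ)
    (θ : Sp d) (hz : (x, t, x, θ) ∈ Y) (hd : (x, x, θ) ∈ phaseDomain P τ ε) :
    dirDeriv (Dir.x 0).vec ψ (x, t, x, θ) = (θ 0 : ℂ) := by
  have hc : ContinuousAt (fun x' : Sp d => ((x', t, x, θ) : AmpPt d)) x :=
    (hasFDerivAt_slice x t x θ).continuousAt
  have hev : ∀ᶠ x' in 𝓝 x, ψ (x', t, x, θ) = ((φ₀ (x', x, θ) : ℝ) : ℂ) :=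
    (hc.eventually (hY.mem_nhds hz)).mono fun x' hx' => hψY _ hx'
  have hd' : DifferentiableAt ℝ ψ (x, t, x, θ) := hψs.differentiable (by simp) _
  rw [xpartial_ofReal_slice (h := fun x' => φ₀ (x', x, θ)) hd' hev 0, hφ₀.gradient x θ hd 0]

set_option maxHeartbeats 2000000 in
/-- The points to be considered. -/
lemma exists_compact_region {d : ℕ} [NeZero d] (P : SchrodingerOp d) {τ ε : ℝ} (hε : 0 < ε) :
    ∃ (δ : ℝ) (K U : Set (AmpPt d)), 0 < δ ∧ δ < ε ∧ IsCompact K ∧ IsOpen U ∧ K ⊆ U ∧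
      (∀ z ∈ U, phasePt z ∈ phaseDomain P τ ε) ∧
      (∀ z ∈ K, ((z.2.2.1, z.2.1, z.2.2.1, z.2.2.2) : AmpPt d) ∈ K ∧
        segment ℝ ((z.2.2.1, z.2.1, z.2.2.1, z.2.2.2) : AmpPt d) z ⊆ K) ∧
      ∀ (x : Sp d) (t : ℝ) (y θ : Sp d), ‖y‖ ≤ 1 / 2 → ‖x - y‖ ≤ δ → |t| ≤ δ →
        |P.symbol y (fun j => θ j) - τ| ≤ ε / 2 → (x, t, y, θ) ∈ K := by
  obtain ⟨g, W, V, hg, hW, hV, -, -, -, heq⟩ := P.exists_global_coeffs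
  obtain ⟨S, hS0, hS⟩ := P.exists_covector_bound (τ + ε / 2)
  -- The bound `1/8` keeps `x` in the ball of radius `3/4` when `‖y‖ ≤ 1/2`; `ε / 2` makes the
  -- inclusion of `K` in the open phase domain strict.
  set δ : ℝ := min (1 / 8) (ε / 2) with hδ
  have hδ0 : 0 < δ := by positivity
  have hδε : δ < ε := (min_le_right _ _).trans_lt (by linarith)
  have hδ8 : δ ≤ 1 / 8 := min_le_left _ _
  -- The energy with extended coefficients is continuous everywhere, which makes `K` closed and `U`
  -- open; for `‖y‖ < 3/4` it is the true energy.
  set e : AmpPt d → ℝ := fun z => (∑ j, ∑ k, g j k z.2.2.1 * (z.2.2.2 j - W j z.2.2.1)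
    * (z.2.2.2 k - W k z.2.2.1)) + V z.2.2.1 with he
  have hec : Continuous e := by
    have h1 : ∀ {f : Sp d → ℝ}, ContDiff ℝ ∞ f → Continuous fun z : AmpPt d => f z.2.2.1 :=
      fun hf => hf.continuous.comp (by fun_prop)
    have h2 : ∀ j, Continuous fun z : AmpPt d => z.2.2.2 j := fun j => by fun_prop
    refine Continuous.add (continuous_finsetSum _ fun j _ => continuous_finsetSum _ fun k _ => ?_)
      (h1 hV)
    exact ((h1 (hg j k)).mul ((h2 j).sub (h1 (hW j)))).mul ((h2 k).sub (h1 (hW k)))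
  have hes : ∀ z : AmpPt d, ‖z.2.2.1‖ < 3 / 4 → e z = P.symbol z.2.2.1 fun j => z.2.2.2 j := by
    intro z hz
    obtain ⟨h1, h2, h3⟩ := heq _ hz
    simp only [he, SchrodingerOp.symbol, h1, h2, h3]
  set K : Set (AmpPt d) := {z | ‖z.2.2.1‖ ≤ 1 / 2 ∧ ‖z.1 - z.2.2.1‖ ≤ δ ∧ |z.2.1| ≤ δ ∧
    |e z - τ| ≤ ε / 2} with hK
  have hKclosed : IsClosed K := by
    have h1 : IsClosed {z : AmpPt d | ‖z.2.2.1‖ ≤ 1 / 2} :=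
      isClosed_le (by fun_prop) continuous_const
    have h2 : IsClosed {z : AmpPt d | ‖z.1 - z.2.2.1‖ ≤ δ} :=
      isClosed_le (by fun_prop) continuous_const
    have h3 : IsClosed {z : AmpPt d | |z.2.1| ≤ δ} := isClosed_le (by fun_prop) continuous_const
    have h4 : IsClosed {z : AmpPt d | |e z - τ| ≤ ε / 2} :=
      isClosed_le (hec.sub continuous_const).abs continuous_const
    exact h1.inter (h2.inter (h3.inter h4))
  have hKc : IsCompact K := by
    refine Metric.isCompact_of_isClosed_isBounded hKclosed ?_
    have hb : IsCompact (Metric.closedBall (0 : Sp d) 1 ×ˢ Metric.closedBall (0 : ℝ) 1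
        ×ˢ Metric.closedBall (0 : Sp d) 1 ×ˢ Metric.closedBall (0 : Sp d) (∑ _j : Fin d, S)) :=
      (isCompact_closedBall _ _).prod ((isCompact_closedBall _ _).prod
        ((isCompact_closedBall _ _).prod (isCompact_closedBall _ _)))
    refine hb.isBounded.subset ?_
    rintro ⟨x, t, y, θ⟩ ⟨h1, h2, h3, h4⟩
    simp only at h1 h2 h3 h4
    have hx : ‖x‖ ≤ ‖x - y‖ + ‖y‖ := by simpa using norm_add_le (x - y) y
    have h5 := hes (x, t, y, θ) (by simp only; linarith)
    rw [h5] at h4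
    have h6 : P.symbol y (fun j => θ j) ≤ τ + ε / 2 := by
      have := (abs_le.1 h4).2
      simp only at this
      linarith
    have h7 := hS y (by linarith) _ h6
    have h8 : ‖θ‖ ≤ ∑ _j : Fin d, S := by
      have h9 : θ = ∑ j, EuclideanSpace.single j (θ j) := by
        ext i; simp
      calc ‖θ‖ = ‖∑ j, EuclideanSpace.single j (θ j)‖ := by rw [← h9]
        _ ≤ ∑ j, ‖EuclideanSpace.single j (θ j)‖ := norm_sum_le _ _
        _ ≤ ∑ _j : Fin d, S := Finset.sum_le_sum fun j _ => by simpa using h7 j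
    simp only [Set.mem_prod, mem_closedBall_zero_iff, Real.norm_eq_abs]
    exact ⟨by linarith, by linarith, by linarith, h8⟩
  set U : Set (AmpPt d) := {z | ‖z.1‖ < 3 / 4 ∧ ‖z.2.2.1‖ < 3 / 4 ∧ ‖z.1 - z.2.2.1‖ < ε ∧
    |e z - τ| < ε} with hU
  have hUo : IsOpen U := by
    have h1 : IsOpen {z : AmpPt d | ‖z.1‖ < 3 / 4} := isOpen_lt (by fun_prop) continuous_const
    have h2 : IsOpen {z : AmpPt d | ‖z.2.2.1‖ < 3 / 4} := isOpen_lt (by fun_prop) continuous_const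
    have h3 : IsOpen {z : AmpPt d | ‖z.1 - z.2.2.1‖ < ε} :=
      isOpen_lt (by fun_prop) continuous_const
    have h4 : IsOpen {z : AmpPt d | |e z - τ| < ε} :=
      isOpen_lt (hec.sub continuous_const).abs continuous_const
    exact h1.inter (h2.inter (h3.inter h4))
  have hUd : ∀ z ∈ U, phasePt z ∈ phaseDomain P τ ε := fun z hz =>
    ⟨hz.1, hz.2.1, hz.2.2.1, by rw [phasePt, ← hes z hz.2.1]; exact hz.2.2.2⟩
  have hKU : K ⊆ U := by
    rintro z ⟨h1, h2, h3, h4⟩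
    have hx : ‖z.1‖ ≤ ‖z.1 - z.2.2.1‖ + ‖z.2.2.1‖ := by simpa using norm_add_le (z.1 - z.2.2.1) z.2.2.1
    exact ⟨by linarith, by linarith, by linarith, by linarith⟩
  have hstar : ∀ z ∈ K, ((z.2.2.1, z.2.1, z.2.2.1, z.2.2.2) : AmpPt d) ∈ K ∧
      segment ℝ ((z.2.2.1, z.2.1, z.2.2.1, z.2.2.2) : AmpPt d) z ⊆ K := by
    intro z hz
    have ha : ((z.2.2.1, z.2.1, z.2.2.1, z.2.2.2) : AmpPt d) ∈ K :=
      ⟨hz.1, by simpa using hδ0.le, hz.2.2.1, hz.2.2.2⟩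
    have hseg : segment ℝ ((z.2.2.1, z.2.1, z.2.2.1, z.2.2.2) : AmpPt d) z ⊆ K := by
      rintro _ ⟨a, b, ha0, hb0, hab, rfl⟩
      have hb1 : b ≤ 1 := by linarith
      have e1 : a • ((z.2.2.1, z.2.1, z.2.2.1, z.2.2.2) : AmpPt d) + b • z
          = (a • z.2.2.1 + b • z.1, z.2.1, z.2.2.1, z.2.2.2) := by
        have h1 : a • z.2 + b • z.2 = z.2 := by rw [← add_smul, hab, one_smul]
        exact Prod.ext rfl h1
      rw [e1]
      refine ⟨hz.1, ?_, hz.2.2.1, hz.2.2.2⟩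
      have e2 : a • z.2.2.1 + b • z.1 - z.2.2.1 = b • (z.1 - z.2.2.1) := by
        have : a = 1 - b := by linarith
        rw [this, sub_smul, one_smul, smul_sub]; abel
      simp only [e2]
      rw [norm_smul, Real.norm_of_nonneg hb0]
      calc b * ‖z.1 - z.2.2.1‖ ≤ 1 * ‖z.1 - z.2.2.1‖ := by gcongr
        _ ≤ δ := by rw [one_mul]; exact hz.2.1
    exact ⟨ha, hseg⟩
  refine ⟨δ, K, U, hδ0, hδε, hKc, hUo, hKU, hUd, hstar, fun x t y θ h1 h2 h3 h4 => ?_⟩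
  refine ⟨h1, h2, h3, ?_⟩
  rw [hes (x, t, y, θ) (show ‖y‖ < 3 / 4 by linarith)]
  exact h4

set_option maxHeartbeats 2000000 in
/-- The parameters, smoothly extended to all of space. -/
theorem exists_background {d : ℕ} [NeZero d] (P : SchrodingerOp d) {τ ε : ℝ} (hε : 0 < ε)
    {φ₀ : PhasePt d → ℝ} (hφ₀ : IncidentPhase P τ ε φ₀) :
    ∃ (𝔹 : Background d) (δ : ℝ), 0 < δ ∧ δ < ε ∧ 0 ≤ 𝔹.S ∧
      (∀ x : Sp d, ‖x‖ < 3 / 4 → (∀ j k, 𝔹.g j k x = P.g x j k) ∧ (∀ j, 𝔹.W j x = P.W x j) ∧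
        𝔹.V x = P.V x) ∧
      (∃ Y, IsOpen Y ∧ 𝔹.K ⊆ Y ∧ ∀ z ∈ Y, phasePt z ∈ phaseDomain P τ ε ∧
        𝔹.φ₀ z = φ₀ (phasePt z)) ∧
      (∀ (x : Sp d) (t : ℝ) (y θ : Sp d), ‖y‖ ≤ 1 / 2 → ‖x - y‖ ≤ δ → |t| ≤ δ →
        |P.symbol y (fun j => θ j) - τ| ≤ ε / 2 → (x, t, y, θ) ∈ 𝔹.K) ∧
      ∀ (x : Sp d) (ξ : Fin d → ℝ), ‖x‖ < 3 / 4 → P.symbol x ξ ≤ τ + ε / 2 → |ξ 0| ≤ 𝔹.S := by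
  obtain ⟨g, W, V, hg, hW, hV, hsymm, hng, hnW, heq⟩ := P.exists_global_coeffs
  obtain ⟨S, hS0, hS⟩ := P.exists_covector_bound (τ + ε / 2)
  obtain ⟨δ, K, U, hδ0, hδε, hKc, hUo, hKU, hUd, hstar, hmem⟩ :=
    exists_compact_region P (τ := τ) hε
  -- The incident phase is cut off near `K`, and keeps its values in a neighbourhood `Y` of `K`,
  -- hence all its derivatives on `K`.
  obtain ⟨χ, hχ, h0, Y, hY, hKY, hYU, hY1⟩ := exists_cutoff hKc.isClosed hUo hKU
  have hφs : ContDiffOn ℝ ∞ (fun z : AmpPt d => (φ₀ (phasePt z) : ℂ)) U :=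
    Complex.ofRealCLM.contDiff.comp_contDiffOn
      (hφ₀.smooth.comp contDiff_phasePt.contDiffOn hUd)
  set ψ : AmpPt d → ℂ := fun z => χ z • (φ₀ (phasePt z) : ℂ) with hψ
  have hψs : ContDiff ℝ ∞ ψ := contDiff_cutoff_smul hUo hχ h0 hφs
  have hψY : ∀ z ∈ Y, ψ z = φ₀ (phasePt z) := fun z hz => by simp [hψ, hY1 z hz]
  have hgrad : ∀ z ∈ Y ∩ {z : AmpPt d | z.1 = z.2.2.1},
      (dirDeriv (Dir.x 0).vec ψ - fun z : AmpPt d => (z.2.2.2 0 : ℂ)) z = 0 := by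
    rintro ⟨x, t, y, θ⟩ ⟨hz, hxy⟩
    obtain rfl : x = y := hxy
    exact sub_eq_zero.2 (gradient_diagonal hφ₀ hψs hY hψY x t θ hz (hUd (x, t, x, θ) (hYU hz)))
  refine ⟨⟨g, W, V, hg, hW, hV, hsymm, hng, hnW, ψ, hψs, K, hKc, S,
    fun w hw hwt => exists_diagonal_bound hψs hY hKc hKY hgrad hstar hw hwt⟩, δ, hδ0, hδε, hS0, heq,
    ⟨Y, hY, hKY, fun z hz => ⟨hUd z (hYU hz), hψY z hz⟩⟩, hmem,
    fun x ξ hx hξ => hS x hx.le ξ hξ 0⟩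

/-! ### The equations for the extended functions compared with the original ones -/

section Slices

variable {d : ℕ} {V : Set (AmpPt d)} {x : Sp d} {t : ℝ} {y θ : Sp d}

lemma eventually_slice (hV : IsOpen V) (hz : (x, t, y, θ) ∈ V) :
    ∀ᶠ x' in 𝓝 x, (x', t, y, θ) ∈ V := by
  have hc : ContinuousAt (fun x' : Sp d => ((x', t, y, θ) : AmpPt d)) x :=
    (hasFDerivAt_slice x t y θ).continuousAt
  exact hc.eventually (hV.mem_nhds hz)

lemma hasDerivAt_tslice (x : Sp d) (t : ℝ) (y θ : Sp d) :
    HasDerivAt (fun s => ((x, s, y, θ) : AmpPt d)) Dir.t.vec t :=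
  (hasDerivAt_const t x).prodMk ((hasDerivAt_id t).prodMk (hasDerivAt_const t (y, θ)))

lemma deriv_tslice {F : AmpPt d → ℂ} (hF : ContDiff ℝ ∞ F) :
    deriv (fun s => F (x, s, y, θ)) t = dirDeriv Dir.t.vec F (x, t, y, θ) := by
  have h1 : HasFDerivAt F (fderiv ℝ F (x, t, y, θ)) (x, t, y, θ) :=
    (hF.differentiable (by simp) _).hasFDerivAt
  have h2 := HasFDerivAt.comp_hasDerivAt t h1 (hasDerivAt_tslice x t y θ)
  exact h2.deriv

lemma eventually_tslice (hV : IsOpen V) (hz : (x, t, y, θ) ∈ V) :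
    ∀ᶠ s in 𝓝 t, (x, s, y, θ) ∈ V := by
  have hc : ContinuousAt (fun s => ((x, s, y, θ) : AmpPt d)) t :=
    (hasDerivAt_tslice x t y θ).continuousAt
  exact hc.eventually (hV.mem_nhds hz)

lemma xpartial_eq_dirDeriv {B F : AmpPt d → ℂ} (hF : ContDiff ℝ ∞ F) (hV : IsOpen V)
    (h : ∀ z ∈ V, F z = B z) (hz : (x, t, y, θ) ∈ V) (j : Fin d) :
    xpartial j (fun x' => B (x', t, y, θ)) x = dirDeriv (Dir.x j).vec F (x, t, y, θ) := by
  rw [← xpartial_slice (hF.differentiable (by simp) _), xpartial, xpartial]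
  have h1 : (fun x' => B (x', t, y, θ)) =ᶠ[𝓝 x] fun x' => F (x', t, y, θ) :=
    (eventually_slice hV hz).mono fun x' hx' => (h _ hx').symm
  rw [h1.fderiv_eq]

lemma deriv_eq_dirDeriv {B F : AmpPt d → ℂ} (hF : ContDiff ℝ ∞ F) (hV : IsOpen V)
    (h : ∀ z ∈ V, F z = B z) (hz : (x, t, y, θ) ∈ V) :
    deriv (fun s => B (x, s, y, θ)) t = dirDeriv Dir.t.vec F (x, t, y, θ) := by
  rw [← deriv_tslice hF]
  have h1 : (fun s => B (x, s, y, θ)) =ᶠ[𝓝 t] fun s => F (x, s, y, θ) :=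
    (eventually_tslice hV hz).mono fun s hs => (h _ hs).symm
  exact h1.deriv_eq

variable {Φ : AmpPt d → ℂ} {φ : PhasePt d → ℝ}

lemma dirDeriv_phase (hΦ : ContDiff ℝ ∞ Φ) (hV : IsOpen V)
    (h : ∀ z ∈ V, Φ z = φ (phasePt z)) (hz : (x, t, y, θ) ∈ V) (j : Fin d) :
    dirDeriv (Dir.x j).vec Φ (x, t, y, θ)
      = ((xpartial j (fun x' => φ (x', y, θ)) x : ℝ) : ℂ) :=
  xpartial_ofReal_slice (hΦ.differentiable (by simp) _)
    ((eventually_slice hV hz).mono fun x' hx' => h _ hx') j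

lemma dirDeriv_t_phase (hΦ : ContDiff ℝ ∞ Φ) (hV : IsOpen V)
    (h : ∀ z ∈ V, Φ z = φ (phasePt z)) (hz : (x, t, y, θ) ∈ V) :
    dirDeriv Dir.t.vec Φ (x, t, y, θ) = 0 := by
  rw [← deriv_tslice hΦ]
  have h1 : (fun s => Φ (x, s, y, θ)) =ᶠ[𝓝 t] fun _ => (φ (x, y, θ) : ℂ) :=
    (eventually_tslice hV hz).mono fun s hs => h _ hs
  rw [h1.deriv_eq, deriv_const]

lemma smooth_prevAmp {B : ℕ → AmpPt d → ℂ} (hB : ∀ n, ContDiff ℝ ∞ (B n)) (n : ℕ) :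
    ContDiff ℝ ∞ (prevAmp B n) := by
  cases n with
  | zero => exact contDiff_const
  | succ n => exact hB n

lemma prevAmp_congr {B F : ℕ → AmpPt d → ℂ} (h : ∀ n, ∀ z ∈ V, F n z = B n z) (n : ℕ) :
    ∀ z ∈ V, prevAmp F n z = prevAmp B n z := by
  cases n with
  | zero => exact fun _ _ => rfl
  | succ n => exact h n

end Slices

namespace Background

variable {d : ℕ} [NeZero d] {𝔹 : Background d} {P : SchrodingerOp d}

/-- The coefficients coincide with those of `P` near the points to be considered. -/
def Agrees (𝔹 : Background d) (P : SchrodingerOp d) : Prop :=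
  ∀ x : Sp d, ‖x‖ < 3 / 4 → (∀ j k, 𝔹.g j k x = P.g x j k) ∧ (∀ j, 𝔹.W j x = P.W x j) ∧
    𝔹.V x = P.V x

section Smooth

variable {Φ B : AmpPt d → ℂ}

lemma smooth_velFn (hΦ : ContDiff ℝ ∞ Φ) (j : Fin d) : ContDiff ℝ ∞ (𝔹.velFn Φ j) := by
  let F : smoothFam d Unit := ⟨fun _ : Unit => Φ, fun _ => hΦ⟩
  rw [← coe_vel (𝔹 := 𝔹) F () j]
  exact (Subtype.property (p := fun G => G ∈ smoothFam d Unit) _) ()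

lemma smooth_symFn (hΦ : ContDiff ℝ ∞ Φ) : ContDiff ℝ ∞ (𝔹.symFn Φ) := by
  let F : smoothFam d Unit := ⟨fun _ : Unit => Φ, fun _ => hΦ⟩
  rw [← coe_sym (𝔹 := 𝔹) F ()]
  exact (Subtype.property (p := fun G => G ∈ smoothFam d Unit) _) ()

lemma smooth_divFn (hΦ : ContDiff ℝ ∞ Φ) : ContDiff ℝ ∞ (𝔹.divFn Φ) :=
  ContDiff.sum fun j _ => (smooth_velFn hΦ j).dirDeriv _

lemma smooth_sourceFn (hB : ContDiff ℝ ∞ B) : ContDiff ℝ ∞ (𝔹.sourceFn B) := by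
  let F : smoothFam d Unit := ⟨fun _ : Unit => B, fun _ => hB⟩
  rw [← coe_source (𝔹 := 𝔹) F ()]
  exact (Subtype.property (p := fun G => G ∈ smoothFam d Unit) _) ()

lemma smooth_transportFn (hΦ : ContDiff ℝ ∞ Φ) (hB : ContDiff ℝ ∞ B) :
    ContDiff ℝ ∞ (𝔹.transportFn Φ B) :=
  (hB.dirDeriv _).sub (ContDiff.sum fun j _ =>
    (contDiff_const.mul (smooth_velFn hΦ j)).mul (hB.dirDeriv _))

end Smooth

section Comparison

variable (h𝔹 : 𝔹.Agrees P) {V : Set (AmpPt d)} (hV : IsOpen V)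
  (hVx : ∀ z ∈ V, ‖z.1‖ < 3 / 4) {Φ : AmpPt d → ℂ} {φ : PhasePt d → ℝ}
  (hΦ : ContDiff ℝ ∞ Φ) (h : ∀ z ∈ V, Φ z = φ (phasePt z)) {x : Sp d} {t : ℝ} {y θ : Sp d}
  (hz : (x, t, y, θ) ∈ V)

include h𝔹 hV hVx hΦ h hz

lemma velFn_eq (j : Fin d) :
    𝔹.velFn Φ j (x, t, y, θ) = ((P.halfVelocity φ y θ j x : ℝ) : ℂ) := by
  obtain ⟨h1, h2, -⟩ := h𝔹 x (hVx (x, t, y, θ) hz)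
  simp only [velFn, pFn, SchrodingerOp.halfVelocity, dirDeriv_phase hΦ hV h hz, h1, h2]
  push_cast
  rfl

lemma symFn_eq : 𝔹.symFn Φ (x, t, y, θ)
    = ((P.symbol x fun j => xpartial j (fun x' => φ (x', y, θ)) x : ℝ) : ℂ) := by
  obtain ⟨h1, h2, h3⟩ := h𝔹 x (hVx (x, t, y, θ) hz)
  simp only [symFn, pFn, SchrodingerOp.symbol, dirDeriv_phase hΦ hV h hz, h1, h2, h3]
  push_cast
  rfl

lemma divFn_eq : 𝔹.divFn Φ (x, t, y, θ)
    = ((∑ j, xpartial j (P.halfVelocity φ y θ j) x : ℝ) : ℂ) := by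
  rw [divFn, Complex.ofReal_sum]
  refine Finset.sum_congr rfl fun j _ => ?_
  exact xpartial_ofReal_slice ((smooth_velFn hΦ j).differentiable (by simp) _)
    ((eventually_slice hV hz).mono fun x' hx' => velFn_eq h𝔹 hV hVx hΦ h hx' j) j

lemma transportFn_eq {B F : AmpPt d → ℂ} (hF : ContDiff ℝ ∞ F) (hB : ∀ z ∈ V, F z = B z) :
    𝔹.transportFn Φ F (x, t, y, θ) = deriv (fun s => B (x, s, y, θ)) t
      - 2 * ∑ j, (P.halfVelocity φ y θ j x : ℂ) * xpartial j (fun z => B (z, t, y, θ)) x := by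
  rw [transportFn, deriv_eq_dirDeriv hF hV hB hz, Finset.mul_sum]
  congr 1
  refine Finset.sum_congr rfl fun j _ => ?_
  rw [velFn_eq h𝔹 hV hVx hΦ h hz, xpartial_eq_dirDeriv hF hV hB hz, mul_assoc]

omit hΦ h in
lemma sourceFn_eq {B F : AmpPt d → ℂ} (hF : ContDiff ℝ ∞ F) (hB : ∀ z ∈ V, F z = B z) :
    𝔹.sourceFn F (x, t, y, θ) = -Complex.I * ∑ j, xpartial j
        (fun z => ∑ k, (P.g z j k : ℂ) * xpartial k (fun w => B (w, t, y, θ)) z) x := by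
  rw [sourceFn]
  congr 1
  refine Finset.sum_congr rfl fun j _ => ?_
  have hG : ContDiff ℝ ∞ fun z' : AmpPt d =>
      ∑ k, (𝔹.g j k z'.1 : ℂ) * dirDeriv (Dir.x k).vec F z' :=
    ContDiff.sum fun k _ => (smooth_coeff (𝔹.smooth_g j k)).mul (hF.dirDeriv _)
  rw [← xpartial_slice (hG.differentiable (by simp) _), xpartial, xpartial]
  have h1 : (fun x' => ∑ k, (𝔹.g j k x' : ℂ) * dirDeriv (Dir.x k).vec F (x', t, y, θ))
      =ᶠ[𝓝 x] fun z => ∑ k, (P.g z j k : ℂ) * xpartial k (fun w => B (w, t, y, θ)) z :=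
    (eventually_slice hV hz).mono fun x' hx' => Finset.sum_congr rfl fun k _ => by
      rw [(h𝔹 x' (hVx (x', t, y, θ) hx')).1 j k, xpartial_eq_dirDeriv hF hV hB hx']
  rw [h1.fderiv_eq]

end Comparison

lemma energy_eq (h𝔹 : 𝔹.Agrees P) {x : Sp d} {t : ℝ} {y θ : Sp d} (hy : ‖y‖ < 3 / 4) :
    𝔹.energy (x, t, y, θ) = P.symbol y fun j => θ j := by
  obtain ⟨h1, h2, h3⟩ := h𝔹 y hy
  simp only [energy, SchrodingerOp.symbol, h1, h2, h3]

end Background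

/-! ### Differentiation along rays, at the boundary and in the half-space -/

lemma HasDerivWithinAt.euclidean {d : ℕ} {X : ℝ → Sp d} {v : Fin d → ℝ} {S : Set ℝ} {r : ℝ}
    (h : ∀ j, HasDerivWithinAt (fun q => X q j) (v j) S r) :
    HasDerivWithinAt X (WithLp.toLp 2 v) S r :=
  (PiLp.continuousLinearEquiv 2 ℝ fun _ : Fin d => ℝ).symm.hasFDerivAt.comp_hasDerivWithinAt r
    (hasDerivWithinAt_pi.2 h)

lemma isOpen_ampDomain {d : ℕ} {O : Set (PhasePt d)} (hO : IsOpen O) (ε : ℝ) :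
    IsOpen (ampDomain O ε) := by
  have h1 : IsOpen (phasePt ⁻¹' O) := hO.preimage contDiff_phasePt.continuous
  have h2 : IsOpen {z : AmpPt d | ‖z.1 - z.2.2.1‖ + |z.2.1| < ε} :=
    isOpen_lt (by fun_prop) continuous_const
  exact h1.inter h2

lemma vec_expansion {d : ℕ} (v : Fin d → ℝ) (c : ℝ) :
    ((WithLp.toLp 2 v, c, 0, 0) : AmpPt d) = c • Dir.t.vec + ∑ j, v j • (Dir.x j).vec := by
  have h1 : (WithLp.toLp 2 v : Sp d) = ∑ j, v j • EuclideanSpace.single j (1 : ℝ) := by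
    ext i; simp [Pi.single_apply]
  have h2 : (∑ j, v j • (Dir.x j).vec : AmpPt d)
      = (∑ j, v j • EuclideanSpace.single j (1 : ℝ), 0) := by
    refine Prod.ext ?_ ?_
    · rw [Prod.fst_sum]; rfl
    · rw [Prod.snd_sum]
      exact Finset.sum_eq_zero fun j _ => smul_zero (v j)
  rw [h2, ← h1]
  simp [Dir.vec]

/-- A curve in the space of the variables `(x, t)` acts on functions. -/
lemma hasDerivWithinAt_curve {d : ℕ} {X : ℝ → Sp d} {u : ℝ → ℝ} {v : Fin d → ℝ} {c r : ℝ}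
    {S : Set ℝ} (hX : ∀ j, HasDerivWithinAt (fun q => X q j) (v j) S r)
    (hu : HasDerivWithinAt u c S r) (y θ : Sp d) {F : AmpPt d → ℂ} (hF : ContDiff ℝ ∞ F) :
    HasDerivWithinAt (fun r => F (X r, u r, y, θ))
      (c * dirDeriv Dir.t.vec F (X r, u r, y, θ)
        + ∑ j, (v j : ℂ) * dirDeriv (Dir.x j).vec F (X r, u r, y, θ)) S r := by
  have h1 : HasDerivWithinAt (fun r => ((X r, u r, y, θ) : AmpPt d))
      (WithLp.toLp 2 v, c, 0, 0) S r :=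
    (HasDerivWithinAt.euclidean hX).prodMk (hu.prodMk (hasDerivWithinAt_const r S (y, θ)))
  have h2 : HasFDerivAt F (fderiv ℝ F (X r, u r, y, θ)) (X r, u r, y, θ) :=
    (hF.differentiable (by simp) _).hasFDerivAt
  have h3 := HasFDerivAt.comp_hasDerivWithinAt r h2 h1
  rw [vec_expansion, map_add, map_sum, map_smul] at h3
  simp only [map_smul, Complex.real_smul] at h3
  exact h3

/-- The set where the first variable vanishes is invariant in the directions which are tangential to the
boundary. -/
lemma tangential_invariant {d : ℕ} [NeZero d] {w : List (Dir d)} (hw : Dir.x 0 ∉ w) :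
    ∀ i ∈ w, ∀ z ∈ {z : AmpPt d | z.1 0 = 0}, ∀ r : ℝ, z + r • i.vec ∈ {z : AmpPt d | z.1 0 = 0} := by
  intro i hi z hz r
  have hz' : z.1 0 = 0 := hz
  change (z.1 + r • i.vec.1) 0 = 0
  rw [PiLp.add_apply, PiLp.smul_apply, hz', zero_add]
  rcases i with j | _ | j | j
  · have hj : j ≠ 0 := fun h => hw (h ▸ hi)
    simp [Dir.vec, hj.symm]
  all_goals simp [Dir.vec]

lemma convex_halfSpace (d : ℕ) [NeZero d] : Convex ℝ {z : AmpPt d | 0 ≤ z.1 0} := by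
  intro z hz z' hz' a b ha hb _
  have h1 : 0 ≤ z.1 0 := hz
  have h2 : 0 ≤ z'.1 0 := hz'
  change 0 ≤ (a • z.1 + b • z'.1) 0
  rw [PiLp.add_apply, PiLp.smul_apply, PiLp.smul_apply, smul_eq_mul, smul_eq_mul]
  positivity

/-- Together with convexity this provides unique differentiability at boundary points of the
half-space. -/
lemma interior_halfSpace_nonempty (d : ℕ) [NeZero d] :
    (interior {z : AmpPt d | 0 ≤ z.1 0}).Nonempty := by
  have h1 : IsOpen {z : AmpPt d | 0 < z.1 0} := isOpen_lt continuous_const (by fun_prop)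
  have h2 : {z : AmpPt d | 0 < z.1 0} ⊆ {z : AmpPt d | 0 ≤ z.1 0} := fun z hz =>
    le_of_lt (show 0 < z.1 0 from hz)
  refine ⟨(EuclideanSpace.single 0 1, 0, 0, 0), interior_maximal h2 h1 ?_⟩
  change 0 < (EuclideanSpace.single (0 : Fin d) (1 : ℝ)) 0
  simp

/-! ### From a reflected ray to a datum -/

namespace Background

variable {d : ℕ} [NeZero d] {𝔹 : Background d} {P : SchrodingerOp d} {τ ε δ : ℝ}
  {φ₀ : PhasePt d → ℝ}

/-- The part of the boundary conditions on a neighbourhood. -/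
lemma wordDeriv_boundary {F : AmpPt d → ℂ} {V : Set (AmpPt d)} (hF : ContDiff ℝ ∞ F)
    (hV : IsOpen V)
    (h : ∀ (x : Sp d) (t : ℝ) (y θ : Sp d), (x, t, y, θ) ∈ V → x 0 = 0 → F (x, t, y, θ) = 0)
    {w : List (Dir d)} (hw : Dir.x 0 ∉ w) {z : AmpPt d} (hz : z ∈ V) (hz0 : z.1 0 = 0) :
    wordDeriv w F z = 0 :=
  wordDeriv_eq_zero_of_line hF hV (S := {z | z.1 0 = 0}) (fun z hz => h z.1 z.2.1 _ _ hz.1 hz.2)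
    (tangential_invariant hw) z ⟨hz, hz0⟩

lemma wordDeriv_halfSpace {F : AmpPt d → ℂ} {V : Set (AmpPt d)} (hF : ContDiff ℝ ∞ F)
    (hV : IsOpen V)
    (h : ∀ (x : Sp d) (t : ℝ) (y θ : Sp d), (x, t, y, θ) ∈ V → 0 ≤ x 0 → F (x, t, y, θ) = 0)
    (w : List (Dir d)) {z : AmpPt d} (hz : z ∈ V) (hz0 : 0 ≤ z.1 0) :
    wordDeriv w F z = 0 :=
  wordDeriv_eq_zero_of_convex hF hV (convex_halfSpace d) (interior_halfSpace_nonempty d)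
    (fun z hz => h z.1 z.2.1 _ _ hz.1 hz.2) w z ⟨hz, hz0⟩

/-- The constants, indexed by words. -/
def wordConst (K : ℕ → (Fin d → ℕ) → ℕ → (Fin d → ℕ) → (Fin d → ℕ) → ℝ) (n : ℕ)
    (w : List (Dir d)) : ℝ :=
  K n (fun j => w.count (Dir.x j)) (w.count Dir.t) (fun j => w.count (Dir.y j))
    fun j => w.count (Dir.θ j)

omit [NeZero d] in
/-- Extensions of the phases and amplitudes near a ray. -/
lemma exists_extension {U R : Set (AmpPt d)} (hU : IsOpen U) (hR : IsClosed R) (hRU : R ⊆ U)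
    {ψ : AmpPt d → ℂ} (hψ : ContDiffOn ℝ ∞ ψ U) {B B₀ : ℕ → AmpPt d → ℂ}
    (hB : ∀ n, ContDiffOn ℝ ∞ (B n) U) (hB₀ : ∀ n, ContDiffOn ℝ ∞ (B₀ n) U) :
    ∃ (V : Set (AmpPt d)) (Φ : AmpPt d → ℂ) (F F₀ : ℕ → AmpPt d → ℂ), IsOpen V ∧ R ⊆ V ∧ V ⊆ U ∧
      ContDiff ℝ ∞ Φ ∧ (∀ n, ContDiff ℝ ∞ (F n)) ∧ (∀ n, ContDiff ℝ ∞ (F₀ n)) ∧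
      (∀ z ∈ V, Φ z = ψ z) ∧ (∀ n, ∀ z ∈ V, F n z = B n z) ∧ ∀ n, ∀ z ∈ V, F₀ n z = B₀ n z := by
  obtain ⟨χ, hχ, h0, V, hV, hRV, hVU, h1⟩ := exists_cutoff hR hU hRU
  have heq : ∀ (f : AmpPt d → ℂ), ∀ z ∈ V, χ z • f z = f z := fun f z hz => by
    rw [h1 z hz, one_smul]
  exact ⟨V, fun z => χ z • ψ z, fun n z => χ z • B n z, fun n z => χ z • B₀ n z, hV, hRV, hVU,
    contDiff_cutoff_smul hU hχ h0 hψ, fun n => contDiff_cutoff_smul hU hχ h0 (hB n),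
    fun n => contDiff_cutoff_smul hU hχ h0 (hB₀ n), heq _, fun n => heq _, fun n => heq _⟩

/-- The phase and the amplitudes on a ray. -/
theorem exists_datum (h𝔹 : 𝔹.Agrees P) (hδ : 0 < δ) (hδε : δ < ε) (hS : 0 ≤ 𝔹.S)
    (hY : ∃ Y, IsOpen Y ∧ 𝔹.K ⊆ Y ∧ ∀ z ∈ Y, phasePt z ∈ phaseDomain P τ ε ∧
        𝔹.φ₀ z = φ₀ (phasePt z))
    (hK : ∀ (x : Sp d) (t : ℝ) (y θ : Sp d), ‖y‖ ≤ 1 / 2 → ‖x - y‖ ≤ δ → |t| ≤ δ →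
        |P.symbol y (fun j => θ j) - τ| ≤ ε / 2 → (x, t, y, θ) ∈ 𝔹.K)
    (hbd : ∀ (x : Sp d) (ξ : Fin d → ℝ), ‖x‖ < 3 / 4 → P.symbol x ξ ≤ τ + ε / 2 → |ξ 0| ≤ 𝔹.S)
    {K : ℕ → (Fin d → ℕ) → ℕ → (Fin d → ℕ) → (Fin d → ℕ) → ℝ} {B₀ : ℕ → AmpPt d → ℂ}
    (hB₀ : IncidentAmplitudes P τ ε φ₀ K B₀) {O : Set (PhasePt d)} {φ : PhasePt d → ℝ}
    {B : ℕ → AmpPt d → ℂ} (hφ : ReflectedPhase P τ ε φ₀ O φ)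
    (hB : ReflectedAmplitudes P ε O φ B₀ B) {T σ : ℝ} {x : Sp d} {t : ℝ} {y θ : Sp d}
    (hT : 0 < T) (hσ : (𝔹.S + 1) / δ * T ≤ σ) (hy : ‖y‖ ≤ 1 / 2)
    (hE : |P.symbol y (fun j => θ j) - τ| ≤ ε / 2) (hray : OnReflectedRay P O φ T σ x t y θ) :
    ∃ D : 𝔹.AmpDatum ((𝔹.S + 1) / δ) (wordConst K), D.T = T ∧ D.σ = σ ∧
      D.z D.ℓ = (x, t, y, θ) ∧ ∀ n, D.B n =ᶠ[𝓝 (x, t, y, θ)] B n := by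
  obtain ⟨Y, hYo, hKY, hYd⟩ := hY
  obtain ⟨s, ς, X, u, hs, hς, hXs, hus, hX0, hσ_eq, hr⟩ := hray
  have h0s : (0 : ℝ) ∈ Set.Icc 0 s := ⟨le_rfl, hs⟩
  have hss : s ∈ Set.Icc 0 s := ⟨hs, le_rfl⟩
  have hC : 0 < (𝔹.S + 1) / δ := by positivity
  have hσ0 : 0 < σ := (mul_pos hC hT).trans_le hσ
  have hς1 : |ς| = 1 := by rcases hς with rfl | rfl <;> simp
  have hx34 : ∀ r ∈ Set.Icc 0 s, ‖X r‖ < 3 / 4 := fun r h => (hφ.subset (hr r h).1).1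
  -- By the eikonal equation the gradient of `φ` at the initial point has energy at most `τ + ε /
  -- 2`, which bounds its normal component.
  have hσS : σ ≤ 𝔹.S := by
    rw [hσ_eq]
    refine hbd (X 0) (fun j => xpartial j (fun z => φ (z, y, θ)) (X 0)) (hx34 0 h0s) ?_
    have h1 := hφ.eikonal _ (hr 0 h0s).1 (hr 0 h0s).2.1
    have h2 := (abs_le.1 hE).2
    have h3 : P.symbol (X 0) (fun j => xpartial j (fun z => φ (z, y, θ)) (X 0))
      = P.symbol y fun j => θ j := h1
    rw [h3]
    linarith
  -- The lower bound `(S + 1) / δ` for the ratio of `σ` to `T` is chosen for this: as `σ ≤ S`, the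
  -- ray cannot leave the compact set `K`.
  have hTδ : T ≤ δ := by
    have h1 : (𝔹.S + 1) * T ≤ 𝔹.S * δ := by
      have := hσ.trans hσS
      rwa [div_mul_eq_mul_div, div_le_iff₀ hδ] at this
    nlinarith
  have hdist : ∀ r ∈ Set.Icc 0 s, ‖X r - y‖ ≤ T ∧ |u r| ≤ T := fun r h => by
    have h1 := (hr r h).2.2.1
    have h2 := norm_nonneg (X r - y)
    have h3 := abs_nonneg (u r)
    exact ⟨by linarith, by linarith⟩
  -- Time runs with unit speed along the ray and `|t| ≤ T` on it.
  have hs2 : s ≤ 2 * T := by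
    have h1 : ‖u s - u 0‖ ≥ s := by
      have h2 : ∀ r ∈ Set.Icc 0 s, HasDerivWithinAt (fun q => u q - ς * q) 0 (Set.Icc 0 s) r :=
        fun r h =>
          ((hr r h).2.2.2.1.sub ((hasDerivWithinAt_id r (Set.Icc 0 s)).const_mul ς)).congr_deriv
            (by simp)
      have h3 := (convex_Icc 0 s).norm_image_sub_le_of_norm_hasDerivWithin_le (C := 0) h2
        (fun r _ => by simp) h0s hss
      have h4 : u s - ς * s - (u 0 - ς * 0) = 0 := by simpa using h3
      have h5 : u s - u 0 = ς * s := by linarith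
      rw [h5, norm_mul, Real.norm_eq_abs, hς1, one_mul, Real.norm_of_nonneg hs]
    have h2 := (norm_sub_le (u s) (u 0)).trans
      (add_le_add (hdist s hss).2 (hdist 0 h0s).2)
    linarith
  set z : ℝ → AmpPt d := fun r => (X r, u r, y, θ) with hz
  have hzK : ∀ r ∈ Set.Icc 0 s, z r ∈ 𝔹.K := fun r h =>
    hK (X r) (u r) y θ hy ((hdist r h).1.trans hTδ) ((hdist r h).2.trans hTδ) hE
  have hzc : ContinuousOn z (Set.Icc 0 s) := fun r h =>
    ((HasDerivWithinAt.euclidean (hr r h).2.2.2.2).continuousWithinAt).prodMk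
      ((hr r h).2.2.2.1.continuousWithinAt.prodMk continuousWithinAt_const)
  -- The image of the ray is compact, so cutoffs exist which equal 1 in a neighbourhood `V` of it.
  -- All functions are unchanged there, and the equations hold in the part `x₁ ≥ 0` of `V`.
  obtain ⟨V, Φ, F, F₀, hV, hRV, hVU, hΦ, hF, hF₀, hΦV, hFV, hF₀V⟩ := exists_extension
    (U := ampDomain O ε ∩ Y) (R := z '' Set.Icc 0 s) ((isOpen_ampDomain hφ.isOpen ε).inter hYo)
    (isCompact_Icc.image_of_continuousOn hzc).isClosed
    (by
      rintro _ ⟨r, h, rfl⟩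
      exact ⟨⟨(hr r h).1, (hr r h).2.2.1.trans_lt (hTδ.trans_lt hδε)⟩, hKY (hzK r h)⟩)
    (ψ := fun z => (φ (phasePt z) : ℂ)) (B := B) (B₀ := B₀)
    (Complex.ofRealCLM.contDiff.comp_contDiffOn
      (hφ.smooth.comp contDiff_phasePt.contDiffOn fun z hz => hz.1.1))
    (fun n => (hB.smooth n).mono fun z hz => hz.1)
    (fun n => (hB₀.smooth n).mono fun z hz => ⟨hφ.subset hz.1.1, hz.1.2⟩)
  have hzV : ∀ r ∈ Set.Icc 0 s, z r ∈ V := fun r h => hRV ⟨r, h, rfl⟩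
  have hVO : ∀ (x : Sp d) (t : ℝ) (y θ : Sp d), (x, t, y, θ) ∈ V → (x, y, θ) ∈ O :=
    fun x t y θ h => (hVU h).1.1
  have hVx : ∀ z ∈ V, ‖z.1‖ < 3 / 4 := fun z h => (hφ.subset (hVU h).1.1).1
  have hVy : ∀ (x : Sp d) (t : ℝ) (y θ : Sp d), (x, t, y, θ) ∈ V → ‖y‖ < 3 / 4 :=
    fun x t y θ h => (hφ.subset (hVO x t y θ h)).2.1
  have hφ₀V : ∀ z ∈ V, 𝔹.φ₀ z = φ₀ (phasePt z) := fun z h => (hYd z (hVU h).2).2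
  have hderiv : ∀ G : AmpPt d → ℂ, ContDiff ℝ ∞ G → ∀ r ∈ Set.Icc 0 s,
      HasDerivWithinAt (fun r => G (z r)) (ς * 𝔹.transportFn Φ G (z r)) (Set.Icc 0 s) r := by
    intro G hG r h
    refine (hasDerivWithinAt_curve (hr r h).2.2.2.2 (hr r h).2.2.2.1 y θ hG).congr_deriv ?_
    rw [transportFn, mul_sub, sub_eq_add_neg, Finset.mul_sum, ← Finset.sum_neg_distrib]
    congr 1
    refine Finset.sum_congr rfl fun j _ => ?_
    rw [velFn_eq h𝔹 hV hVx hΦ hΦV (hzV r h) j]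
    push_cast
    ring
  have heik : ∀ r ∈ Set.Icc 0 s, ∀ w,
      wordDeriv w (fun z => 𝔹.symFn Φ z - 𝔹.energy z) (z r) = 0 := by
    intro r h w
    refine wordDeriv_halfSpace ((smooth_symFn hΦ).sub 𝔹.smooth_energy) hV
      (fun x t y θ hm h0 => ?_) w (hzV r h) (hr r h).2.1
    rw [symFn_eq h𝔹 hV hVx hΦ hΦV hm, energy_eq h𝔹 (hVy x t y θ hm)]
    have h1 : P.symbol x (fun j => xpartial j (fun z => φ (z, y, θ)) x)
      = P.symbol y fun j => θ j := hφ.eikonal _ (hVO x t y θ hm) h0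
    rw [h1, sub_self]
  have hstat : ∀ r ∈ Set.Icc 0 s, ∀ w, wordDeriv w (dirDeriv Dir.t.vec Φ) (z r) = 0 := by
    intro r h w
    exact wordDeriv_halfSpace (hΦ.dirDeriv _) hV
      (fun x t y θ hm h0 => dirDeriv_t_phase hΦ hV hΦV hm) w (hzV r h) (hr r h).2.1
  have hbdry : ∀ w, Dir.x 0 ∉ w → wordDeriv w (fun z => Φ z - 𝔹.φ₀ z) (z 0) = 0 := by
    intro w hw
    refine wordDeriv_boundary (hΦ.sub 𝔹.smooth_φ₀) hV (fun x t y θ hm h0 => ?_) hw (hzV 0 h0s) hX0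
    rw [hΦV _ hm, hφ₀V _ hm]
    have h1 := hφ.boundary x y θ (hVO x t y θ hm) h0
    simp only [phasePt, h1, sub_self]
  have hrefl : ∀ w, Dir.x 0 ∉ w → wordDeriv w
      (fun z => dirDeriv (Dir.x 0).vec Φ z + dirDeriv (Dir.x 0).vec 𝔹.φ₀ z) (z 0) = 0 := by
    intro w hw
    refine wordDeriv_boundary ((hΦ.dirDeriv _).add (𝔹.smooth_φ₀.dirDeriv _)) hV
      (fun x t y θ hm h0 => ?_) hw (hzV 0 h0s) hX0
    rw [dirDeriv_phase hΦ hV hΦV hm, dirDeriv_phase 𝔹.smooth_φ₀ hV hφ₀V hm,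
      hφ.reflection x y θ (hVO x t y θ hm) h0, Complex.ofReal_neg, neg_add_cancel]
  have hσ' : σ = ‖dirDeriv (Dir.x 0).vec Φ (z 0)‖ := by
    rw [dirDeriv_phase hΦ hV hΦV (hzV 0 h0s), Complex.norm_real, hσ_eq, Real.norm_eq_abs]
  have hdom : ∀ z ∈ V, z ∈ ampDomain O ε := fun z h => (hVU h).1
  have hbound : ∀ n w, ‖wordDeriv w (F₀ n) (z 0)‖ ≤ wordConst K n w := by
    intro n w
    have h1 : F₀ n =ᶠ[𝓝 (z 0)] B₀ n := by
      filter_upwards [hV.mem_nhds (hzV 0 h0s)] with z' h using hF₀V n z' h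
    have h2 := hdom _ (hzV 0 h0s)
    -- The hypothesis on the incident amplitudes is stated for one order of differentiation; the
    -- letters of `w` are sorted accordingly.
    rw [wordDeriv_perm (perm_ampWord w) (hF₀ n), (h1.wordDeriv _).eq_of_nhds, ← ampDeriv_eq]
    exact hB₀.bounded n _ _ _ _ _ ⟨hφ.subset h2.1, h2.2⟩
  have hpF := prevAmp_congr hFV
  have hpF₀ := prevAmp_congr hF₀V
  have htrans : ∀ n, ∀ r ∈ Set.Icc 0 s, ∀ w, wordDeriv w (fun z => 𝔹.transportFn Φ (F n) z
      - (𝔹.divFn Φ z * F n z + 𝔹.sourceFn (prevAmp F n) z)) (z r) = 0 := by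
    intro n r h w
    refine wordDeriv_halfSpace ((smooth_transportFn hΦ (hF n)).sub
      (((smooth_divFn hΦ).mul (hF n)).add (smooth_sourceFn (smooth_prevAmp hF n)))) hV
      (fun x t y θ hm h0 => ?_) w (hzV r h) (hr r h).2.1
    rw [transportFn_eq h𝔹 hV hVx hΦ hΦV hm (hF n) (hFV n), divFn_eq h𝔹 hV hVx hΦ hΦV hm,
      sourceFn_eq h𝔹 hV hVx hm (smooth_prevAmp hF n) (hpF n), hFV n _ hm,
      ← hB.transport n x t y θ ⟨hdom _ hm, h0⟩]
    ring
  have hmatch : (∀ n w, Dir.x 0 ∉ w → wordDeriv w (fun z => F n z + F₀ n z) (z 0) = 0) ∨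
      ∀ n w, Dir.x 0 ∉ w → wordDeriv w (fun z =>
        (dirDeriv (Dir.x 0).vec Φ z * F n z
          - Complex.I * dirDeriv (Dir.x 0).vec (prevAmp F n) z)
        - (dirDeriv (Dir.x 0).vec Φ z * F₀ n z
          + Complex.I * dirDeriv (Dir.x 0).vec (prevAmp F₀ n) z)) (z 0) = 0 := by
    refine hB.matching.imp (fun hD n w hw => ?_) fun hN n w hw => ?_
    · refine wordDeriv_boundary ((hF n).add (hF₀ n)) hV (fun x t y θ hm h0 => ?_) hw
        (hzV 0 h0s) hX0
      rw [hFV n _ hm, hF₀V n _ hm, hD n _ (hdom _ hm) h0, neg_add_cancel]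
    · refine wordDeriv_boundary ((((hΦ.dirDeriv _).mul (hF n)).sub
        (contDiff_const.mul ((smooth_prevAmp hF n).dirDeriv _))).sub
        (((hΦ.dirDeriv _).mul (hF₀ n)).add
        (contDiff_const.mul ((smooth_prevAmp hF₀ n).dirDeriv _)))) hV (fun x t y θ hm h0 => ?_) hw
        (hzV 0 h0s) hX0
      rw [sub_eq_zero, ← xpartial_eq_dirDeriv hΦ hV hΦV hm, hFV n _ hm, hF₀V n _ hm,
        ← xpartial_eq_dirDeriv (smooth_prevAmp hF n) hV (hpF n) hm,
        ← xpartial_eq_dirDeriv (smooth_prevAmp hF₀ n) hV (hpF₀ n) hm]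
      exact hN n x t y θ (hdom _ hm) h0
  refine ⟨{ φ := Φ, smooth_φ := hΦ, ℓ := s, z := z, σ := σ, sgn := ς, T := T, ℓ_nonneg := hs,
            ℓ_le := hs2, σ_pos := hσ0, σ_le := hσS, T_le := hσ, abs_sgn := hς1, mem_K := hzK,
            deriv := hderiv, eikonal := heik, stationary := hstat, boundary := hbdry,
            reflection := hrefl, σ_eq := hσ', dist_le := (hdist 0 h0s).1, B := F, B₀ := F₀,
            smooth_B := hF, smooth_B₀ := hF₀, bound := hbound, transport := htrans,
            matching := hmatch }, rfl, rfl, ?_, fun n => ?_⟩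
  · simp only [hz, hXs, hus]
  · have h1 : (x, t, y, θ) ∈ V := by rw [← hXs, ← hus]; exact hzV s hss
    filter_upwards [hV.mem_nhds h1] with z' h using hFV n z' h

end Background

/-! ### Weights of mixed derivatives and the conclusion -/

section Weights

variable {d : ℕ} [NeZero d] (α : Fin d → ℕ) (m : ℕ) (β γ : Fin d → ℕ)

omit [NeZero d] in
lemma count_x_ampWord (j : Fin d) : (ampWord α m β γ).count (Dir.x j) = α j := by
  simp only [ampWord, List.count_append, count_multiWord, List.count_replicate]
  simp [Dir.x, Dir.t, Dir.y, Dir.θ]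

lemma sum_wt_ampWord : ((ampWord α m β γ).map Dir.wt).sum
    = γ 0 + (∑ i, β i) + m + (∑ i, α i) + α 0 := by
  have h1 : ∑ i, α i * Dir.wt (Dir.x i) = (∑ i, α i) + α 0 := by
    have : ∀ i, α i * Dir.wt (Dir.x i) = α i + if i = 0 then α i else 0 := fun i => by
      by_cases hi : i = 0 <;> simp [Dir.wt, hi, mul_two]
    simp [this, Finset.sum_add_distrib]
  have h2 : ∑ i, γ i * Dir.wt (Dir.θ i) = γ 0 := by
    have : ∀ i, γ i * Dir.wt (Dir.θ i) = if i = 0 then γ i else 0 := fun i => by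
      by_cases hi : i = 0 <;> simp [Dir.wt, hi]
    simp [this]
  have h3 : ∀ i : Fin d, β i * Dir.wt (Dir.y i) = β i := fun i => by simp [Dir.wt]
  have h4 : ((List.replicate m (Dir.t : Dir d)).map Dir.wt).sum = m := by simp [Dir.wt]
  simp only [ampWord, List.map_append, List.sum_append, sum_map_multiWord, h1, h2, h3, h4]
  ring

lemma sum_wt_le : ((ampWord α m β γ).map Dir.wt).sum ≤ α 0 + totalOrder α m β γ := by
  have : γ 0 ≤ ∑ i, γ i :=
    Finset.single_le_sum (f := γ) (fun _ _ => Nat.zero_le _) (Finset.mem_univ 0)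
  rw [sum_wt_ampWord, totalOrder]
  omega

variable {γ} in
-- A derivative in some `θ_j`, `j ≠ 0`, is counted in the total order but has weight 0; this saves a
-- power of `σ`.
lemma sum_wt_lt {j : Fin d} (hj : j ≠ 0) (hγ : 1 ≤ γ j) :
    ((ampWord α m β γ).map Dir.wt).sum < α 0 + totalOrder α m β γ := by
  have : γ 0 + γ j ≤ ∑ i, γ i := by
    rw [← Finset.sum_pair hj.symm]
    exact Finset.sum_le_sum_of_subset (Finset.subset_univ _)
  rw [sum_wt_ampWord, totalOrder]
  omega

end Weights

/-- The weight of a word may be smaller than the exponent in the assertion. As `σ` is bounded by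
`M`, the surplus powers are absorbed in a constant, whose exponent `k` does not depend on `σ`. -/
lemma zpow_le_mul_zpow {σ M : ℝ} (hσ : 0 < σ) (hσM : σ ≤ M) (hM : 1 ≤ M) {a b : ℤ} {k : ℕ}
    (hba : b ≤ a) (hab : a ≤ b + k) : σ ^ a ≤ M ^ k * σ ^ b := by
  obtain ⟨l, rfl⟩ := Int.le.dest hba
  rw [zpow_add₀ hσ.ne', zpow_natCast, mul_comm]
  gcongr
  calc σ ^ l ≤ M ^ l := by gcongr
    _ ≤ M ^ k := pow_le_pow_right₀ hM (by omega)

theorem proposition5p4 {d : ℕ} [NeZero d] (P : SchrodingerOp d) (τ ε₀ ε : ℝ)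
    (hε₀ : 0 < ε₀) (hε : 0 < ε)
    (hP : ∀ x ∈ Metric.ball (0 : Sp d) 1, P.symbol x (fun _ => 0) < τ - ε₀)
    (φ₀ : PhasePt d → ℝ) (hφ₀ : IncidentPhase P τ ε φ₀) :
    ∃ C₀ : ℝ, 0 < C₀ ∧
      ∀ (K : ℕ → (Fin d → ℕ) → ℕ → (Fin d → ℕ) → (Fin d → ℕ) → ℝ)
        (n : ℕ) (α : Fin d → ℕ) (m : ℕ) (β γ : Fin d → ℕ),
      ∃ C : ℝ, ∀ (B₀ : ℕ → AmpPt d → ℂ), IncidentAmplitudes P τ ε φ₀ K B₀ →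
        ∀ (O : Set (PhasePt d)) (φ : PhasePt d → ℝ) (B : ℕ → AmpPt d → ℂ),
          ReflectedPhase P τ ε φ₀ O φ → ReflectedAmplitudes P ε O φ B₀ B →
        ∀ (T σ : ℝ) (x : Sp d) (t : ℝ) (y θ : Sp d),
          0 < T → C₀ * T ≤ σ → ‖y‖ ≤ 1 / 2 → 0 ≤ y 0 →
          |P.symbol y (fun j => θ j) - τ| ≤ ε / 2 →
          OnReflectedRay P O φ T σ x t y θ →
          (α 0 = 0 ∧ n = 0 →
            ‖ampDeriv α m β γ (B n) (x, t, y, θ)‖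
              ≤ C * (1 + T * σ ^ (-1 - (totalOrder α m β γ : ℤ)))) ∧
          (1 ≤ α 0 + n →
            ‖ampDeriv α m β γ (B n) (x, t, y, θ)‖
              ≤ C * σ ^ (-3 * (n : ℤ) - (α 0 : ℤ) - (totalOrder α m β γ : ℤ))) ∧
          ((∃ j, j ≠ 0 ∧ 1 ≤ γ j) →
            (α 0 = 0 ∧ n = 0 →
              ‖ampDeriv α m β γ (B n) (x, t, y, θ)‖
                ≤ C * (1 + T * σ ^ (-(totalOrder α m β γ : ℤ)))) ∧
            (1 ≤ α 0 + n →
              ‖ampDeriv α m β γ (B n) (x, t, y, θ)‖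
                ≤ C * σ ^ (1 - 3 * (n : ℤ) - (α 0 : ℤ) - (totalOrder α m β γ : ℤ)))) := by

  obtain ⟨𝔹, δ, hδ, hδε, hS, h𝔹, hY, hK, hbd⟩ := exists_background P hε hφ₀
  have hC : 0 < (𝔹.S + 1) / δ := by positivity
  obtain ⟨C₀, hC₀, A, hA⟩ := 𝔹.exists_constant hC
  refine ⟨C₀, hC.trans_le hC₀, fun K n α m β γ => ?_⟩
  obtain ⟨A', hA'0, hA'⟩ :=
    Background.amplitude_bounds hA hC (Background.wordConst K) n (ampWord α m β γ)
  have hM : 1 ≤ max 1 𝔹.S := le_max_left _ _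
  -- The largest discrepancy between the weight and the asserted exponents is at most `α 0 +
  -- totalOrder α m β γ`, so one constant covers all four estimates.
  refine ⟨A' * max 1 𝔹.S ^ (α 0 + totalOrder α m β γ), fun B₀ hB₀ O φ B hφ hB T σ x t y θ hT hσ hy _
    hE hray => ?_⟩
  have hσ' : (𝔹.S + 1) / δ * T ≤ σ := (mul_le_mul_of_nonneg_right hC₀ hT.le).trans hσ
  obtain ⟨D, hDT, hDσ, hDz, hDB⟩ := Background.exists_datum h𝔹 hδ hδε hS hY hK hbd hB₀ hφ hB hT hσ'
    hy hE hray
  have hσ0 : 0 < σ := hDσ ▸ D.σ_pos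
  have hσM : σ ≤ max 1 𝔹.S := le_trans (hDσ ▸ D.σ_le) (le_max_right _ _)
  obtain ⟨hb1, hb2⟩ := hA' D (by rwa [hDT, hDσ]) D.ℓ ⟨D.ℓ_nonneg, le_rfl⟩
  rw [hDz, hDσ, ((hDB n).wordDeriv _).eq_of_nhds, ← ampDeriv_eq] at hb1
  rw [hDz, hDσ, hDT, ((hDB n).wordDeriv _).eq_of_nhds, ← ampDeriv_eq] at hb2
  have hwt := sum_wt_le α m β γ
  have hN : Dir.x 0 ∉ ampWord α m β γ ↔ α 0 = 0 := by
    rw [← List.count_eq_zero, count_x_ampWord]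
  have hwt' : (∃ j, j ≠ 0 ∧ 1 ≤ γ j) →
      ((ampWord α m β γ).map Dir.wt).sum < α 0 + totalOrder α m β γ :=
    fun ⟨_, hj, hγ⟩ => sum_wt_lt α m β hj hγ
  generalize ((ampWord α m β γ).map Dir.wt).sum = s at *
  generalize totalOrder α m β γ = N at *
  have hpow : ∀ b : ℤ, b ≤ -3 * (n : ℤ) - (s : ℤ) → -3 * (n : ℤ) - (s : ℤ) ≤ b + (α 0 + N : ℕ) →
      ‖ampDeriv α m β γ (B n) (x, t, y, θ)‖ ≤ A' * max 1 𝔹.S ^ (α 0 + N) * σ ^ b := by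
    intro b h1 h2
    rw [mul_assoc]
    exact hb1.trans (mul_le_mul_of_nonneg_left (zpow_le_mul_zpow hσ0 hσM hM h1 h2) hA'0)
  have htan : α 0 = 0 ∧ n = 0 → ∀ b : ℤ, b ≤ -1 - (s : ℤ) → -1 - (s : ℤ) ≤ b + (α 0 + N : ℕ) →
      ‖ampDeriv α m β γ (B n) (x, t, y, θ)‖
        ≤ A' * max 1 𝔹.S ^ (α 0 + N) * (1 + T * σ ^ b) := by
    intro h0 b h1 h2
    refine (hb2 h0.2 (hN.2 h0.1)).trans ?_
    rw [mul_assoc]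
    refine mul_le_mul_of_nonneg_left ?_ hA'0
    have h3 := zpow_le_mul_zpow hσ0 hσM hM h1 h2
    have h4 : 1 ≤ max 1 𝔹.S ^ (α 0 + N) := one_le_pow₀ hM
    calc 1 + T * σ ^ (-1 - (s : ℤ))
        ≤ max 1 𝔹.S ^ (α 0 + N) + T * (max 1 𝔹.S ^ (α 0 + N) * σ ^ b) := by gcongr
      _ = _ := by ring
  refine ⟨fun h => htan h _ ?_ ?_, fun _ => hpow _ ?_ ?_, fun hγ =>
    ⟨fun h => htan h _ ?_ ?_, fun _ => hpow _ ?_ ?_⟩⟩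
  -- What remains is the comparison of exponents: `s ≤ α 0 + N`, with strict inequality if a
  -- derivative in `θ'` is present.
  all_goals first | (have := hwt' hγ; omega) | omega
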